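/- Let $M=\mathbb Z^n$, $M_{\mathbb R}=\mathbb R^n$. A lattice polytope is the convex hull of a nonempty finite subset of $M$; its toric variety is the complex projective toric variety $X_\Delta=\operatorname{Proj}\bigoplus_{k\ge 0}\mathbb C[k\Delta\cap M]$, i.e. the toric variety of the normal fan when $\Delta$ is $n$-dimensional. The primary vector at $p$ of an edge ending at $p$ is the primitive vector of $M$ pointing from $p$ along the edge. A lattice polytope is simplicial if at each vertex there are exactly $n$ edges and their primary vectors span $M_{\mathbb R}$; it is non-singular at a vertex if the primary vectors there span $M$. Let $\Delta$ be a simplicial lattice polytope and let $\Gamma$ be a partition of $\Delta$ into finitely many simplicial lattice polytopes $\Delta_j$ with pairwise disjoint interiors. The faces of $\Gamma$ are the nonempty faces of the $\Delta_j$; its vertices are the vertices of the $\Delta_j$ that are not vertices of $\Delta$. Assume the following. (i) $\Gamma$ is semi-stable: if $\sigma$ is an $l$-dimensional face of some $\Delta_j$ (vertices of $\Delta$ included) whose relative interior lies in the relative interior of a $k$-dimensional face $\tau$ of $\Delta$, then exactly $k-l+1$ of the polytopes $\Delta_j$ have $\sigma$ as a face. Let $K_\Gamma$ be the dual simplicial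 complex: its vertices are the $\Delta_j$, and each face $\sigma$ of $\Gamma$ whose relative interior lies in the interior of $\Delta$ gives the simplex $\{\Delta_j : \sigma \text{ is a face of } \Delta_j\}$. (ii) $\Gamma$ is mildly singular: it is balanced, i.e. for every vertex $p$ of $\Gamma$, with $\tau$ the face of $\Delta$ containing $p$ in its relative interior, the primary vectors at $p$ of the edges of $\Gamma$ that lie in $\tau$ and end at $p$ add up to $0$; and every maximal vertex of $\Gamma$, i.e. every vertex of $\Gamma$ in the relative interior of a face of $\Delta$ of dimension $\dim K_\Gamma$, is non-singular in some $\Delta_j$ having it as a vertex. (iii) Whenever three distinct polytopes $\Delta_i,\Delta_j,\Delta_k$ have a common point, they have a common point that is a vertex of $\Gamma$ and is non-singular in some subpolytope having it as a vertex. (This follows from (i) and (ii) if all maximal simplices of $K_\Gamma$ have the same dimension.) Then there is a weak semi-stable degeneration $p:\widetilde X\to\mathbb C$ of $X_\Delta$, that is: $\widetilde X$ is an integral scheme (possibly singular); $p$ is a proper flat morphism to the affine line over $\mathbb C$ which is toroidal, i.e. for some open $U\subseteq\widetilde X$ the triple $(\widetilde X,U,p)$ is étale locally, at every point, a normal affine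 toric variety with its open torus and the morphism to $\mathbb C$ given by a regular character; all fibers $p^{-1}(a)$, $a\in\mathbb C$, are reduced; and $p^{-1}(\mathbb C\setminus\{0\})\cong X_\Delta\times(\mathbb C\setminus\{0\})$ over $\mathbb C\setminus\{0\}$. Moreover there is a bijection $\Delta_j\mapsto X_j$ from the polytopes of $\Gamma$ to the irreducible components of the central fiber $p^{-1}(0)$ such that each $X_j$, with its reduced structure, is isomorphic over $\mathbb C$ to the toric variety $X_{\Delta_j}$, and which identifies $K_\Gamma$ with the dual complex of $p^{-1}(0)$: a nonempty set of polytopes of $\Gamma$ is a simplex of $K_\Gamma$ if and only if the corresponding components have a common point. -/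

import Mathlib

open CategoryTheory CategoryTheory.Limits AlgebraicGeometry Polynomial
open scoped Pointwise

noncomputable section

/-! ## Lattice polytopes in `M_ℝ = ℝⁿ`, `M = ℤⁿ` -/

/-- The inclusion of the lattice `M = ℤⁿ` into `M_ℝ = ℝⁿ`. -/
def latticeToReal {n : ℕ} (m : Fin n → ℤ) : Fin n → ℝ := fun i => (m i : ℝ)

/-- A (nonempty, compact) lattice polytope in `ℝⁿ`: the convex hull of finitely many points of
the lattice `ℤⁿ`. -/
structure LatticePolytope (n : ℕ) where
  carrier : Set (Fin n → ℝ)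
  exists_points : ∃ V : Finset (Fin n → ℤ),
    V.Nonempty ∧ carrier = convexHull ℝ (latticeToReal '' (V : Set (Fin n → ℤ)))

/-- `F` is a nonempty (closed) face of `A`, i.e. the intersection of `A` with a supporting
hyperplane, or `A` itself. -/
def IsPolytopeFace {n : ℕ} (A F : Set (Fin n → ℝ)) : Prop :=
  IsExposed ℝ A F ∧ F.Nonempty

/-- The dimension of (the affine span of) a subset of `ℝⁿ`. -/
def faceDim {n : ℕ} (F : Set (Fin n → ℝ)) : ℕ :=
  Module.finrank ℝ (vectorSpan ℝ F)

/-- `v` is the primary vector at `p` of an edge `E` ending at `p`: the primitive lattice vector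
pointing from `p` along `E`. -/
def IsPrimaryVector {n : ℕ} (E : Set (Fin n → ℝ)) (p : Fin n → ℝ) (v : Fin n → ℤ) : Prop :=
  (∀ (k : ℤ) (w : Fin n → ℤ), v = k • w → IsUnit k) ∧
    ∃ ε : ℝ, 0 < ε ∧ p + ε • latticeToReal v ∈ E

namespace LatticePolytope

variable {n : ℕ}

/-- The nonempty faces of `P` (including `P` itself). -/
def IsFace (P : LatticePolytope n) (F : Set (Fin n → ℝ)) : Prop :=
  IsPolytopeFace P.carrier F

/-- The vertices (`0`-faces) of `P`. -/
def IsVertex (P : LatticePolytope n) (p : Fin n → ℝ) : Prop :=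
  P.IsFace {p}

/-- The edges (`1`-faces) of `P` ending at `p`. -/
def edgesAt (P : LatticePolytope n) (p : Fin n → ℝ) : Set (Set (Fin n → ℝ)) :=
  {E | P.IsFace E ∧ faceDim E = 1 ∧ IsPolytopeFace E {p}}

/-- The primary vectors of the edges of `P` at `p`. -/
def primaryVectors (P : LatticePolytope n) (p : Fin n → ℝ) : Set (Fin n → ℤ) :=
  {v | ∃ E ∈ P.edgesAt p, IsPrimaryVector E p v}

/-- `P` is simplicial: there are exactly `n` edges at each vertex, and their primary vectors span
`M_ℝ`. -/
def IsSimplicial (P : LatticePolytope n) : Prop :=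
  ∀ p, P.IsVertex p → (P.edgesAt p).ncard = n ∧
    Submodule.span ℝ (latticeToReal '' P.primaryVectors p) = ⊤

/-- `P` is non-singular at `p`: the primary vectors at `p` span the lattice. -/
def NonsingularAt (P : LatticePolytope n) (p : Fin n → ℝ) : Prop :=
  Submodule.span ℤ (P.primaryVectors p) = ⊤

theorem carrier_nonempty (P : LatticePolytope n) : P.carrier.Nonempty := by
  obtain ⟨V, hV, h⟩ := P.exists_points
  rw [h, convexHull_nonempty_iff]
  exact (Finset.coe_nonempty.2 hV).image _

theorem carrier_convex (P : LatticePolytope n) : Convex ℝ P.carrier := by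
  obtain ⟨V, -, h⟩ := P.exists_points
  rw [h]
  exact convex_convexHull _ _

/-! ## The toric variety of a lattice polytope -/

/-- The monoid of lattice points of the cone over `P`: pairs `(m, k)` with `m ∈ k P ∩ M`. -/
def coneMonoid (P : LatticePolytope n) : AddSubmonoid ((Fin n → ℤ) × ℕ) where
  carrier := {x | latticeToReal x.1 ∈ (x.2 : ℝ) • P.carrier}
  zero_mem' := by
    obtain ⟨y, hy⟩ := P.carrier_nonempty
    refine ⟨y, hy, ?_⟩
    ext i
    simp [latticeToReal]
  add_mem' := by
    rintro ⟨a, k⟩ ⟨b, l⟩ ha hb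
    have ha' : latticeToReal a ∈ (k : ℝ) • P.carrier := ha
    have hb' : latticeToReal b ∈ (l : ℝ) • P.carrier := hb
    have h := Set.add_mem_add ha' hb'
    rw [← P.carrier_convex.add_smul (Nat.cast_nonneg k) (Nat.cast_nonneg l)] at h
    have e : latticeToReal ((a, k) + (b, l) : (Fin n → ℤ) × ℕ).1
        = latticeToReal a + latticeToReal b := by
      ext i
      simp [latticeToReal]
    change latticeToReal ((a, k) + (b, l) : (Fin n → ℤ) × ℕ).1 ∈ ((k + l : ℕ) : ℝ) • P.carrier
    rw [e]
    simpa using h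

/-- The degree `(m, k) ↦ k` on the cone monoid. -/
def coneDegree (P : LatticePolytope n) : P.coneMonoid →+ ℕ :=
  (AddMonoidHom.snd (Fin n → ℤ) ℕ).comp P.coneMonoid.subtype

/-- The grading of the polytope algebra `ℂ[cone(P) ∩ (M × ℕ)]`; its degree `k` part has the
characters `χᵐ`, `m ∈ k P ∩ M`, as a basis. -/
abbrev coneGrading (P : LatticePolytope n) :
    ℕ → Submodule ℂ (AddMonoidAlgebra ℂ P.coneMonoid) :=
  AddMonoidAlgebra.gradeBy ℂ P.coneDegree

/-- The complex projective toric variety `X_P = Proj ⨁ₖ ℂ[k P ∩ M]` of the polytope `P`. It is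
covered by the affine toric varieties `Spec ℂ[cone(P - v) ∩ M]` at the vertices `v` of `P`, glued
as prescribed by the normal fan of `P`. -/
def toricVariety (P : LatticePolytope n) : Scheme :=
  Proj P.coneGrading

/-- The structure morphism of `X_P` over `Spec ℂ`. -/
def toricStructure (P : LatticePolytope n) : P.toricVariety ⟶ Spec (CommRingCat.of ℂ) :=
  Proj.toSpecZero P.coneGrading ≫
    Spec.map (CommRingCat.ofHom (algebraMap ℂ (P.coneGrading 0)))

end LatticePolytope

/-! ## Semi-stable partitions -/

/-- A simplicial partition of the polytope `P`: finitely many simplicial lattice polytopes with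
pairwise disjoint interiors whose union is `P`. -/
structure SimplicialPartition {n : ℕ} (P : LatticePolytope n) (ι : Type*) where
  piece : ι → LatticePolytope n
  simplicial : ∀ j, (piece j).IsSimplicial
  union_eq : ⋃ j, (piece j).carrier = P.carrier
  disjoint_interior : ∀ i j, i ≠ j →
    Disjoint (interior (piece i).carrier) (interior (piece j).carrier)

namespace SimplicialPartition

variable {n : ℕ} {P : LatticePolytope n} {ι : Type*}

/-- The faces of the subpolytopes. -/
def IsFace (Γ : SimplicialPartition P ι) (σ : Set (Fin n → ℝ)) : Prop :=
  ∃ j, (Γ.piece j).IsFace σ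

/-- The vertices of the partition: vertices of subpolytopes that are not vertices of `P`. -/
def IsVertex (Γ : SimplicialPartition P ι) (p : Fin n → ℝ) : Prop :=
  Γ.IsFace {p} ∧ ¬ P.IsVertex p

/-- The subpolytopes that have `σ` as a face. -/
def piecesAt (Γ : SimplicialPartition P ι) (σ : Set (Fin n → ℝ)) : Set ι :=
  {j | (Γ.piece j).IsFace σ}

/-- Semi-stability: if the `l`-face `σ` of a subpolytope lies in the (relatively open) `k`-face
`τ` of `P`, then exactly `k - l + 1` subpolytopes have `σ` as a face. -/
def IsSemistable (Γ : SimplicialPartition P ι) : Prop :=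
  ∀ σ τ, Γ.IsFace σ → P.IsFace τ → intrinsicInterior ℝ σ ⊆ intrinsicInterior ℝ τ →
    (Γ.piecesAt σ).ncard + faceDim σ = faceDim τ + 1

/-- The dual simplicial complex `K_Γ`, given by the vertex sets of its simplices: every face `σ` of
the partition lying in the interior of `P` gives the simplex of all subpolytopes having `σ` as a
face. -/
def dualComplex (Γ : SimplicialPartition P ι) : Set (Set ι) :=
  {S | ∃ σ, Γ.IsFace σ ∧ intrinsicInterior ℝ σ ⊆ interior P.carrier ∧ S = Γ.piecesAt σ}

/-- The dimension of `K_Γ`. -/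
def dualDim (Γ : SimplicialPartition P ι) : ℕ :=
  sSup {d | ∃ S ∈ Γ.dualComplex, S.ncard = d + 1}

/-- The primary vectors at `p` of the edges of the partition that lie in the face `τ` of `P`. -/
def primaryVectorsIn (Γ : SimplicialPartition P ι) (τ : Set (Fin n → ℝ)) (p : Fin n → ℝ) :
    Set (Fin n → ℤ) :=
  {v | ∃ j, ∃ E ∈ (Γ.piece j).edgesAt p, E ⊆ τ ∧ IsPrimaryVector E p v}

/-- The vertex `p` is balanced: if `τ` is the face of `P` with `p` in its relative interior, the
primary vectors at `p` of the edges of `Γ ∩ τ` satisfy the relation with all weights `1`. -/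
def BalancedAt (Γ : SimplicialPartition P ι) (p : Fin n → ℝ) : Prop :=
  ∀ τ, P.IsFace τ → p ∈ intrinsicInterior ℝ τ → ∑ᶠ v ∈ Γ.primaryVectorsIn τ p, v = 0

/-- Every vertex of the partition is balanced. -/
def IsBalanced (Γ : SimplicialPartition P ι) : Prop :=
  ∀ p, Γ.IsVertex p → Γ.BalancedAt p

/-- The vertex `p` is non-singular in some subpolytope having it as a vertex. -/
def NonsingularAt (Γ : SimplicialPartition P ι) (p : Fin n → ℝ) : Prop :=
  ∃ j, (Γ.piece j).IsVertex p ∧ (Γ.piece j).NonsingularAt p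

/-- The maximal vertices: those lying in some (relatively open) `l`-face of `P`,
where `l = dim K_Γ`. -/
def IsMaximalVertex (Γ : SimplicialPartition P ι) (p : Fin n → ℝ) : Prop :=
  Γ.IsVertex p ∧ ∃ τ, P.IsFace τ ∧ faceDim τ = Γ.dualDim ∧ p ∈ intrinsicInterior ℝ τ

/-- A balanced partition is mildly singular if all its maximal vertices are non-singular. -/
def IsMildlySingular (Γ : SimplicialPartition P ι) : Prop :=
  Γ.IsBalanced ∧ ∀ p, Γ.IsMaximalVertex p → Γ.NonsingularAt p

/-- Any three distinct subpolytopes that meet have a common non-singular vertex. -/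
def TriplesMeetAtNonsingularVertex (Γ : SimplicialPartition P ι) : Prop :=
  ∀ i j k, i ≠ j → j ≠ k → i ≠ k →
    ((Γ.piece i).carrier ∩ (Γ.piece j).carrier ∩ (Γ.piece k).carrier).Nonempty →
    ∃ p ∈ (Γ.piece i).carrier ∩ (Γ.piece j).carrier ∩ (Γ.piece k).carrier,
      Γ.IsVertex p ∧ Γ.NonsingularAt p

end SimplicialPartition

/-! ## Weak semi-stable degenerations over the affine line -/

/-- The complex affine line `Spec ℂ[t]`. -/
abbrev complexLine : Scheme := Spec (CommRingCat.of ℂ[X])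

/-- The structure morphism of the affine line. -/
def complexLineStructure : complexLine ⟶ Spec (CommRingCat.of ℂ) :=
  Spec.map (CommRingCat.ofHom (algebraMap ℂ ℂ[X]))

/-- The closed point `t = a` of the affine line. -/
def complexLinePoint (a : ℂ) : Spec (CommRingCat.of ℂ) ⟶ complexLine :=
  Spec.map (CommRingCat.ofHom (Polynomial.evalRingHom a))

/-- The inclusion of the punctured line `Spec ℂ[t, t⁻¹]` into the affine line. -/
def puncturedLineι : Spec (CommRingCat.of (LaurentPolynomial ℂ)) ⟶ complexLine :=
  Spec.map (CommRingCat.ofHom (algebraMap ℂ[X] (LaurentPolynomial ℂ)))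

/-- The scheme-theoretic fiber `p⁻¹(a)`. -/
def fiberOver {Y : Scheme} (p : Y ⟶ complexLine) (a : ℂ) : Scheme :=
  pullback p (complexLinePoint a)

/-- The structure morphism of the fiber `p⁻¹(a)` over `Spec ℂ`. -/
def fiberStructure {Y : Scheme} (p : Y ⟶ complexLine) (a : ℂ) :
    fiberOver p a ⟶ Spec (CommRingCat.of ℂ) :=
  pullback.snd p (complexLinePoint a)

/-- The monoids `S = σ^∨ ∩ ℤᵈ` of the (normal) affine toric varieties `Spec ℂ[S]` with torus
`Spec ℂ[ℤᵈ]`: finitely generated, saturated, and generating `ℤᵈ` as a group. -/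
def IsToricMonoid {d : ℕ} (S : AddSubmonoid (Fin d → ℤ)) : Prop :=
  S.FG ∧ AddSubgroup.closure (S : Set (Fin d → ℤ)) = ⊤ ∧
    ∀ (k : ℕ) (m : Fin d → ℤ), 0 < k → k • m ∈ S → m ∈ S

/-- The affine toric variety `Spec ℂ[S]`. -/
abbrev affineToric {d : ℕ} (S : AddSubmonoid (Fin d → ℤ)) : Scheme :=
  Spec (CommRingCat.of (AddMonoidAlgebra ℂ S))

/-- The open torus of `Spec ℂ[S]`, as the image of `Spec ℂ[ℤᵈ]`. -/
def torusIn {d : ℕ} (S : AddSubmonoid (Fin d → ℤ)) : Set (affineToric S) :=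
  Set.range (Spec.map (CommRingCat.ofHom
    (AddMonoidAlgebra.mapDomainRingHom ℂ S.subtype) :
      CommRingCat.of (AddMonoidAlgebra ℂ S) ⟶ CommRingCat.of (AddMonoidAlgebra ℂ (Fin d → ℤ))))

/-- The toric morphism `Spec ℂ[S] → 𝔸¹` given by the character `t = χᵐ`. -/
def characterMap {d : ℕ} (S : AddSubmonoid (Fin d → ℤ)) (m : S) : affineToric S ⟶ complexLine :=
  Spec.map (CommRingCat.ofHom
    (Polynomial.aeval (R := ℂ) (AddMonoidAlgebra.single m (1 : ℂ))).toRingHom)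

/-- The morphism `p` is toroidal at `y` with respect to the open set `U ⊆ Y` (and the punctured
line in `𝔸¹`): étale locally at `y`, the triple `(Y, U, p)` is an affine toric variety with its
torus and a character. -/
def IsToroidalAt {Y : Scheme} (p : Y ⟶ complexLine) (U : Y.Opens) (y : Y) : Prop :=
  ∃ (d : ℕ) (S : AddSubmonoid (Fin d → ℤ)) (m : S) (W : Scheme) (f : W ⟶ Y)
    (g : W ⟶ affineToric S),
    IsToricMonoid S ∧ Etale f ∧ Etale g ∧ y ∈ Set.range f ∧
      f ⁻¹' (U : Set Y) = g ⁻¹' (torusIn S) ∧ f ≫ p = g ≫ characterMap S m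

/-- A weakly semi-stable family over the affine line: a proper flat toroidal morphism from a
complex variety, all of whose fibers are reduced. The total space may be singular. -/
structure IsWeaklySemistable {Y : Scheme} (p : Y ⟶ complexLine) : Prop where
  integral : IsIntegral Y
  proper : IsProper p
  flat : Flat p
  reduced_fibers : ∀ a : ℂ, IsReduced (fiberOver p a)
  toroidal : ∃ U : Y.Opens, ∀ y, IsToroidalAt p U y

/-- `p` is a weak semi-stable degeneration of the complex variety `X`: it is weakly semi-stable,
and away from `t = 0` it is the product family with fiber `X`. -/
def IsWeakSemistableDegeneration {Y X : Scheme} (p : Y ⟶ complexLine)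
    (s : X ⟶ Spec (CommRingCat.of ℂ)) : Prop :=
  IsWeaklySemistable p ∧
    ∃ e : pullback p puncturedLineι ≅ pullback s (puncturedLineι ≫ complexLineStructure),
      e.hom ≫ pullback.snd s (puncturedLineι ≫ complexLineStructure)
        = pullback.snd p puncturedLineι

/-- An irreducible component of `Z` with its reduced induced scheme structure. -/
def reducedComponent {Z : Scheme} (C : irreducibleComponents Z) : Scheme :=
  (Scheme.IdealSheafData.vanishingIdeal
    (⟨C.1, isClosed_of_mem_irreducibleComponents C.1 C.2⟩ : TopologicalSpace.Closeds Z)).subscheme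

/-- The inclusion of an irreducible component. -/
def reducedComponentι {Z : Scheme} (C : irreducibleComponents Z) : reducedComponent C ⟶ Z :=
  (Scheme.IdealSheafData.vanishingIdeal
    (⟨C.1, isClosed_of_mem_irreducibleComponents C.1 C.2⟩ : TopologicalSpace.Closeds Z)).subschemeι

/-- The dual complex of `Z`: a vertex for every irreducible component, and a simplex for every
nonempty finite set of components with nonempty intersection. -/
def componentDualComplex (Z : Scheme) : Set (Set (irreducibleComponents Z)) :=
  {T | T.Nonempty ∧ T.Finite ∧ (⋂ C ∈ T, (C : Set Z)).Nonempty}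

end

/-!
The degeneration is a Mumford degeneration: it is the projective toric family attached to the
unbounded polyhedron above the graph of a convex piecewise linear function on `Δ`, integral on each
`Δ_j`, whose domains of linearity are the `Δ_j`. The proof constructs the function from the
hypotheses on the partition, and then reads the asserted properties off the monoid of lattice points
of the cone over the polyhedron.

*The function.* Semi-stability makes the partition locally at a point look like the partition of
affine space by the maximum of affinely independent functions: polytopes `Δ_j ≠ Δ_k` that meet, meet
in a common facet (`SimplicialPartition.IsSemistable.exists_facet_equiv`), and this wall has a
unique equation `f_jk` with primitive integral linear part which is nonnegative on `Δ_j`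
(`SimplicialPartition.IsSemistable.exists_isWallForm`). If `f_jk = g_j - g_k` for integral affine
functions `g_j`, then the maximum of the `g_j` is the function wanted. So the `f_jk` must form a
cocycle, and the cocycle must be a coboundary.

At a vertex `p` of the partition which is non-singular in some polytope, the balancing condition and
the unimodularity of that polytope give integral functions `g_j` with `f_jk = g_j - g_k` for all
polytopes at `p` (`SimplicialPartition.IsSemistable.exists_wallForm_eq_sub`); hence the cocycle
relation holds for every triple of polytopes that meet at such a vertex, which is every triple that
meets at all (`SimplicialPartition.IsSemistable.exists_wallForm_cocycle`). A cocycle of constants on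
a finite closed convex cover of a bounded convex set is a coboundary: it is one on small boxes,
whose points lie in polytopes with a common point, and trivializations on the two sides of a
hyperplane glue (`exists_sub_eq_of_cocycle`). The resulting functions satisfy `g_k ≤ g_j` on `Δ_j`
when `Δ_j` and `Δ_k` meet, and convexity along segments extends this to all pairs
(`le_of_forall_adjacent_le`, `mem_of_eq_of_forall_adjacent`).

*The family.* Let `N` be the monoid of the `((m, l), k)` with `(m, k)` in the cone over `Δ` and `l`
at least the homogenized maximum of the `g_j` at `(m, k)` (`totalMonoid`). The total space is `Proj
ℂ[N]`, graded by `k`, and the parameter `t` is the character `((0, 1), 0)` of degree zero. As `Δ`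
and the `Δ_j` may be singular, `N` need not be generated in degree one; but a positive multiple of
each element of positive degree is the sum of an element of degree one and an element of `N`
(`IsCoveredInDegreeOne`), so that the charts `Spec ℂ[N_w]` at the degree one elements `(w, 1)` cover
the total space. Each chart is a normal affine toric variety on which `t` is a character. This gives
a toroidal morphism (`isToroidalAt_structureMap_paramHom`), which is flat as `ℂ[t]` is a principal
ideal domain, and proper because the degree zero part of `ℂ[N]` is `ℂ[t]`. Inverting `t` turns `N`
into the product of the cone monoid of `Δ` with `ℤ`, because `((m, l), k)` belongs to `N` for every
`(m, k)` in the cone and all large `l`; base change along `Spec ℂ[t, t⁻¹]` therefore gives the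
product of `X_Δ` with the punctured line (`isPullback_invert`, `isPullback_product`).

*The central fiber.* The elements of `N` on the graph of `g_j` over the cone on `Δ_j` form a face of
`N` isomorphic to the monoid of `X_{Δ_j}`, so that `X_{Δ_j}` is a closed subscheme of the total
space. An element of `N` on no such face is the sum of `((0, 1), 0)` and an element of `N`, because
the heights are integers (`exists_eq_vertical_add`). Hence the ideal of `t` is the intersection of
the prime ideals of these faces: the central fiber is reduced and is the union of the `X_{Δ_j}`. A
set of the `X_{Δ_j}` has a common point if and only if the faces of `N` have a common element of
degree one, which is a common lattice point of the polytopes (`exists_point`,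
`exists_common_point`); and by semi-stability the sets of polytopes with a common point are exactly
the simplices of the dual complex (`SimplicialPartition.IsSemistable.mem_dualComplex_iff`).
-/

/-! ### Lattice vectors -/

section Lattice

variable {n : ℕ}

theorem latticeToReal_add (u v : Fin n → ℤ) :
    latticeToReal (u + v) = latticeToReal u + latticeToReal v := by
  ext i; simp [latticeToReal]

theorem latticeToReal_sub (u v : Fin n → ℤ) :
    latticeToReal (u - v) = latticeToReal u - latticeToReal v := by
  ext i; simp [latticeToReal]

theorem latticeToReal_zero : latticeToReal (0 : Fin n → ℤ) = 0 := by
  ext i; simp [latticeToReal]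

theorem latticeToReal_zsmul (k : ℤ) (v : Fin n → ℤ) :
    latticeToReal (k • v) = (k : ℝ) • latticeToReal v := by
  ext i; simp [latticeToReal]

theorem latticeToReal_nsmul (k : ℕ) (v : Fin n → ℤ) :
    latticeToReal (k • v) = (k : ℝ) • latticeToReal v := by
  ext i; simp [latticeToReal]

theorem latticeToReal_injective : Function.Injective (latticeToReal (n := n)) := by
  intro u v h
  ext i
  have := congrFun h i
  simpa [latticeToReal] using this

/-- A vector of the lattice is primitive if it is not a proper multiple of a lattice vector. -/
def IsPrimitiveVector (v : Fin n → ℤ) : Prop :=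
  ∀ (k : ℤ) (w : Fin n → ℤ), v = k • w → IsUnit k

theorem IsPrimitiveVector.ne_zero {v : Fin n → ℤ} (hv : IsPrimitiveVector v) : v ≠ 0 := by
  rintro rfl
  have := hv 2 0 (by simp)
  rw [Int.isUnit_iff] at this
  omega

/-- Dividing by the greatest common divisor of the coordinates gives a primitive vector. -/
theorem exists_primitive_vector {u : Fin n → ℤ} (hu : u ≠ 0) :
    ∃ (g : ℤ) (v : Fin n → ℤ), 0 < g ∧ IsPrimitiveVector v ∧ u = g • v := by
  obtain ⟨i, hi⟩ := Function.ne_iff.1 hu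
  obtain ⟨v, hv, hg⟩ := Finset.extract_gcd u (s := Finset.univ) ⟨i, Finset.mem_univ i⟩
  set g := Finset.univ.gcd u with hgdef
  have hg0 : g ≠ 0 := by
    intro h
    have := (Finset.gcd_eq_zero_iff.1 h) i (Finset.mem_univ i)
    exact hi this
  have hnn : 0 ≤ g := by
    have : normalize g = g := Finset.normalize_gcd
    rw [← this, ← Int.abs_eq_normalize]; exact abs_nonneg _
  refine ⟨g, v, lt_of_le_of_ne hnn (Ne.symm hg0), ?_, ?_⟩
  · rintro k w rfl
    have : k ∣ Finset.univ.gcd (k • w) := Finset.dvd_gcd fun j _ => ⟨w j, by simp⟩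
    rw [hg] at this
    exact isUnit_of_dvd_one this
  · ext j
    simpa using hv j (Finset.mem_univ j)

/-- A ray of `ℝⁿ` contains at most one primitive lattice vector. -/
theorem IsPrimitiveVector.eq_of_smul {u v : Fin n → ℤ} (hu : IsPrimitiveVector u)
    (hv : IsPrimitiveVector v) {c : ℝ} (hc : 0 < c)
    (h : latticeToReal u = c • latticeToReal v) : u = v := by
  obtain ⟨i, hi⟩ := Function.ne_iff.1 hv.ne_zero
  have hi' : v i ≠ 0 := hi
  have hk : ∀ k, (u k : ℝ) = c * v k := fun k => by
    simpa [latticeToReal] using congrFun h k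
  -- the factor `c` is eliminated, and the greatest common divisor of `u i` and `v i` divided out
  have hcross : ∀ k, v i * u k = u i * v k := fun k => by
    have : (v i * u k : ℝ) = u i * v k := by rw [hk k, hk i]; ring
    exact_mod_cast this
  have hui : u i ≠ 0 := by
    intro h0
    have := hk i
    rw [h0] at this
    have h2 : (v i : ℝ) ≠ 0 := by exact_mod_cast hi'
    simp [hc.ne', h2] at this
  obtain ⟨a', b', hgcd, ha, hb⟩ := Int.exists_gcd_one (Int.gcd_pos_of_ne_zero_left (v i) hui)
  have hg : ((Int.gcd (u i) (v i) : ℕ) : ℤ) ≠ 0 := by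
    have := Int.gcd_pos_of_ne_zero_left (v i) hui
    omega
  generalize ((Int.gcd (u i) (v i) : ℕ) : ℤ) = d at ha hb hg
  have hcop : IsCoprime a' b' := Int.isCoprime_iff_gcd_eq_one.2 hgcd
  have hcross' : ∀ k, b' * u k = a' * v k := fun k => by
    have := hcross k
    rw [ha, hb] at this
    apply mul_right_cancel₀ hg
    linear_combination this
  have hua : IsUnit a' := by
    have hd : ∀ k, a' ∣ u k := fun k => hcop.dvd_of_dvd_mul_left ⟨v k, hcross' k⟩
    choose w hw using hd
    exact hu a' w (funext fun k => by simpa using hw k)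
  have hub : IsUnit b' := by
    have hd : ∀ k, b' ∣ v k := fun k => hcop.symm.dvd_of_dvd_mul_left ⟨u k, (hcross' k).symm⟩
    choose w hw using hd
    exact hv b' w (funext fun k => by simpa using hw k)
  have hsame : 0 < (u i : ℝ) * v i := by
    rw [hk i]
    have h2 : (v i : ℝ) ≠ 0 := by exact_mod_cast hi'
    have : c * (v i : ℝ) * v i = c * (v i : ℝ) ^ 2 := by ring
    rw [this]
    positivity
  have hab : a' = b' := by
    have h1 : 0 < u i * v i := by exact_mod_cast hsame
    rw [ha, hb] at h1
    rcases Int.isUnit_iff.1 hua with h | h <;> rcases Int.isUnit_iff.1 hub with h' | h' <;>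
      rw [h, h'] at h1 ⊢ <;> nlinarith [sq_nonneg d]
  ext k
  have := hcross' k
  rw [hab] at this
  exact mul_left_cancel₀ hub.ne_zero this

end Lattice

/-! ### Vertices of polytopes -/

section Vertices

variable {E : Type*} [AddCommGroup E] [Module ℝ E]

/-- Points in the convex hull of the others can be removed from a finite set without changing its
convex hull. -/
theorem exists_irredundant_convexHull (V : Finset E) :
    ∃ W ⊆ V, convexHull ℝ (W : Set E) = convexHull ℝ (V : Set E) ∧
      ∀ q ∈ W, q ∉ convexHull ℝ ((W : Set E) \ {q}) := by
  classical
  induction V using Finset.strongInduction with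
  | H V ih =>
    by_cases h : ∀ q ∈ V, q ∉ convexHull ℝ ((V : Set E) \ {q})
    · exact ⟨V, subset_rfl, rfl, h⟩
    · push Not at h
      obtain ⟨q, hq, hq'⟩ := h
      obtain ⟨W, hW, hW', hW''⟩ := ih (V.erase q) (Finset.erase_ssubset hq)
      refine ⟨W, hW.trans (Finset.erase_subset _ _), ?_, hW''⟩
      rw [hW']
      rw [← Finset.coe_erase] at hq'
      apply subset_antisymm
      · exact convexHull_mono (by simp)
      · apply convexHull_min _ (convex_convexHull _ _)
        intro v hv
        by_cases hvq : v = q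
        · rw [hvq]; exact hq'
        · exact subset_convexHull _ _ (by simpa [hvq] using hv)

variable [TopologicalSpace E]

/-- A point of a finite set outside the convex hull of the others is strictly separated from
them. -/
theorem exists_separating_functional [IsTopologicalAddGroup E] [ContinuousSMul ℝ E]
    [T2Space E] [LocallyConvexSpace ℝ E] (W : Finset E) {q : E}
    (hq : q ∉ convexHull ℝ ((W : Set E) \ {q})) :
    ∃ f : StrongDual ℝ E, ∀ w ∈ W, w ≠ q → f w < f q := by
  have hfin : ((W : Set E) \ {q}).Finite := W.finite_toSet.subset Set.sdiff_subset
  obtain ⟨f, u, h1, h2⟩ := geometric_hahn_banach_closed_point (convex_convexHull ℝ _)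
    (hfin.isClosed_convexHull ℝ) hq
  exact ⟨f, fun w hw hne => (h1 w (subset_convexHull _ _ ⟨hw, hne⟩)).trans h2⟩

/-- A linear functional attains its maximum over a polytope only at `q` if this holds on a finite
set spanning the polytope. -/
theorem isExposed_singleton_of_finset {W : Finset E} {q : E} (hqW : q ∈ W)
    {f : StrongDual ℝ E} (hf : ∀ w ∈ W, w ≠ q → f w < f q) :
    IsExposed ℝ (convexHull ℝ (W : Set E)) {q} := by
  intro _
  refine ⟨f, ?_⟩
  have hle : ∀ w ∈ W, f w ≤ f q := fun w hw => by
    by_cases h : w = q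
    · rw [h]
    · exact (hf w hw h).le
  have hmax : ∀ y ∈ convexHull ℝ (W : Set E), f y ≤ f q := by
    intro y hy
    obtain ⟨c, hc0, hc1, rfl⟩ := Finset.mem_convexHull'.1 hy
    rw [map_sum]
    calc ∑ w ∈ W, f (c w • w) ≤ ∑ w ∈ W, c w * f q :=
          Finset.sum_le_sum fun w hw => by
            rw [map_smul, smul_eq_mul]
            exact mul_le_mul_of_nonneg_left (hle w hw) (hc0 w hw)
      _ = f q := by rw [← Finset.sum_mul, hc1, one_mul]
  ext x
  simp only [Set.mem_singleton_iff, Set.mem_ofPred_eq]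
  constructor
  · rintro rfl
    exact ⟨subset_convexHull _ _ hqW, hmax⟩
  · rintro ⟨hx, hxm⟩
    have hxq := hxm q (subset_convexHull _ _ hqW)
    obtain ⟨c, hc0, hc1, rfl⟩ := Finset.mem_convexHull'.1 hx
    -- where the maximum is attained, only `q` has a nonzero weight
    have hz : ∀ w ∈ W, c w * (f q - f w) = 0 := by
      rw [← Finset.sum_eq_zero_iff_of_nonneg
        (fun w hw => mul_nonneg (hc0 w hw) (sub_nonneg.2 (hle w hw)))]
      apply le_antisymm
      · rw [map_sum] at hxq
        simp only [map_smul, smul_eq_mul] at hxq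
        simp only [mul_sub, Finset.sum_sub_distrib, ← Finset.sum_mul, hc1, one_mul]
        linarith
      · exact Finset.sum_nonneg fun w hw => mul_nonneg (hc0 w hw) (sub_nonneg.2 (hle w hw))
    have hz' : ∀ w ∈ W, w ≠ q → c w = 0 := fun w hw hne => by
      rcases mul_eq_zero.1 (hz w hw) with h | h
      · exact h
      · exact absurd h (sub_pos.2 (hf w hw hne)).ne'
    rw [Finset.sum_eq_single_of_mem q hqW fun w hw hne => by rw [hz' w hw hne, zero_smul]]
    rw [Finset.sum_eq_single_of_mem q hqW fun w hw hne => hz' w hw hne] at hc1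
    rw [hc1, one_smul]

/-- Every point of a polytope is a convex combination of vertices. -/
theorem exists_finset_vertices [IsTopologicalAddGroup E] [ContinuousSMul ℝ E]
    [T2Space E] [LocallyConvexSpace ℝ E] (V : Finset E) :
    ∃ W ⊆ V, convexHull ℝ (W : Set E) = convexHull ℝ (V : Set E) ∧
      ∀ q ∈ W, IsExposed ℝ (convexHull ℝ (V : Set E)) {q} := by
  obtain ⟨W, hWV, hW, hq⟩ := exists_irredundant_convexHull V
  refine ⟨W, hWV, hW, fun q hqW => ?_⟩
  obtain ⟨f, hf⟩ := exists_separating_functional W (hq q hqW)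
  rw [← hW]
  exact isExposed_singleton_of_finset hqW hf

end Vertices

/-! ### The cone of a polytope at a vertex -/

section Directions

variable {n : ℕ}

/-- The directions of the edges of a polytope at a vertex `p`, normalized by a functional exposing
`p`: they generate the cone of the polytope at `p`, and each spans an exposed ray of this cone. -/
theorem exists_edge_directions (V : Finset (Fin n → ℝ)) {p : Fin n → ℝ}
    (hp : IsExposed ℝ (convexHull ℝ (V : Set (Fin n → ℝ))) {p}) :
    ∃ (W : Finset (Fin n → ℝ)) (l : StrongDual ℝ (Fin n → ℝ)),
      (∀ q ∈ W, l q = -1) ∧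
      (∀ q ∈ W, ∃ ε : ℝ, 0 < ε ∧ p + ε • q ∈ V) ∧
      (∀ x ∈ convexHull ℝ (V : Set (Fin n → ℝ)), ∃ c : (Fin n → ℝ) → ℝ,
        (∀ q ∈ W, 0 ≤ c q) ∧ x - p = ∑ q ∈ W, c q • q) ∧
      ∀ q ∈ W, ∃ m : StrongDual ℝ (Fin n → ℝ), m q = 0 ∧ ∀ w ∈ W, w ≠ q → m w < 0 := by
  classical
  obtain ⟨l, hl⟩ := hp (Set.singleton_nonempty p)
  have hpA : p ∈ convexHull ℝ (V : Set (Fin n → ℝ)) := hp.subset rfl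
  have hlp : ∀ y ∈ convexHull ℝ (V : Set (Fin n → ℝ)), y ≠ p → l y < l p := by
    have hpm : p ∈ {x ∈ convexHull ℝ (V : Set (Fin n → ℝ)) |
      ∀ y ∈ convexHull ℝ (V : Set (Fin n → ℝ)), l y ≤ l x} := hl ▸ rfl
    intro y hy hne
    refine lt_of_le_of_ne (hpm.2 y hy) fun h => hne ?_
    have : y ∈ ({p} : Set (Fin n → ℝ)) := by
      rw [hl]
      exact ⟨hy, fun z hz => h ▸ hpm.2 z hz⟩
    exact this
  have hVA : ∀ v ∈ V, v ∈ convexHull ℝ (V : Set (Fin n → ℝ)) := fun v hv =>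
    subset_convexHull _ _ hv
  -- the directions from `p` to the other points, scaled to lie in the hyperplane `l = -1`; their
  -- convex hull is the vertex figure at `p`, whose vertices are the directions of the edges
  set D : Finset (Fin n → ℝ) := (V.erase p).image fun v => (l p - l v)⁻¹ • (v - p) with hD
  obtain ⟨W, hWD, hWhull, hW⟩ := exists_irredundant_convexHull D
  have hpos : ∀ v ∈ V, v ≠ p → 0 < l p - l v := fun v hv hne => sub_pos.2 (hlp v (hVA v hv) hne)
  have hDl : ∀ q ∈ D, l q = -1 := by
    intro q hq
    obtain ⟨v, hv, rfl⟩ := Finset.mem_image.1 hq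
    rw [Finset.mem_erase] at hv
    have := (hpos v hv.2 hv.1).ne'
    rw [map_smul, map_sub, smul_eq_mul]
    field_simp
    ring
  refine ⟨W, l, fun q hq => hDl q (hWD hq), fun q hq => ?_, fun x hx => ?_, fun q hq => ?_⟩
  · obtain ⟨v, hv, rfl⟩ := Finset.mem_image.1 (hWD hq)
    rw [Finset.mem_erase] at hv
    refine ⟨l p - l v, hpos v hv.2 hv.1, ?_⟩
    rw [smul_smul, mul_inv_cancel₀ (hpos v hv.2 hv.1).ne', one_smul]
    simpa using hv.2
  · let C : Set (Fin n → ℝ) := {x | ∃ c : (Fin n → ℝ) → ℝ,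
        (∀ q ∈ W, 0 ≤ c q) ∧ x - p = ∑ q ∈ W, c q • q}
    have hC : Convex ℝ C := by
      rintro x ⟨c, hc, hx⟩ y ⟨d, hd, hy⟩ a b ha hb hab
      refine ⟨fun q => a * c q + b * d q, fun q hq =>
        add_nonneg (mul_nonneg ha (hc q hq)) (mul_nonneg hb (hd q hq)), ?_⟩
      have : a • x + b • y - p = a • (x - p) + b • (y - p) := by
        have h1 : p = (a + b) • p := by rw [hab, one_smul]
        nth_rewrite 1 [h1]
        module
      rw [this, hx, hy, Finset.smul_sum, Finset.smul_sum, ← Finset.sum_add_distrib]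
      refine Finset.sum_congr rfl fun q _ => ?_
      module
    have hVC : (V : Set (Fin n → ℝ)) ⊆ C := by
      intro v hv
      by_cases hvp : v = p
      · exact ⟨0, by simp, by simp [hvp]⟩
      · have hd : (l p - l v)⁻¹ • (v - p) ∈ convexHull ℝ (W : Set (Fin n → ℝ)) := by
          rw [hWhull]
          exact subset_convexHull _ _ (Finset.mem_image_of_mem _
            (Finset.mem_erase.2 ⟨hvp, hv⟩))
        obtain ⟨c, hc0, -, hc⟩ := Finset.mem_convexHull'.1 hd
        refine ⟨fun q => (l p - l v) * c q, fun q hq =>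
          mul_nonneg (hpos v hv hvp).le (hc0 q hq), ?_⟩
        simp only [mul_smul]
        rw [← Finset.smul_sum, hc, smul_smul, mul_inv_cancel₀ (hpos v hv hvp).ne', one_smul]
    exact convexHull_min hVC hC hx
  · obtain ⟨f, hf⟩ := exists_separating_functional W (hW q hq)
    -- on the hyperplane `l = -1` this is `f - f q`
    refine ⟨f + f q • l, ?_, fun w hw hne => ?_⟩
    · simp [hDl q (hWD hq)]
    · have := hf w hw hne
      simp [hDl w (hWD hw)]
      linarith

end Directions

section Frames

variable {n : ℕ}

/-- A frame of a lattice polytope `P` at a vertex `p`: the primitive vectors of the edges at `p`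
form a basis of `ℝⁿ` and generate the cone of `P` at `p`. -/
structure VertexFrame (P : LatticePolytope n) (p : Fin n → ℝ) where
  /-- the primary vectors at `p` -/
  vec : Fin n → Fin n → ℤ
  /-- the primary vectors as a basis of `ℝⁿ` -/
  basis : Module.Basis (Fin n) ℝ (Fin n → ℝ)
  basis_eq : ∀ i, basis i = latticeToReal (vec i)
  primitive : ∀ i, IsPrimitiveVector (vec i)
  mem : p ∈ P.carrier
  tip : ∀ i, ∃ ε : ℝ, 0 < ε ∧ p + ε • basis i ∈ P.carrier
  nonneg : ∀ x ∈ P.carrier, ∀ i, 0 ≤ basis.repr (x - p) i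
  edgesAt_eq : P.edgesAt p =
    Set.range fun i => {x ∈ P.carrier | ∀ l, l ≠ i → basis.repr (x - p) l = 0}
  lattice : ∃ p₀ : Fin n → ℤ, p = latticeToReal p₀

theorem sub_eq_smul_of_repr {b : Module.Basis (Fin n) ℝ (Fin n → ℝ)} {y : Fin n → ℝ} {i : Fin n}
    (h : ∀ l, l ≠ i → b.repr y l = 0) : y = b.repr y i • b i := by
  conv_lhs => rw [← b.sum_repr y]
  exact Finset.sum_eq_single i (fun l _ hl => by rw [h l hl, zero_smul]) (by simp)

theorem VertexFrame.isPrimaryVector_iff {P : LatticePolytope n} {p : Fin n → ℝ}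
    (F : VertexFrame P p) (i : Fin n) (v : Fin n → ℤ) :
    IsPrimaryVector {x ∈ P.carrier | ∀ l, l ≠ i → F.basis.repr (x - p) l = 0} p v ↔
      v = F.vec i := by
  constructor
  · rintro ⟨hv, ε, hε, hvm, hv0⟩
    have hnn := F.nonneg _ hvm i
    simp only [add_sub_cancel_left] at hv0 hnn
    have h1 := sub_eq_smul_of_repr hv0
    rw [F.basis_eq] at h1
    set c := F.basis.repr (ε • latticeToReal v) i
    have hc : c ≠ 0 := by
      intro h0
      rw [h0, zero_smul, smul_eq_zero] at h1
      rcases h1 with h1 | h1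
      · exact hε.ne' h1
      · rw [← latticeToReal_zero] at h1
        exact IsPrimitiveVector.ne_zero hv (latticeToReal_injective h1)
    refine IsPrimitiveVector.eq_of_smul hv (F.primitive i) (c := ε⁻¹ * c)
      (mul_pos (inv_pos.2 hε) (lt_of_le_of_ne hnn hc.symm)) ?_
    rw [mul_smul, ← h1, smul_smul, inv_mul_cancel₀ hε.ne', one_smul]
  · rintro rfl
    obtain ⟨ε, hε, h⟩ := F.tip i
    refine ⟨F.primitive i, ε, hε, ?_, fun l hl => ?_⟩
    · rwa [← F.basis_eq]
    · simp [← F.basis_eq, hl.symm]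

theorem VertexFrame.primaryVectors_eq {P : LatticePolytope n} {p : Fin n → ℝ}
    (F : VertexFrame P p) : P.primaryVectors p = Set.range F.vec := by
  ext v
  simp only [LatticePolytope.primaryVectors, F.edgesAt_eq]
  constructor
  · rintro ⟨_, ⟨i, rfl⟩, h⟩
    exact ⟨i, ((F.isPrimaryVector_iff i v).1 h).symm⟩
  · rintro ⟨i, rfl⟩
    exact ⟨_, ⟨i, rfl⟩, (F.isPrimaryVector_iff i _).2 rfl⟩

/-- At a vertex of a simplicial polytope the primary vectors of the edges form a basis and generate
the cone of the polytope. The edges are compared with the vertices of the vertex figure, which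
generate this cone; there are `n` of them as there are `n` edges. -/
theorem LatticePolytope.IsSimplicial.exists_vertexFrame {P : LatticePolytope n}
    (hP : P.IsSimplicial) {p : Fin n → ℝ} (hp : P.IsVertex p) : Nonempty (VertexFrame P p) := by
  classical
  obtain ⟨V₀, hV₀, hPV⟩ := P.exists_points
  set V : Finset (Fin n → ℝ) := V₀.image latticeToReal with hVdef
  have hPV : P.carrier = convexHull ℝ (V : Set (Fin n → ℝ)) := by rw [hPV, hVdef]; simp
  have hexp : IsExposed ℝ (convexHull ℝ (V : Set (Fin n → ℝ))) {p} := hPV ▸ hp.1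
  obtain ⟨W, l, hWl, hWtip, hWcone, hWm⟩ := exists_edge_directions V hexp
  rw [← hPV] at hWcone
  have hpP : p ∈ P.carrier := hp.1.subset rfl
  have hVP : ∀ v ∈ V, v ∈ P.carrier := fun v hv => by
    rw [hPV]; exact subset_convexHull _ _ hv
  obtain ⟨p₀, hp₀⟩ : ∃ p₀ : Fin n → ℤ, p = latticeToReal p₀ := by
    have : p ∈ V := by
      have h1 : p ∈ (convexHull ℝ (V : Set (Fin n → ℝ))).extremePoints ℝ :=
        exposedPoints_subset_extremePoints (mem_exposedPoints_iff_exposed_singleton.2 hexp)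
      exact extremePoints_convexHull_subset h1
    obtain ⟨p₀, -, h⟩ := Finset.mem_image.1 this
    exact ⟨p₀, h.symm⟩
  -- the primitive vectors of the edge directions
  have hprim : ∀ q ∈ W, ∃ v : Fin n → ℤ, IsPrimitiveVector v ∧
      ∃ s : ℝ, 0 < s ∧ latticeToReal v = s • q := by
    intro q hq
    obtain ⟨ε, hε, h⟩ := hWtip q hq
    obtain ⟨v, -, hv⟩ := Finset.mem_image.1 h
    have hq0 : q ≠ 0 := by
      rintro rfl
      have := hWl 0 hq
      simp at this
    have h1 : latticeToReal (v - p₀) = ε • q := by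
      rw [latticeToReal_sub, hv, ← hp₀, add_sub_cancel_left]
    have h2 : v - p₀ ≠ 0 := by
      intro h0
      rw [h0, latticeToReal_zero] at h1
      exact (smul_ne_zero hε.ne' hq0) h1.symm
    obtain ⟨g, u, hg, hu, huv⟩ := exists_primitive_vector h2
    have hg' : (0 : ℝ) < g := by exact_mod_cast hg
    refine ⟨u, hu, (g : ℝ)⁻¹ * ε, by positivity, ?_⟩
    rw [mul_smul, ← h1, huv, latticeToReal_zsmul, smul_smul, inv_mul_cancel₀ hg'.ne', one_smul]
  -- the edge of `P` in the direction `q`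
  let Edge : (Fin n → ℝ) → Set (Fin n → ℝ) := fun q =>
    {x ∈ P.carrier | ∃ s : ℝ, 0 ≤ s ∧ x - p = s • q}
  have hlinj : ∀ q ∈ W, ∀ q' ∈ W, ∀ s : ℝ, q' = s • q → q = q' := by
    intro q hq q' hq' s h
    have h1 := congrArg l h
    rw [map_smul, hWl q hq, hWl q' hq', smul_eq_mul] at h1
    have : s = 1 := by linarith
    rw [h, this, one_smul]
  -- a set on the ray from `p` in a direction `q` which is more than a point has dimension one
  have hspan : ∀ q ∈ W, ∀ F : Set (Fin n → ℝ), p ∈ F → (∀ x ∈ F, ∃ s : ℝ, x - p = s • q) →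
      (∃ ε : ℝ, 0 < ε ∧ p + ε • q ∈ F) → faceDim F = 1 := by
    intro q hq F hpF hF ⟨ε, hε, hεF⟩
    have hq0 : q ≠ 0 := by
      rintro rfl
      have := hWl 0 hq
      simp at this
    have : vectorSpan ℝ F = Submodule.span ℝ {q} := by
      rw [vectorSpan_eq_span_vsub_set_right ℝ hpF]
      apply le_antisymm
      · rw [Submodule.span_le]
        rintro _ ⟨x, hx, rfl⟩
        obtain ⟨s, hs⟩ := hF x hx
        simp only [vsub_eq_sub, hs]
        exact Submodule.smul_mem _ _ (Submodule.mem_span_singleton_self q)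
      · rw [Submodule.span_le, Set.singleton_subset_iff]
        have : q = ε⁻¹ • ((p + ε • q) - p) := by
          rw [add_sub_cancel_left, smul_smul, inv_mul_cancel₀ hε.ne', one_smul]
        rw [this]
        exact Submodule.smul_mem _ _ (Submodule.subset_span ⟨_, hεF, rfl⟩)
    rw [faceDim, this, finrank_span_singleton hq0]
  have hEexp : ∀ q ∈ W, ∀ m : StrongDual ℝ (Fin n → ℝ), m q = 0 →
      (∀ w ∈ W, w ≠ q → m w < 0) →
      Edge q = {x ∈ P.carrier | ∀ y ∈ P.carrier, m y ≤ m x} := by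
    intro q hq m hmq hmw
    have hle : ∀ y ∈ P.carrier, m y ≤ m p := by
      intro y hy
      obtain ⟨c, hc, hyc⟩ := hWcone y hy
      have h1 : m (y - p) ≤ 0 := by
        rw [hyc, map_sum]
        refine Finset.sum_nonpos fun w hw => ?_
        rw [map_smul, smul_eq_mul]
        by_cases hwq : w = q
        · rw [hwq, hmq, mul_zero]
        · exact mul_nonpos_of_nonneg_of_nonpos (hc w hw) (hmw w hw hwq).le
      rw [map_sub] at h1
      linarith
    ext x
    constructor
    · rintro ⟨hx, s, hs, hxs⟩
      refine ⟨hx, fun y hy => ?_⟩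
      have : m (x - p) = 0 := by rw [hxs, map_smul, hmq, smul_zero]
      rw [map_sub] at this
      linarith [hle y hy]
    · rintro ⟨hx, hxm⟩
      obtain ⟨c, hc, hyc⟩ := hWcone x hx
      have h1 : m (x - p) = 0 := by
        rw [map_sub]; linarith [hle x hx, hxm p hpP]
      rw [hyc, map_sum] at h1
      have h2 := (Finset.sum_eq_zero_iff_of_nonpos fun w hw => by
        rw [map_smul, smul_eq_mul]
        by_cases hwq : w = q
        · rw [hwq, hmq, mul_zero]
        · exact mul_nonpos_of_nonneg_of_nonpos (hc w hw) (hmw w hw hwq).le).1 h1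
      refine ⟨hx, c q, hc q hq, ?_⟩
      rw [hyc]
      refine Finset.sum_eq_single_of_mem q hq fun w hw hwq => ?_
      have := h2 w hw
      rw [map_smul, smul_eq_mul, mul_eq_zero] at this
      rcases this with h | h
      · rw [h, zero_smul]
      · exact absurd h (hmw w hw hwq).ne
  have hEtip : ∀ q ∈ W, ∃ ε : ℝ, 0 < ε ∧ p + ε • q ∈ Edge q := by
    intro q hq
    obtain ⟨ε, hε, h⟩ := hWtip q hq
    exact ⟨ε, hε, hVP _ h, ε, hε.le, by rw [add_sub_cancel_left]⟩
  have hpE : ∀ q, p ∈ Edge q := fun q => ⟨hpP, 0, le_rfl, by simp⟩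
  have hEedge : ∀ q ∈ W, Edge q ∈ P.edgesAt p := by
    intro q hq
    obtain ⟨m, hmq, hmw⟩ := hWm q hq
    refine ⟨⟨fun _ => ⟨m, hEexp q hq m hmq hmw⟩, p, hpE q⟩, ?_, ?_, Set.singleton_nonempty p⟩
    · exact hspan q hq _ (hpE q) (fun x hx => ⟨_, hx.2.choose_spec.2⟩) (hEtip q hq)
    · exact hp.1.mono (fun x hx => hx.1) (Set.singleton_subset_iff.2 (hpE q))
  have hEinj : Set.InjOn Edge (W : Set (Fin n → ℝ)) := by
    intro q hq q' hq' h
    obtain ⟨ε, hε, h1⟩ := hEtip q' hq'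
    rw [← h] at h1
    obtain ⟨-, s, -, hs⟩ := h1
    rw [add_sub_cancel_left] at hs
    refine hlinj q hq q' hq' (ε⁻¹ * s) ?_
    rw [mul_smul, ← hs, smul_smul, inv_mul_cancel₀ hε.ne', one_smul]
  -- An edge is exposed by a functional `m` which vanishes on some of the directions. By the
  -- dimension it vanishes on exactly one of them, and the edge is the one in this direction.
  have hedges : P.edgesAt p = Edge '' W := by
    apply subset_antisymm
    · rintro E ⟨hE, hdim, hpE'⟩
      obtain ⟨m, hm⟩ := hE.1 hE.2
      have hpE'' : p ∈ E := hpE'.1.subset rfl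
      have hmp : ∀ y ∈ P.carrier, m y ≤ m p := by
        have h := hpE''
        rw [hm] at h
        exact h.2
      have hEm : ∀ x, x ∈ E ↔ x ∈ P.carrier ∧ m x = m p := by
        intro x
        rw [hm]
        exact ⟨fun h => ⟨h.1, le_antisymm (hmp x h.1) (h.2 p hpP)⟩,
          fun h => ⟨h.1, fun y hy => h.2 ▸ hmp y hy⟩⟩
      have hmW : ∀ q ∈ W, m q ≤ 0 := by
        intro q hq
        obtain ⟨ε, hε, h⟩ := hWtip q hq
        have := hmp _ (hVP _ h)
        rw [map_add, map_smul, smul_eq_mul] at this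
        by_contra! hcon
        have := mul_pos hε hcon
        linarith
      have hEsum : ∀ x ∈ E, ∃ c : (Fin n → ℝ) → ℝ, (∀ q ∈ W, 0 ≤ c q) ∧
          (∀ q ∈ W, c q * m q = 0) ∧ x - p = ∑ q ∈ W, c q • q := by
        intro x hx
        obtain ⟨hxP, hxm⟩ := (hEm x).1 hx
        obtain ⟨c, hc, hxc⟩ := hWcone x hxP
        have h1 : m (x - p) = 0 := by rw [map_sub, hxm, sub_self]
        rw [hxc, map_sum] at h1
        simp only [map_smul, smul_eq_mul] at h1
        exact ⟨c, hc, (Finset.sum_eq_zero_iff_of_nonpos fun w hw =>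
          mul_nonpos_of_nonneg_of_nonpos (hc w hw) (hmW w hw)).1 h1, hxc⟩
      have hqE : ∀ q ∈ W, m q = 0 → q ∈ vectorSpan ℝ E := by
        intro q hq hmq
        obtain ⟨ε, hε, h⟩ := hWtip q hq
        have h1 : p + ε • q ∈ E := (hEm _).2 ⟨hVP _ h, by simp [hmq]⟩
        have : q = ε⁻¹ • ((p + ε • q) -ᵥ p) := by
          rw [vsub_eq_sub, add_sub_cancel_left, smul_smul, inv_mul_cancel₀ hε.ne', one_smul]
        rw [this]
        exact Submodule.smul_mem _ _ (vsub_mem_vectorSpan ℝ h1 hpE'')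
      obtain ⟨q, hq, hmq⟩ : ∃ q ∈ W, m q = 0 := by
        by_contra! hcon
        have : E ⊆ {p} := by
          intro x hx
          obtain ⟨c, -, hc0, hxc⟩ := hEsum x hx
          have : x - p = 0 := by
            rw [hxc]
            exact Finset.sum_eq_zero fun w hw => by
              rw [(mul_eq_zero.1 (hc0 w hw)).resolve_right (hcon w hw), zero_smul]
          exact sub_eq_zero.1 this
        have h0 : E.Subsingleton := Set.subsingleton_singleton.anti this
        rw [faceDim, vectorSpan_of_subsingleton ℝ h0, finrank_bot] at hdim
        exact zero_ne_one hdim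
      have huniq : ∀ w ∈ W, m w = 0 → w = q := by
        intro w hw hmw
        have hq0 : q ≠ 0 := by
          rintro rfl
          have := hWl 0 hq
          simp at this
        obtain ⟨s, hs⟩ := exists_smul_eq_of_finrank_eq_one (K := ℝ) hdim
          (x := ⟨q, hqE q hq hmq⟩) (by simpa [Subtype.ext_iff] using hq0) ⟨w, hqE w hw hmw⟩
        exact (hlinj q hq w hw s (congrArg Subtype.val hs).symm).symm
      refine ⟨q, hq, ?_⟩
      ext x
      constructor
      · rintro ⟨hx, s, -, hxs⟩
        refine (hEm x).2 ⟨hx, ?_⟩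
        rw [← sub_eq_zero, ← map_sub, hxs, map_smul, hmq, smul_zero]
      · intro hx
        obtain ⟨c, hc, hc0, hxc⟩ := hEsum x hx
        refine ⟨((hEm x).1 hx).1, c q, hc q hq, ?_⟩
        rw [hxc]
        refine Finset.sum_eq_single_of_mem q hq fun w hw hwq => ?_
        rw [(mul_eq_zero.1 (hc0 w hw)).resolve_right fun h => hwq (huniq w hw h), zero_smul]
    · rintro _ ⟨q, hq, rfl⟩
      exact hEedge q hq
  -- the polytope is simplicial, so the `n` edge directions form a basis
  have hcard : W.card = n := by
    have h := (hP p hp).1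
    rwa [hedges, Set.InjOn.ncard_image hEinj, Set.ncard_coe_finset] at h
  let e : Fin n ≃ W := (Finset.equivFinOfCardEq hcard).symm
  choose! vec hvprim s hs hvec using hprim
  let v : Fin n → Fin n → ℤ := fun i => vec (e i)
  have hv : ∀ i, latticeToReal (v i) = s (e i) • (e i : Fin n → ℝ) := fun i => hvec _ (e i).2
  have hspi : ∀ i, 0 < s (e i) := fun i => hs _ (e i).2
  have hEv : ∀ q ∈ W, ∀ u, IsPrimaryVector (Edge q) p u → ∃ a : ℝ, latticeToReal u = a • q := by
    rintro q hq u ⟨-, ε, hε, -, t, ht, hut⟩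
    rw [add_sub_cancel_left] at hut
    exact ⟨ε⁻¹ * t, by rw [mul_smul, ← hut, smul_smul, inv_mul_cancel₀ hε.ne', one_smul]⟩
  have hqs : ∀ i, (e i : Fin n → ℝ) = (s (e i))⁻¹ • latticeToReal (v i) := fun i => by
    rw [hv, smul_smul, inv_mul_cancel₀ (hspi i).ne', one_smul]
  have htop : ⊤ ≤ Submodule.span ℝ (Set.range fun i => latticeToReal (v i)) := by
    rw [← (hP p hp).2, Submodule.span_le]
    rintro _ ⟨u, ⟨E, hE, huE⟩, rfl⟩
    rw [hedges] at hE
    obtain ⟨q, hq, rfl⟩ := hE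
    obtain ⟨a, ha⟩ := hEv q hq u huE
    obtain ⟨i, hi⟩ := e.surjective ⟨q, hq⟩
    have hi' : (e i : Fin n → ℝ) = q := by rw [hi]
    rw [ha, ← hi', hqs i, smul_smul]
    exact Submodule.smul_mem _ _ (Submodule.subset_span ⟨i, rfl⟩)
  let b := basisOfTopLeSpanOfCardEqFinrank (fun i => latticeToReal (v i)) htop (by simp)
  have hb : ∀ i, b i = latticeToReal (v i) := fun i => by simp [b]
  have hqrepr : ∀ i l, b.repr (e i : Fin n → ℝ) l = if i = l then (s (e i))⁻¹ else 0 := by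
    intro i l
    have h : b.repr (e i : Fin n → ℝ) = (s (e i))⁻¹ • b.repr (b i) := by
      rw [← map_smul, hb, ← hqs i]
    rw [h, b.repr_self, Finsupp.smul_apply, Finsupp.single_apply]
    simp
  -- the edges in terms of the coordinates
  have hedge : ∀ i, Edge (e i) = {x ∈ P.carrier | ∀ l, l ≠ i → b.repr (x - p) l = 0} := by
    intro i
    ext x
    constructor
    · rintro ⟨hx, t, ht, hxt⟩
      refine ⟨hx, fun l hl => ?_⟩
      rw [hxt, map_smul, Finsupp.smul_apply, hqrepr, if_neg hl.symm, smul_zero]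
    · rintro ⟨hx, h⟩
      have h1 := sub_eq_smul_of_repr h
      obtain ⟨c, hc, hxc⟩ := hWcone x hx
      refine ⟨hx, b.repr (x - p) i * s (e i), ?_, ?_⟩
      · refine mul_nonneg ?_ (hspi i).le
        rw [hxc, map_sum, Finsupp.finsetSum_apply]
        refine Finset.sum_nonneg fun q hq => ?_
        obtain ⟨j, hj⟩ := e.surjective ⟨q, hq⟩
        have hj' : (e j : Fin n → ℝ) = q := by rw [hj]
        rw [map_smul, Finsupp.smul_apply, ← hj', hqrepr]
        split_ifs
        · rw [hj']
          exact mul_nonneg (hc q hq) (inv_nonneg.2 (hs q hq).le)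
        · simp
      · rw [mul_smul, ← hv, ← hb]
        exact h1
  refine ⟨⟨v, b, hb, fun i => hvprim _ (e i).2, hpP, fun i => ?_, fun x hx i => ?_, ?_, p₀, hp₀⟩⟩
  · obtain ⟨ε, hε, h⟩ := hWtip (e i) (e i).2
    refine ⟨ε * (s (e i))⁻¹, mul_pos hε (inv_pos.2 (hspi i)), ?_⟩
    rw [mul_smul, hb, ← hqs i]
    exact hVP _ h
  · obtain ⟨c, hc, hxc⟩ := hWcone x hx
    rw [hxc, map_sum, Finsupp.finsetSum_apply]
    refine Finset.sum_nonneg fun q hq => ?_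
    obtain ⟨j, hj⟩ := e.surjective ⟨q, hq⟩
    have hj' : (e j : Fin n → ℝ) = q := by rw [hj]
    rw [map_smul, Finsupp.smul_apply, ← hj', hqrepr]
    split_ifs
    · rw [hj']
      exact mul_nonneg (hc q hq) (inv_nonneg.2 (hs q hq).le)
    · simp
  · rw [hedges]
    ext E
    constructor
    · rintro ⟨q, hq, rfl⟩
      obtain ⟨j, hj⟩ := e.surjective ⟨q, hq⟩
      refine ⟨j, ?_⟩
      simp only [← hedge, hj]
    · rintro ⟨i, rfl⟩
      exact ⟨e i, (e i).2, hedge i⟩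

end Frames

/-! ### Local models of simple polytopes -/

section LocalModels

open Filter Topology

variable {n : ℕ}

theorem continuous_repr (b : Module.Basis (Fin n) ℝ (Fin n → ℝ)) (x : Fin n → ℝ) (i : Fin n) :
    Continuous fun y => b.repr (y - x) i := by
  have h : Continuous (b.coord i) := (b.coord i).continuous_of_finiteDimensional
  exact h.comp (continuous_id.sub continuous_const)

/-- A description of `A ⊆ ℝⁿ` near `x` by finitely many linearly independent inequalities (which
are valid on all of `A`): the coordinates with index in `idx` with respect to `basis` and the
origin `x` are nonnegative. -/
structure LocalModel (A : Set (Fin n → ℝ)) (x : Fin n → ℝ) where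
  /-- the coordinates -/
  basis : Module.Basis (Fin n) ℝ (Fin n → ℝ)
  /-- the coordinates that are nonnegative on `A` -/
  idx : Finset (Fin n)
  nonneg : ∀ y ∈ A, ∀ i ∈ idx, 0 ≤ basis.repr (y - x) i
  nhds : ∀ᶠ y in 𝓝 x, (∀ i ∈ idx, 0 ≤ basis.repr (y - x) i) → y ∈ A

/-- The local model of a polytope at a point `x` of a face of which `p` is a vertex and to whose
relative interior `x` belongs. -/
noncomputable def VertexFrame.localModel {P : LatticePolytope n} {p : Fin n → ℝ} (F : VertexFrame P p)
    {x : Fin n → ℝ} (hx : x ∈ P.carrier) {δ : ℝ} (hδ : 0 < δ) (hxδ : x + δ • (x - p) ∈ P.carrier) :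
    LocalModel P.carrier x where
  basis := F.basis
  idx := Finset.univ.filter fun i => F.basis.repr (x - p) i = 0
  nonneg y hy i hi := by
    have h0 := (Finset.mem_filter.1 hi).2
    have h1 := F.nonneg y hy i
    have : y - x = (y - p) - (x - p) := by abel
    rw [this, map_sub, Finsupp.sub_apply, h0, sub_zero]
    exact h1
  nhds := by
    classical
    set b := F.basis with hb
    have hξ : ∀ i, 0 ≤ b.repr (x - p) i := F.nonneg x hx
    choose ε hε hεP using F.tip
    set ξ := fun i => b.repr (x - p) i with hξdef
    -- choose `η` so small that the simplex spanned by `p` and the tips contains the correction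
    obtain ⟨η, hη0, hη1, hηS⟩ : ∃ η : ℝ, 0 < η ∧ η < 1 ∧
        ∑ i, η * ξ i / ε i < (1 - (1 - η) / (1 + δ)) := by
      have hc : Tendsto (fun η : ℝ => (1 - (1 - η) / (1 + δ)) - ∑ i, η * ξ i / ε i) (𝓝 0)
          (𝓝 ((1 - (1 - 0) / (1 + δ)) - ∑ i, 0 * ξ i / ε i)) := by
        apply Continuous.tendsto (f := fun η : ℝ =>
          (1 - (1 - η) / (1 + δ)) - ∑ i, η * ξ i / ε i)
        fun_prop
      have hpos : (0 : ℝ) < (1 - (1 - 0) / (1 + δ)) - ∑ i, 0 * ξ i / ε i := by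
        simp only [zero_mul, zero_div, Finset.sum_const_zero, sub_zero]
        rw [sub_pos, div_lt_one (by linarith)]
        linarith
      have h1 := (hc.eventually (lt_mem_nhds hpos)).and (gt_mem_nhds zero_lt_one)
      obtain ⟨η, ⟨h2, h3⟩, h4⟩ := (((h1.filter_mono nhdsWithin_le_nhds).and
        (self_mem_nhdsWithin : Set.Ioi (0 : ℝ) ∈ 𝓝[>] 0)).exists)
      exact ⟨η, h4, h3, sub_pos.1 h2⟩
    set lam := (1 - η) / (1 + δ) with hlam
    have hlam0 : 0 < lam := div_pos (by linarith) (by linarith)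
    have hlam1 : 0 < 1 - lam := by
      rw [sub_pos, hlam, div_lt_one (by linarith)]
      linarith
    -- for `y` near `x` the coordinates of `η • (x - p) + (y - x)` are nonnegative and small
    have hE1 : ∀ᶠ y in 𝓝 x, ∀ i, ξ i ≠ 0 → 0 < η * ξ i + b.repr (y - x) i := by
      rw [eventually_all]
      intro i
      by_cases hi : ξ i = 0
      · simp [hi]
      · have hpos : 0 < ξ i := lt_of_le_of_ne (hξ i) (Ne.symm hi)
        have hc : Tendsto (fun y => η * ξ i + b.repr (y - x) i) (𝓝 x)
            (𝓝 (η * ξ i + b.repr (x - x) i)) :=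
          (continuous_const.add (continuous_repr b x i)).tendsto x
        have h0 : 0 < η * ξ i + b.repr (x - x) i := by simpa using mul_pos hη0 hpos
        filter_upwards [hc.eventually (lt_mem_nhds h0)] with y hy _ using hy
    have hE2 : ∀ᶠ y in 𝓝 x, ∑ i, (η * ξ i + b.repr (y - x) i) / ε i < 1 - lam := by
      have hc : Tendsto (fun y => ∑ i, (η * ξ i + b.repr (y - x) i) / ε i) (𝓝 x)
          (𝓝 (∑ i, (η * ξ i + b.repr (x - x) i) / ε i)) := by
        refine tendsto_finsetSum _ fun i _ => ?_
        exact ((continuous_const.add (continuous_repr b x i)).div_const _).tendsto x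
      have h0 : ∑ i, (η * ξ i + b.repr (x - x) i) / ε i < 1 - lam := by simpa using hηS
      exact hc.eventually (gt_mem_nhds h0)
    filter_upwards [hE1, hE2] with y h1 h2 h3
    set r := fun i => η * ξ i + b.repr (y - x) i with hr
    have hr0 : ∀ i, 0 ≤ r i := by
      intro i
      by_cases hi : ξ i = 0
      · have := h3 i (Finset.mem_filter.2 ⟨Finset.mem_univ i, hi⟩)
        simpa [hr, hi] using this
      · exact (h1 i hi).le
    set μ := fun i => r i / ε i with hμ
    have hμ0 : ∀ i, 0 ≤ μ i := fun i => div_nonneg (hr0 i) (hε i).le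
    have hsum : ∑ i, r i • b i = η • (x - p) + (y - x) := by
      simp only [hr, add_smul, Finset.sum_add_distrib, mul_smul]
      rw [← Finset.smul_sum, b.sum_repr, b.sum_repr]
    -- `y` is a convex combination of the point beyond `x`, of `p` and of the tips
    have hy : y = lam • (x + δ • (x - p)) + (1 - lam - ∑ i, μ i) • p
        + ∑ i, μ i • (p + ε i • b i) := by
      have h4 : ∑ i, μ i • (p + ε i • b i) = (∑ i, μ i) • p + ∑ i, r i • b i := by
        simp only [smul_add, Finset.sum_add_distrib, smul_smul, ← Finset.sum_smul]
        congr 1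
        refine Finset.sum_congr rfl fun i _ => ?_
        rw [hμ]
        simp only
        rw [div_mul_cancel₀ _ (hε i).ne']
      rw [h4, hsum]
      have h5 : lam * (1 + δ) = 1 - η := by
        rw [hlam, div_mul_cancel₀]
        linarith
      have h6 : lam • (x + δ • (x - p)) = (1 - η) • (x - p) + lam • p := by
        have : x + δ • (x - p) = (1 + δ) • (x - p) + p := by module
        rw [this, smul_add, smul_smul, h5]
      rw [h6]
      module
    have hconv := P.carrier_convex
    have hp := F.mem
    rw [hy]
    have key := hconv.sum_mem (t := (Finset.univ : Finset (Option (Option (Fin n)))))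
      (w := fun o => o.elim lam fun o => o.elim (1 - lam - ∑ i, μ i) μ)
      (z := fun o => o.elim (x + δ • (x - p)) fun o => o.elim p fun i => p + ε i • b i)
      (by
        rintro (_ | _ | i) -
        · exact hlam0.le
        · exact sub_nonneg.2 h2.le
        · exact hμ0 i)
      (by
        simp only [Fintype.sum_option, Option.elim_none, Option.elim_some]
        ring)
      (by
        rintro (_ | _ | i) -
        · exact hxδ
        · exact hp
        · exact hεP i)
    simpa only [Fintype.sum_option, Option.elim_none, Option.elim_some, add_assoc] using key

/-- A simple lattice polytope has a local model at each of its points `x`, whose coordinates are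
those of a frame at a vertex of the face with `x` in its relative interior. -/
theorem LatticePolytope.IsSimplicial.exists_frame_localModel {P : LatticePolytope n}
    (hP : P.IsSimplicial) {x : Fin n → ℝ} (hx : x ∈ P.carrier) :
    ∃ (p : Fin n → ℝ) (F : VertexFrame P p) (m : LocalModel P.carrier x),
      m.basis = F.basis ∧ ∀ i ∈ m.idx, F.basis.repr (x - p) i = 0 := by
  classical
  obtain ⟨V₀, hV₀, hPV⟩ := P.exists_points
  obtain ⟨W, hWV, hW, hWexp⟩ := exists_finset_vertices (V₀.image latticeToReal)
  have hPW : P.carrier = convexHull ℝ (W : Set (Fin n → ℝ)) := by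
    rw [hW, hPV, Finset.coe_image]
  rw [Finset.coe_image, ← hPV] at hWexp
  have hxW := hx
  rw [hPW] at hxW
  obtain ⟨c, hc0, hc1, hcx⟩ := Finset.mem_convexHull'.1 hxW
  -- a vertex with a positive weight lies on the smallest face containing `x`, so that the segment
  -- from the vertex to `x` can be prolonged inside `P`
  obtain ⟨p, hp, hcp⟩ : ∃ p ∈ W, c p ≠ 0 := by
    by_contra! h
    rw [Finset.sum_eq_zero h] at hc1
    exact zero_ne_one hc1
  have hcp : 0 < c p := lt_of_le_of_ne (hc0 p hp) (Ne.symm hcp)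
  obtain ⟨F⟩ := hP.exists_vertexFrame (p := p) ⟨hWexp p hp, Set.singleton_nonempty p⟩
  refine ⟨p, F, F.localModel hx (δ := c p) hcp ?_, rfl, fun i hi => (Finset.mem_filter.1 hi).2⟩
  rw [hPW, Finset.mem_convexHull']
  refine ⟨fun q => (1 + c p) * c q - if q = p then c p else 0, fun q hq => ?_, ?_, ?_⟩
  · dsimp only
    split_ifs with h
    · rw [h]; nlinarith [hc0 p hp]
    · have := hc0 q hq
      simp only [sub_zero]
      positivity
  · rw [Finset.sum_sub_distrib, ← Finset.mul_sum, hc1, Finset.sum_ite_eq' W p, if_pos hp]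
    ring
  · simp only [sub_smul, Finset.sum_sub_distrib, mul_smul, ite_smul, zero_smul]
    rw [← Finset.smul_sum, hcx, Finset.sum_ite_eq' W p (fun _ => c p • _), if_pos hp]
    module

theorem LatticePolytope.IsSimplicial.exists_localModel {P : LatticePolytope n}
    (hP : P.IsSimplicial) {x : Fin n → ℝ} (hx : x ∈ P.carrier) :
    Nonempty (LocalModel P.carrier x) :=
  let ⟨_, _, m, _⟩ := hP.exists_frame_localModel hx
  ⟨m⟩

namespace LocalModel

variable {A : Set (Fin n → ℝ)} {x : Fin n → ℝ} (m : LocalModel A x)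

theorem mem {A : Set (Fin n → ℝ)} {x : Fin n → ℝ} (m : LocalModel A x) : x ∈ A := m.nhds.self_of_nhds fun i _ => by simp

theorem repr_sub_eq {y : Fin n → ℝ} {i : Fin n} (h : m.basis.repr (y - x) i = 0)
    (z : Fin n → ℝ) : m.basis.repr (z - y) i = m.basis.repr (z - x) i := by
  have : z - y = (z - x) - (y - x) := by abel
  rw [this, map_sub, Finsupp.sub_apply, h, sub_zero]

/-- The local model of `A` at a point near `x`. -/
noncomputable def shift {y : Fin n → ℝ}
    (hy : ∀ᶠ z in 𝓝 y, (∀ i ∈ m.idx, 0 ≤ m.basis.repr (z - x) i) → z ∈ A) (hyA : y ∈ A) :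
    LocalModel A y where
  basis := m.basis
  idx := m.idx.filter fun i => m.basis.repr (y - x) i = 0
  nonneg z hz i hi := by
    rw [Finset.mem_filter] at hi
    rw [m.repr_sub_eq hi.2]
    exact m.nonneg z hz i hi.1
  nhds := by
    have h : ∀ᶠ z in 𝓝 y, ∀ i, 0 < m.basis.repr (y - x) i → 0 < m.basis.repr (z - x) i := by
      rw [eventually_all]
      intro i
      by_cases hi : 0 < m.basis.repr (y - x) i
      · filter_upwards [((continuous_repr m.basis x i).tendsto y).eventually (lt_mem_nhds hi)]
          with z hz _ using hz
      · exact Eventually.of_forall fun z h => absurd h hi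
    filter_upwards [h, hy] with z h1 h2 h3
    refine h2 fun i hi => ?_
    by_cases h0 : m.basis.repr (y - x) i = 0
    · rw [← m.repr_sub_eq h0]
      exact h3 i (Finset.mem_filter.2 ⟨hi, h0⟩)
    · exact (h1 i (lt_of_le_of_ne (m.nonneg y hyA i hi) (Ne.symm h0))).le

theorem eventually_shift :
    ∀ᶠ y in 𝓝 x, ∀ᶠ z in 𝓝 y, (∀ i ∈ m.idx, 0 ≤ m.basis.repr (z - x) i) → z ∈ A :=
  eventually_eventually_nhds.2 m.nhds

/-- The face of `A` on which the coordinates with index in `J` vanish. -/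
def face (J : Finset (Fin n)) : Set (Fin n → ℝ) :=
  {y ∈ A | ∀ i ∈ J, m.basis.repr (y - x) i = 0}

theorem mem_face {J : Finset (Fin n)} {y : Fin n → ℝ} :
    y ∈ m.face J ↔ y ∈ A ∧ ∀ i ∈ J, m.basis.repr (y - x) i = 0 := Iff.rfl

theorem self_mem_face (J : Finset (Fin n)) : x ∈ m.face J := ⟨m.mem, fun i _ => by simp⟩

/-- The face is exposed by the sum of the coordinates in `J`. -/
theorem isPolytopeFace_face {J : Finset (Fin n)} (hJ : J ⊆ m.idx) :
    IsPolytopeFace A (m.face J) := by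
  refine ⟨fun _ => ⟨-∑ i ∈ J, (m.basis.coord i).toContinuousLinearMap, ?_⟩, x, m.self_mem_face J⟩
  have hval : ∀ y, (-∑ i ∈ J, (m.basis.coord i).toContinuousLinearMap) y
      = -∑ i ∈ J, m.basis.repr y i := fun y => by simp
  have hsub : ∀ y, ∑ i ∈ J, m.basis.repr (y - x) i
      = ∑ i ∈ J, m.basis.repr y i - ∑ i ∈ J, m.basis.repr x i := fun y => by
    simp [Finset.sum_sub_distrib]
  have hnn : ∀ y ∈ A, 0 ≤ ∑ i ∈ J, m.basis.repr (y - x) i := fun y hy =>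
    Finset.sum_nonneg fun i hi => m.nonneg y hy i (hJ hi)
  ext y
  simp only [mem_face, Set.mem_ofPred_eq, hval]
  constructor
  · rintro ⟨hy, h⟩
    refine ⟨hy, fun z hz => ?_⟩
    have h1 := hnn z hz
    have h2 : ∑ i ∈ J, m.basis.repr (y - x) i = 0 := Finset.sum_eq_zero h
    rw [hsub] at h1 h2
    linarith
  · rintro ⟨hy, h⟩
    refine ⟨hy, (Finset.sum_eq_zero_iff_of_nonneg fun i hi => m.nonneg y hy i (hJ hi)).1 ?_⟩
    have h1 := h x m.mem
    have h2 := hnn y hy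
    rw [hsub] at h2 ⊢
    linarith

theorem exists_add_smul_mem (v : Fin n → ℝ) (hv : ∀ i ∈ m.idx, 0 ≤ m.basis.repr v i) {s : Set
    (Fin n → ℝ)} (hs : s ∈ 𝓝 x) : ∃ ε : ℝ, 0 < ε ∧ x + ε • v ∈ A ∧ x + ε • v ∈ s := by
  have hc : Tendsto (fun ε : ℝ => x + ε • v) (𝓝[>] 0) (𝓝 x) := by
    have : Continuous fun ε : ℝ => x + ε • v := by fun_prop
    simpa using (this.tendsto 0).mono_left nhdsWithin_le_nhds
  obtain ⟨ε, ⟨h1, h2⟩, h3⟩ := (((hc.eventually m.nhds).and (hc.eventually_mem hs)).and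
    (self_mem_nhdsWithin : Set.Ioi (0 : ℝ) ∈ 𝓝[>] 0)).exists
  have h3 : (0 : ℝ) < ε := h3
  refine ⟨ε, h3, h1 fun i hi => ?_, h2⟩
  have := hv i hi
  simp only [add_sub_cancel_left, map_smul, Finsupp.smul_apply, smul_eq_mul]
  positivity

theorem vectorSpan_face (J : Finset (Fin n)) :
    vectorSpan ℝ (m.face J) = Submodule.span ℝ (m.basis '' (J : Set (Fin n))ᶜ) := by
  apply le_antisymm
  · rw [vectorSpan_eq_span_vsub_set_right ℝ (m.self_mem_face J), Submodule.span_le]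
    rintro _ ⟨y, hy, rfl⟩
    rw [SetLike.mem_coe, Module.Basis.mem_span_image]
    intro i hi hiJ
    exact (Finsupp.mem_support_iff.1 hi) (hy.2 i hiJ)
  · rw [Submodule.span_le]
    rintro _ ⟨i, hi, rfl⟩
    have h0 : ∀ k, 0 ≤ m.basis.repr (m.basis i) k := fun k => by
      rw [m.basis.repr_self, Finsupp.single_apply]; split_ifs <;> simp
    obtain ⟨ε, hε, h, -⟩ := m.exists_add_smul_mem (m.basis i) (fun k _ => h0 k) univ_mem
    have h1 : x + ε • m.basis i ∈ m.face J := by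
      refine ⟨h, fun k hk => ?_⟩
      have : i ≠ k := by rintro rfl; exact hi hk
      simp [this]
    have h2 : m.basis i = ε⁻¹ • ((x + ε • m.basis i) -ᵥ x) := by
      rw [vsub_eq_sub, add_sub_cancel_left, smul_smul, inv_mul_cancel₀ hε.ne', one_smul]
    rw [h2]
    exact Submodule.smul_mem _ _ (vsub_mem_vectorSpan ℝ h1 (m.self_mem_face J))

theorem faceDim_face (J : Finset (Fin n)) : faceDim (m.face J) + J.card = n := by
  classical
  have h1 : (m.basis '' (J : Set (Fin n))ᶜ) = Set.range fun i : (Jᶜ : Finset (Fin n)) =>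
      m.basis i := by
    ext y; simp
  rw [faceDim, m.vectorSpan_face, h1,
    finrank_span_eq_card (b := fun i : (Jᶜ : Finset (Fin n)) => m.basis i)
      (m.basis.linearIndependent.comp _ Subtype.val_injective),
    Fintype.card_coe, Finset.card_compl, Fintype.card_fin]
  have := J.card_le_univ
  simp at this
  omega

/-- A point near `x` in the relative interior of a face of `A`. -/
theorem exists_generic (J : Finset (Fin n)) {s : Set (Fin n → ℝ)} (hs : s ∈ 𝓝 x) :
    ∃ y ∈ m.face J, y ∈ s ∧ (∀ᶠ z in 𝓝 y, (∀ i ∈ m.idx, 0 ≤ m.basis.repr (z - x) i) → z ∈ A) ∧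
      ∀ i, i ∉ J → 0 < m.basis.repr (y - x) i := by
  classical
  let v : Fin n → ℝ := ∑ i ∈ Jᶜ, m.basis i
  have hv : ∀ i, m.basis.repr v i = if i ∈ J then 0 else 1 := by
    intro i
    simp only [v, map_sum, Finsupp.finsetSum_apply, m.basis.repr_self, Finsupp.single_apply]
    rw [Finset.sum_ite_eq']
    simp [Finset.mem_compl, ite_not]
  obtain ⟨ε, hε, h1, h2⟩ := m.exists_add_smul_mem v (fun i _ => by rw [hv]; split_ifs <;> simp)
    (Filter.inter_mem hs m.eventually_shift)
  refine ⟨x + ε • v, ⟨h1, fun i hi => ?_⟩, h2.1, h2.2, fun i hi => ?_⟩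
  · simp [hv, hi]
  · simp [hv, hi, hε]

end LocalModel

/-! ### Minimal faces and relative interiors -/

/-- The smallest face of a convex set `A` containing the point `x` of `A`. -/
def minFace (A : Set (Fin n → ℝ)) (x : Fin n → ℝ) : Set (Fin n → ℝ) :=
  {y ∈ A | ∃ δ : ℝ, 0 < δ ∧ x + δ • (x - y) ∈ A}

theorem LocalModel.minFace_eq {A : Set (Fin n → ℝ)} {x : Fin n → ℝ} (m : LocalModel A x) :
    minFace A x = m.face m.idx := by
  ext y
  constructor
  · rintro ⟨hy, δ, hδ, h⟩
    refine ⟨hy, fun i hi => le_antisymm ?_ (m.nonneg y hy i hi)⟩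
    have := m.nonneg _ h i hi
    rw [add_sub_cancel_left, map_smul, ← neg_sub, map_neg, Finsupp.smul_apply,
      Finsupp.neg_apply, smul_eq_mul] at this
    nlinarith
  · rintro ⟨hy, h⟩
    obtain ⟨δ, hδ, h1, -⟩ := m.exists_add_smul_mem (x - y)
      (fun i hi => by rw [← neg_sub, map_neg, Finsupp.neg_apply, h i hi, neg_zero]) univ_mem
    exact ⟨hy, δ, hδ, h1⟩

/-- Smallest faces can be computed inside an exposed face. In particular polytopes with a common
face have the same smallest face at the points of this face. -/
theorem minFace_of_isExposed {A F : Set (Fin n → ℝ)} (hF : IsExposed ℝ A F)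
    {x : Fin n → ℝ} (hx : x ∈ F) : minFace F x = minFace A x := by
  ext y
  constructor
  · rintro ⟨hy, δ, hδ, h⟩
    exact ⟨hF.subset hy, δ, hδ, hF.subset h⟩
  · rintro ⟨hy, δ, hδ, h⟩
    obtain ⟨l, hl⟩ := hF ⟨x, hx⟩
    rw [hl] at hx
    have h1 := hx.2 y hy
    have h2 := hx.2 _ h
    rw [map_add, map_smul, map_sub, smul_eq_mul] at h2
    have h3 : l y = l x := le_antisymm h1 (by nlinarith)
    refine ⟨?_, δ, hδ, ?_⟩
    · rw [hl]
      exact ⟨hy, fun z hz => h3 ▸ hx.2 z hz⟩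
    · rw [hl]
      refine ⟨h, fun z hz => ?_⟩
      rw [map_add, map_smul, map_sub, h3, sub_self, smul_zero, add_zero]
      exact hx.2 z hz

theorem mem_intrinsicInterior_iff_eventually {s : Set (Fin n → ℝ)} {x : Fin n → ℝ} :
    x ∈ intrinsicInterior ℝ s ↔
      x ∈ s ∧ ∀ᶠ y in 𝓝 x, y ∈ affineSpan ℝ s → y ∈ s := by
  constructor
  · intro h
    refine ⟨intrinsicInterior_subset h, ?_⟩
    obtain ⟨y, hy, rfl⟩ := mem_intrinsicInterior.1 h
    rw [mem_interior_iff_mem_nhds, mem_nhds_subtype_iff_nhdsWithin,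
      mem_nhdsWithin_iff_eventually] at hy
    filter_upwards [hy] with z hz hz'
    obtain ⟨w, hw, rfl⟩ := hz hz'
    exact hw
  · rintro ⟨hx, h⟩
    rw [mem_intrinsicInterior]
    refine ⟨⟨x, subset_affineSpan ℝ s hx⟩, ?_, rfl⟩
    rw [mem_interior_iff_mem_nhds, mem_nhds_subtype_iff_nhdsWithin, mem_nhdsWithin_iff_eventually]
    filter_upwards [h] with z hz hz'
    exact ⟨⟨z, hz'⟩, hz hz', rfl⟩

theorem add_smul_sub_mem_affineSpan {s : Set (Fin n → ℝ)} {x y z : Fin n → ℝ}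
    (hx : x ∈ affineSpan ℝ s) (hy : y ∈ affineSpan ℝ s) (hz : z ∈ affineSpan ℝ s) (c : ℝ) :
    x + c • (y - z) ∈ affineSpan ℝ s := by
  have := AffineSubspace.vadd_mem_of_mem_direction
    (Submodule.smul_mem _ c (AffineSubspace.vsub_mem_direction hy hz)) hx
  rwa [vadd_eq_add, add_comm] at this

theorem exists_add_smul_mem_of_intrinsicInterior {s : Set (Fin n → ℝ)} {x y : Fin n → ℝ}
    (hx : x ∈ intrinsicInterior ℝ s) (hy : y ∈ s) : ∃ δ : ℝ, 0 < δ ∧ x + δ • (x - y) ∈ s := by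
  obtain ⟨hxs, h⟩ := mem_intrinsicInterior_iff_eventually.1 hx
  have hc : Tendsto (fun ε : ℝ => x + ε • (x - y)) (𝓝[>] 0) (𝓝 x) := by
    have : Continuous fun ε : ℝ => x + ε • (x - y) := by fun_prop
    simpa using (this.tendsto 0).mono_left nhdsWithin_le_nhds
  obtain ⟨ε, h1, h2⟩ := ((hc.eventually h).and
    (self_mem_nhdsWithin : Set.Ioi (0 : ℝ) ∈ 𝓝[>] 0)).exists
  exact ⟨ε, h2, h1 (add_smul_sub_mem_affineSpan (subset_affineSpan _ _ hxs)
    (subset_affineSpan _ _ hxs) (subset_affineSpan _ _ hy) ε)⟩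

theorem LocalModel.mem_intrinsicInterior_face {A : Set (Fin n → ℝ)} {x : Fin n → ℝ}
    (m : LocalModel A x) : x ∈ intrinsicInterior ℝ (m.face m.idx) := by
  rw [mem_intrinsicInterior_iff_eventually]
  refine ⟨m.self_mem_face _, ?_⟩
  filter_upwards [m.nhds] with y hy hys
  have h0 : ∀ i ∈ m.idx, m.basis.repr (y - x) i = 0 := by
    have h1 : y -ᵥ x ∈ vectorSpan ℝ (m.face m.idx) := by
      rw [← direction_affineSpan]
      exact AffineSubspace.vsub_mem_direction hys (subset_affineSpan _ _ (m.self_mem_face _))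
    rw [m.vectorSpan_face, Module.Basis.mem_span_image] at h1
    intro i hi
    by_contra hne
    exact h1 (Finsupp.mem_support_iff.2 hne) hi
  exact ⟨hy fun i hi => (h0 i hi).ge, h0⟩

/-- The relative interior of a convex set meeting the relative interior of a larger convex set is
contained in it. -/
theorem intrinsicInterior_subset_of_mem {s t : Set (Fin n → ℝ)} (hst : s ⊆ t) (ht : Convex ℝ t)
    {y : Fin n → ℝ} (hys : y ∈ s) (hyt : y ∈ intrinsicInterior ℝ t) :
    intrinsicInterior ℝ s ⊆ intrinsicInterior ℝ t := by
  intro z hz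
  obtain ⟨δ, hδ, hw⟩ := exists_add_smul_mem_of_intrinsicInterior hz hys
  have hzt := hst (intrinsicInterior_subset hz)
  rw [mem_intrinsicInterior_iff_eventually] at hyt ⊢
  refine ⟨hzt, ?_⟩
  have hc : Tendsto (fun u => y + ((1 + δ) / δ) • (u - z)) (𝓝 z) (𝓝 y) := by
    have : Continuous fun u => y + ((1 + δ) / δ) • (u - z) := by fun_prop
    simpa using this.tendsto z
  filter_upwards [hc.eventually hyt.2] with u hu hut
  have hu' := hu (add_smul_sub_mem_affineSpan (subset_affineSpan _ _ hyt.1) hut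
    (subset_affineSpan _ _ hzt) _)
  have h1 := ht (hst hw) hu' (a := 1 / (1 + δ)) (b := δ / (1 + δ)) (by positivity)
    (by positivity) (by field_simp)
  convert h1 using 1
  have e1 : δ / (1 + δ) * ((1 + δ) / δ) = 1 := by field_simp
  have e2 : (1 / (1 + δ)) * δ = δ / (1 + δ) := by ring
  have e3 : 1 / (1 + δ) + δ / (1 + δ) = 1 := by field_simp
  calc u = (1 / (1 + δ) + δ / (1 + δ)) • z + (δ / (1 + δ) * ((1 + δ) / δ)) • (u - z) := by
        rw [e1, e3]; module
    _ = (1 / (1 + δ)) • z + (1 / (1 + δ) * δ) • (z - y) + (δ / (1 + δ)) • y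
          + (δ / (1 + δ) * ((1 + δ) / δ)) • (u - z) := by rw [e2]; module
    _ = _ := by module

theorem IsPolytopeFace.convex {A F : Set (Fin n → ℝ)} (h : IsPolytopeFace A F)
    (hA : Convex ℝ A) : Convex ℝ F := h.1.convex hA

/-- The face of a polytope carrying a point `y` carries every convex subset having `y` in its
relative interior. -/
theorem LocalModel.carrier_face {A σ : Set (Fin n → ℝ)} {y : Fin n → ℝ}
    (m : LocalModel A y) (hA : Convex ℝ A) (hσ : σ ⊆ A) (hy : y ∈ intrinsicInterior ℝ σ) :
    σ ⊆ m.face m.idx ∧ intrinsicInterior ℝ σ ⊆ intrinsicInterior ℝ (m.face m.idx) := by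
  have h1 : σ ⊆ m.face m.idx := by
    intro z hz
    rw [← m.minFace_eq]
    obtain ⟨δ, hδ, h⟩ := exists_add_smul_mem_of_intrinsicInterior hy hz
    exact ⟨hσ hz, δ, hδ, hσ h⟩
  exact ⟨h1, intrinsicInterior_subset_of_mem h1
    ((m.isPolytopeFace_face subset_rfl).convex hA) (intrinsicInterior_subset hy)
    m.mem_intrinsicInterior_face⟩

end LocalModels

/-! ### Walls between the polytopes of a partition -/

section Walls

open Filter Topology

variable {n : ℕ}

theorem LatticePolytope.isCompact_carrier (P : LatticePolytope n) : IsCompact P.carrier := by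
  obtain ⟨V, -, h⟩ := P.exists_points
  rw [h]
  exact (V.finite_toSet.image _).isCompact_convexHull ℝ

/-- An open set is not covered by finitely many hyperplanes. -/
theorem exists_mem_open_avoiding_hyperplanes {κ : Type*} [Finite κ] {U : Set (Fin n → ℝ)}
    (hU : IsOpen U) (hne : U.Nonempty) (g : κ → (Fin n → ℝ) →ₗ[ℝ] ℝ) (c : κ → ℝ)
    (hg : ∀ a, g a ≠ 0) : ∃ y ∈ U, ∀ a, g a y ≠ c a := by
  have hopen : ∀ a, IsOpen {y | g a y ≠ c a} := fun a =>
    isOpen_ne_fun (g a).continuous_of_finiteDimensional continuous_const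
  have hdense : ∀ a, Dense {y | g a y ≠ c a} := by
    intro a
    rw [dense_iff_inter_open]
    rintro V hV ⟨y, hy⟩
    by_cases h : g a y = c a
    · obtain ⟨v, hv⟩ : ∃ v, g a v ≠ 0 := by
        by_contra! h0
        exact hg a (LinearMap.ext h0)
      have hc : Tendsto (fun ε : ℝ => y + ε • v) (𝓝[>] 0) (𝓝 y) := by
        have : Continuous fun ε : ℝ => y + ε • v := by fun_prop
        simpa using (this.tendsto 0).mono_left nhdsWithin_le_nhds
      obtain ⟨ε, h1, h2⟩ := ((hc.eventually_mem (hV.mem_nhds hy)).and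
        (self_mem_nhdsWithin : Set.Ioi (0 : ℝ) ∈ 𝓝[>] 0)).exists
      have h2 : (0 : ℝ) < ε := h2
      exact ⟨_, h1, by simp [h, h2.ne', hv]⟩
    · exact ⟨y, hy, h⟩
  obtain ⟨y, hy, hy'⟩ := (dense_iInter_of_isOpen hopen hdense).inter_open_nonempty U hU hne
  exact ⟨y, hy, fun a => Set.mem_iInter.1 hy' a⟩

theorem basis_coord_ne_zero (b : Module.Basis (Fin n) ℝ (Fin n → ℝ)) (i : Fin n) :
    b.coord i ≠ 0 := by
  intro h
  have := LinearMap.congr_fun h (b i)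
  simp at this

namespace LocalModel

variable {A B : Set (Fin n → ℝ)} {x : Fin n → ℝ}

theorem mem_nhds_of_idx_eq_empty (m : LocalModel A x) (h : m.idx = ∅) : A ∈ 𝓝 x := by
  have := m.nhds
  simpa [h] using this

theorem exists_mem_interior (m : LocalModel A x) {s : Set (Fin n → ℝ)} (hs : s ∈ 𝓝 x) :
    ∃ y ∈ s, y ∈ interior A ∧ ∀ i, 0 < m.basis.repr (y - x) i := by
  obtain ⟨y, -, hys, hy, hpos⟩ := m.exists_generic ∅ hs
  refine ⟨y, hys, ?_, fun i => hpos i (by simp)⟩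
  rw [mem_interior_iff_mem_nhds]
  have h : ∀ᶠ z in 𝓝 y, ∀ i, 0 < m.basis.repr (z - x) i := by
    rw [eventually_all]
    exact fun i => ((continuous_repr m.basis x i).tendsto y).eventually
      (lt_mem_nhds (hpos i (by simp)))
  filter_upwards [h, hy] with z h1 h2
  exact h2 fun i _ => (h1 i).le

theorem notMem_interior_of_disjoint (m : LocalModel A x) (h : Disjoint (interior B) (interior A)) :
    x ∉ interior B := by
  intro hx
  obtain ⟨y, hyB, hyA, -⟩ := m.exists_mem_interior (isOpen_interior.mem_nhds hx)
  exact Set.disjoint_left.1 h hyB hyA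

/-- If a facet of `A` is contained in `B`, and the interiors of `A` and `B` are disjoint, then at a
relative interior point `x` of the facet `B` is the half-space opposite to `A`. -/
theorem opposite_halfSpace (m : LocalModel A x) {i : Fin n} (hi : m.idx = {i})
    (m' : LocalModel B x) (hAB : m.face {i} ⊆ B) (hdisj : Disjoint (interior A) (interior B)) :
    (∀ y ∈ B, m.basis.repr (y - x) i ≤ 0) ∧
      ∀ᶠ z in 𝓝 x, m.basis.repr (z - x) i ≤ 0 → z ∈ B := by
  -- the inequalities of `B` are equalities on the facet, hence multiples of the coordinate `i`
  have hbk : ∀ k, k ≠ i → ∀ i' ∈ m'.idx, m'.basis.repr (m.basis k) i' = 0 := by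
    intro k hk i' hi'
    have key : ∀ s : ℝ, s ≠ 0 → 0 ≤ s * m'.basis.repr (m.basis k) i' := by
      intro s hs
      have h0 : m.basis.repr (s • m.basis k) i = 0 := by simp [hk]
      obtain ⟨ε, hε, h, -⟩ := m.exists_add_smul_mem (s • m.basis k)
        (fun l hl => by
          rw [hi, Finset.mem_singleton] at hl
          rw [hl, h0]) univ_mem
      have h1 : x + ε • s • m.basis k ∈ m.face {i} := ⟨h, fun l hl => by
        rw [Finset.mem_singleton.1 hl, add_sub_cancel_left, map_smul, Finsupp.smul_apply, h0,
          smul_zero]⟩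
      have h2 := m'.nonneg _ (hAB h1) i' hi'
      rw [add_sub_cancel_left, map_smul, map_smul, Finsupp.smul_apply, Finsupp.smul_apply,
        smul_eq_mul, smul_eq_mul] at h2
      exact nonneg_of_mul_nonneg_right h2 hε
    have h1 := key 1 one_ne_zero
    have h2 := key (-1) (by norm_num)
    linarith
  have hmul : ∀ i' ∈ m'.idx, ∀ v, m'.basis.repr v i'
      = m'.basis.repr (m.basis i) i' * m.basis.repr v i := by
    intro i' hi' v
    conv_lhs => rw [← m.basis.sum_repr v]
    rw [map_sum, Finsupp.finsetSum_apply, Finset.sum_eq_single i]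
    · rw [map_smul, Finsupp.smul_apply, smul_eq_mul, mul_comm]
    · intro k _ hk
      rw [map_smul, Finsupp.smul_apply, hbk k hk i' hi', smul_zero]
    · simp
  -- if all factors were nonnegative, then `B` would contain interior points of `A`
  obtain ⟨i', hi', hneg⟩ : ∃ i' ∈ m'.idx, m'.basis.repr (m.basis i) i' < 0 := by
    by_contra! hcon
    obtain ⟨y, hy, hyA, hypos⟩ := m.exists_mem_interior (eventually_eventually_nhds.2 m'.nhds)
    refine Set.disjoint_left.1 hdisj hyA ?_
    rw [mem_interior_iff_mem_nhds]
    filter_upwards [hy, ((continuous_repr m.basis x i).tendsto y).eventually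
      (lt_mem_nhds (hypos i))] with z h1 h2
    refine h1 fun l hl => ?_
    rw [hmul l hl]
    exact mul_nonneg (hcon l hl) h2.le
  -- distinct coordinates are not proportional
  have huniq : ∀ l ∈ m'.idx, l = i' := by
    intro l hl
    by_contra hne
    have h1 := hmul i' hi' (m'.basis l)
    have h2 := hmul l hl (m'.basis l)
    rw [m'.basis.repr_self, Finsupp.single_eq_of_ne (Ne.symm hne)] at h1
    rw [m'.basis.repr_self, Finsupp.single_eq_same] at h2
    rcases mul_eq_zero.1 h1.symm with h | h
    · exact hneg.ne h
    · rw [h, mul_zero] at h2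
      exact one_ne_zero h2
  constructor
  · intro y hy
    have := m'.nonneg y hy i' hi'
    rw [hmul i' hi'] at this
    nlinarith
  · filter_upwards [m'.nhds] with z hz hz'
    refine hz fun l hl => ?_
    rw [huniq l hl, hmul i' hi']
    nlinarith

end LocalModel

namespace SimplicialPartition

variable {P : LatticePolytope n} {ι : Type*} (Γ : SimplicialPartition P ι)

/-- A local model of a polytope of the partition at one of its points. -/
noncomputable def model (j : ι) {x : Fin n → ℝ} (hx : x ∈ (Γ.piece j).carrier) :
    LocalModel (Γ.piece j).carrier x :=
  ((Γ.simplicial j).exists_localModel hx).some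

theorem piece_subset (j : ι) : (Γ.piece j).carrier ⊆ P.carrier := by
  rw [← Γ.union_eq]
  exact Set.subset_iUnion (fun j => (Γ.piece j).carrier) j

theorem exists_mem_piece {x : Fin n → ℝ} (hx : x ∈ P.carrier) : ∃ j, x ∈ (Γ.piece j).carrier := by
  rw [← Γ.union_eq] at hx
  exact Set.mem_iUnion.1 hx

theorem eq_of_mem_interior {j k : ι} {x : Fin n → ℝ} (hj : x ∈ interior (Γ.piece j).carrier)
    (hk : x ∈ (Γ.piece k).carrier) : j = k := by
  by_contra hne
  exact (Γ.model k hk).notMem_interior_of_disjoint (Γ.disjoint_interior j k hne) hj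

variable {Γ}

theorem faceDim_carrier (hP : P.IsSimplicial) : faceDim P.carrier = n := by
  obtain ⟨x, hx⟩ := P.carrier_nonempty
  obtain ⟨m⟩ := hP.exists_localModel hx
  have h := m.faceDim_face ∅
  have h2 : m.face ∅ = P.carrier := by ext y; simp [LocalModel.mem_face]
  rwa [h2, Finset.card_empty, add_zero] at h

/-- A facet of a polytope of a semi-stable partition meeting the interior is a facet of exactly one
other polytope. -/
theorem IsSemistable.exists_adjacent (hP : P.IsSimplicial) (hss : Γ.IsSemistable) {j : ι}
    {x w : Fin n → ℝ} (m : LocalModel (Γ.piece j).carrier x) {i : Fin n} (hi : i ∈ m.idx)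
    (hw : w ∈ m.face {i}) (hwP : w ∈ interior P.carrier) :
    ∃ k, k ≠ j ∧ (Γ.piece k).IsFace (m.face {i}) := by
  have hface : (Γ.piece j).IsFace (m.face {i}) := m.isPolytopeFace_face (by simpa using hi)
  have h := hss _ P.carrier ⟨j, hface⟩ ⟨IsExposed.refl _, P.carrier_nonempty⟩
    (intrinsicInterior_subset_of_mem (hface.1.subset.trans (Γ.piece_subset j)) P.carrier_convex hw
      (interior_subset_intrinsicInterior hwP))
  have hd := m.faceDim_face {i}
  rw [Finset.card_singleton] at hd
  rw [faceDim_carrier hP] at h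
  have h2 : (Γ.piecesAt (m.face {i})).ncard = 2 := by omega
  obtain ⟨a, b, hab, hs⟩ := Set.ncard_eq_two.1 h2
  have hj : j ∈ Γ.piecesAt (m.face {i}) := hface
  have ha : a ∈ Γ.piecesAt (m.face {i}) := by rw [hs]; simp
  have hb : b ∈ Γ.piecesAt (m.face {i}) := by rw [hs]; simp
  by_cases haj : a = j
  · exact ⟨b, fun h => hab (haj.trans h.symm), hb⟩
  · exact ⟨a, haj, ha⟩

/-- Two polytopes sharing a facet of the first at a relative interior point `w` of the facet fill a
neighbourhood of `w`. -/
theorem eq_or_eq_of_mem_wall {j k l : ι} (hjk : j ≠ k) {w : Fin n → ℝ}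
    (m : LocalModel (Γ.piece j).carrier w) {i : Fin n} (hi : m.idx = {i})
    (hk : m.face {i} ⊆ (Γ.piece k).carrier) (hl : w ∈ (Γ.piece l).carrier) : l = j ∨ l = k := by
  obtain ⟨-, hnb⟩ := m.opposite_halfSpace hi (Γ.model k (hk (m.self_mem_face _))) hk
    (Γ.disjoint_interior j k hjk)
  have hnb' := m.nhds
  rw [hi] at hnb'
  simp only [Finset.mem_singleton, forall_eq] at hnb'
  obtain ⟨s, hs, hs1, hs2⟩ := eventually_nhds_iff.1
    (eventually_eventually_nhds.2 (hnb.and hnb'))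
  obtain ⟨u₀, hu₀, hu₀', -⟩ := (Γ.model l hl).exists_mem_interior (hs1.mem_nhds hs2)
  obtain ⟨u, ⟨hus, hul⟩, hu⟩ := exists_mem_open_avoiding_hyperplanes (κ := Unit)
    (hs1.inter isOpen_interior) ⟨u₀, hu₀, hu₀'⟩ (fun _ => m.basis.coord i)
    (fun _ => m.basis.coord i w) fun _ => basis_coord_ne_zero _ _
  have hu : m.basis.repr (u - w) i ≠ 0 := by
    have := hu ()
    rwa [map_sub, Finsupp.sub_apply, sub_ne_zero]
  have hmem := hs u hus
  have hc := (continuous_repr m.basis w i).tendsto u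
  rcases lt_or_gt_of_ne hu with h | h
  · right
    refine (Γ.eq_of_mem_interior ?_ (interior_subset hul)).symm
    rw [mem_interior_iff_mem_nhds]
    filter_upwards [hmem, hc.eventually (gt_mem_nhds h)] with z h1 h2 using h1.1 h2.le
  · left
    refine (Γ.eq_of_mem_interior ?_ (interior_subset hul)).symm
    rw [mem_interior_iff_mem_nhds]
    filter_upwards [hmem, hc.eventually (lt_mem_nhds h)] with z h1 h2 using h1.2 h2.le

/-- All polytopes of a semi-stable partition containing a point have the same smallest face
containing this point. The proof crosses walls along a segment joining two of the polytopes near the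
point which avoids all faces of codimension two. -/
theorem IsSemistable.minFace_eq [Finite ι] (hP : P.IsSimplicial) (hss : Γ.IsSemistable)
    {x : Fin n → ℝ} {j k : ι} (hj : x ∈ (Γ.piece j).carrier) (hk : x ∈ (Γ.piece k).carrier) :
    minFace (Γ.piece j).carrier x = minFace (Γ.piece k).carrier x := by
  classical
  -- a ball around `x` in which all local models are valid
  have hgood : ∀ᶠ y in 𝓝 x, ∀ l, (x ∉ (Γ.piece l).carrier → y ∉ (Γ.piece l).carrier) ∧
      ∀ hl : x ∈ (Γ.piece l).carrier, ∀ᶠ z in 𝓝 y,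
        (∀ i ∈ (Γ.model l hl).idx, 0 ≤ (Γ.model l hl).basis.repr (z - x) i) →
          z ∈ (Γ.piece l).carrier := by
    rw [eventually_all]
    intro l
    by_cases hl : x ∈ (Γ.piece l).carrier
    · filter_upwards [(Γ.model l hl).eventually_shift] with y hy
      exact ⟨fun h => absurd hl h, fun _ => hy⟩
    · filter_upwards [(Γ.piece l).isCompact_carrier.isClosed.isOpen_compl.mem_nhds hl] with y hy
      exact ⟨fun _ => hy, fun h => absurd h hl⟩
  obtain ⟨r, hr, hball⟩ := Metric.eventually_nhds_iff_ball.1 hgood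
  -- First `z` is chosen such that all the coordinates of `z - x` in one local model are distinct
  -- from zero, then `y` such that no two coordinates vanish at the same point of the segment from
  -- `z` to `y`.
  let κ := {l : ι // x ∈ (Γ.piece l).carrier} × Fin n × Fin n
  let f : κ → (Fin n → ℝ) →ₗ[ℝ] ℝ := fun a => (Γ.model a.1.1 a.1.2).basis.coord a.2.1
  let f' : κ → (Fin n → ℝ) →ₗ[ℝ] ℝ := fun a => (Γ.model a.1.1 a.1.2).basis.coord a.2.2
  obtain ⟨z₁, hz₁, hz₁', -⟩ := (Γ.model k hk).exists_mem_interior (Metric.ball_mem_nhds x hr)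
  obtain ⟨z, ⟨hzb, hzk⟩, hz⟩ := exists_mem_open_avoiding_hyperplanes
    (Metric.isOpen_ball.inter isOpen_interior) ⟨z₁, hz₁, hz₁'⟩ f (fun a => f a x)
    fun a => basis_coord_ne_zero _ _
  obtain ⟨y₁, hy₁, hy₁', -⟩ := (Γ.model j hj).exists_mem_interior (Metric.ball_mem_nhds x hr)
  let κ' := {a : κ // a.2.1 ≠ a.2.2}
  let G : κ' → (Fin n → ℝ) →ₗ[ℝ] ℝ := fun a => f' a (z - x) • f a - f a (z - x) • f' a
  obtain ⟨y, ⟨hyb, hyj⟩, hy⟩ := exists_mem_open_avoiding_hyperplanes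
    (Metric.isOpen_ball.inter isOpen_interior) ⟨y₁, hy₁, hy₁'⟩ G (fun a => G a x) (by
      rintro ⟨⟨l, i, i'⟩, hne⟩ h0
      have h1 := LinearMap.congr_fun h0 ((Γ.model l.1 l.2).basis i)
      have h2 := hz (l, i', i)
      have h3 : i' ≠ i := Ne.symm hne
      simp only [G, f, f', LinearMap.sub_apply, LinearMap.smul_apply, Module.Basis.coord_apply,
        Module.Basis.repr_self, Finsupp.single_eq_same, smul_eq_mul, mul_one,
        Finsupp.single_eq_of_ne h3, mul_zero, sub_zero, LinearMap.zero_apply, map_sub] at h1 h2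
      exact h2 (sub_eq_zero.1 h1))
  let γ : ℝ → Fin n → ℝ := fun t => z + t • (y - z)
  have hγ : Continuous γ := by fun_prop
  have hseg : ∀ t ∈ Set.Icc (0 : ℝ) 1, γ t ∈ segment ℝ z y := by
    intro t ht
    rw [segment_eq_image']
    exact ⟨t, ht, rfl⟩
  have hγb : ∀ t ∈ Set.Icc (0 : ℝ) 1, γ t ∈ Metric.ball x r := fun t ht =>
    (convex_ball x r).segment_subset hzb hyb (hseg t ht)
  have hγP : ∀ t ∈ Set.Icc (0 : ℝ) 1, γ t ∈ interior P.carrier := fun t ht =>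
    P.carrier_convex.interior.segment_subset (interior_mono (Γ.piece_subset k) hzk)
      (interior_mono (Γ.piece_subset j) hyj) (hseg t ht)
  -- two polytopes which meet at a point of the segment share a facet through this point and `x`
  have hstep : ∀ t ∈ Set.Icc (0 : ℝ) 1, ∀ l l', γ t ∈ (Γ.piece l).carrier →
      γ t ∈ (Γ.piece l').carrier →
      minFace (Γ.piece l).carrier x = minFace (Γ.piece l').carrier x := by
    intro t ht l l' hl hl'
    by_cases hll : l = l'
    · rw [hll]
    have hgl := (hball _ (hγb t ht) l)
    have hxl : x ∈ (Γ.piece l).carrier := by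
      by_contra h
      exact hgl.1 h hl
    set m := Γ.model l hxl with hm
    let m₁ : LocalModel (Γ.piece l).carrier (γ t) := m.shift (hgl.2 hxl) hl
    have hm₁idx : m₁.idx = m.idx.filter fun i => m.basis.repr (γ t - x) i = 0 := rfl
    have hcard : ∀ i ∈ m₁.idx, ∀ i' ∈ m₁.idx, i = i' := by
      intro i hi i' hi'
      by_contra hne
      rw [hm₁idx, Finset.mem_filter] at hi hi'
      have hval : ∀ q, m.basis.repr (γ t - x) q
          = m.basis.repr (z - x) q + t * (m.basis.repr (y - x) q - m.basis.repr (z - x) q) := by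
        intro q
        have : γ t - x = (z - x) + t • ((y - x) - (z - x)) := by simp only [γ]; module
        rw [this, map_add, map_smul, map_sub]
        simp
      have e1 := hi.2
      have e2 := hi'.2
      rw [hval] at e1 e2
      have hG : m.basis.repr (z - x) i' * m.basis.repr (y - x) i
          - m.basis.repr (z - x) i * m.basis.repr (y - x) i' ≠ 0 := by
        have := hy ⟨(⟨l, hxl⟩, i, i'), hne⟩
        rw [← sub_ne_zero, ← map_sub] at this
        exact this
      have ht0 : t = 0 := by
        have : t * (m.basis.repr (z - x) i' * m.basis.repr (y - x) i
          - m.basis.repr (z - x) i * m.basis.repr (y - x) i') = 0 := by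
          linear_combination m.basis.repr (z - x) i' * e1 - m.basis.repr (z - x) i * e2
        exact (mul_eq_zero.1 this).resolve_right hG
      rw [ht0, zero_mul, add_zero, map_sub, Finsupp.sub_apply, sub_eq_zero] at e1
      exact hz (⟨l, hxl⟩, i, i') e1
    rcases m₁.idx.eq_empty_or_nonempty with h0 | ⟨i, hi⟩
    · exact absurd (Γ.eq_of_mem_interior
        (mem_interior_iff_mem_nhds.2 (m₁.mem_nhds_of_idx_eq_empty h0)) hl') hll
    · have hidx : m₁.idx = {i} := by
        ext i'
        rw [Finset.mem_singleton]
        exact ⟨fun h => hcard i' h i hi, fun h => h ▸ hi⟩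
      have hi2 := hi
      rw [hm₁idx, Finset.mem_filter] at hi2
      have hfe : m₁.face {i} = m.face {i} := by
        ext u
        simp only [LocalModel.mem_face, Finset.mem_singleton, forall_eq]
        rw [← m.repr_sub_eq hi2.2 u]
        rfl
      obtain ⟨l'', hne, hl''⟩ := hss.exists_adjacent hP m hi2.1
        (by rw [← hfe]; exact m₁.self_mem_face _) (hγP t ht)
      have heq : l' = l'' := by
        rcases eq_or_eq_of_mem_wall hne.symm m₁ hidx (by rw [hfe]; exact hl''.1.subset) hl'
          with h | h
        · exact absurd h.symm hll
        · exact h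
      rw [heq, ← minFace_of_isExposed hl''.1 (m.self_mem_face _)]
      exact (minFace_of_isExposed (m.isPolytopeFace_face (by simpa using hi2.1)).1
        (m.self_mem_face _)).symm
  -- by connectedness of the segment the smallest faces of all polytopes on it agree
  by_contra hne
  have hclosed : ∀ p : ι → Prop, IsClosed {t | ∃ l, p l ∧ γ t ∈ (Γ.piece l).carrier} := by
    intro p
    have : {t | ∃ l, p l ∧ γ t ∈ (Γ.piece l).carrier}
        = ⋃ l ∈ {l | p l}, γ ⁻¹' (Γ.piece l).carrier := by
      ext t; simp
    rw [this]
    exact (Set.toFinite _).isClosed_biUnion fun l _ =>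
      (Γ.piece l).isCompact_carrier.isClosed.preimage hγ
  have hconn := isPreconnected_closed_iff.1 (isPreconnected_Icc (a := (0 : ℝ)) (b := 1)) _ _
    (hclosed fun l => minFace (Γ.piece l).carrier x = minFace (Γ.piece k).carrier x)
    (hclosed fun l => minFace (Γ.piece l).carrier x ≠ minFace (Γ.piece k).carrier x)
    (by
      intro t ht
      obtain ⟨l, hl⟩ := Γ.exists_mem_piece (interior_subset (hγP t ht))
      by_cases h : minFace (Γ.piece l).carrier x = minFace (Γ.piece k).carrier x
      · exact Or.inl ⟨l, h, hl⟩
      · exact Or.inr ⟨l, h, hl⟩)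
    ⟨0, by simp, k, rfl, by simpa [γ] using interior_subset hzk⟩
    ⟨1, by simp, j, hne, by simpa [γ] using interior_subset hyj⟩
  obtain ⟨t, ht, ⟨l, h1, hl⟩, l', h2, hl'⟩ := hconn
  exact h2 ((hstep t ht l l' hl hl').symm.trans h1)

end SimplicialPartition

end Walls

/-! ### The combinatorics of a semi-stable partition -/

section Combinatorics

open Filter Topology

variable {n : ℕ}

namespace SimplicialPartition

variable {P : LatticePolytope n} {ι : Type*} {Γ : SimplicialPartition P ι}

/-- The semi-stability condition, expressed by the numbers of inequalities which describe `P` and a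
polytope of the partition near a point `x`. -/
theorem IsSemistable.ncard_add_card [Finite ι] (hP : P.IsSimplicial) (hss : Γ.IsSemistable)
    {x : Fin n → ℝ} (mP : LocalModel P.carrier x) {j : ι}
    (m : LocalModel (Γ.piece j).carrier x) :
    {k | x ∈ (Γ.piece k).carrier}.ncard + mP.idx.card = m.idx.card + 1 := by
  have hface : (Γ.piece j).IsFace (m.face m.idx) := m.isPolytopeFace_face subset_rfl
  have h := hss _ _ ⟨j, hface⟩ (mP.isPolytopeFace_face subset_rfl)
    (mP.carrier_face P.carrier_convex (hface.1.subset.trans (Γ.piece_subset j))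
      m.mem_intrinsicInterior_face).2
  have hN : Γ.piecesAt (m.face m.idx) = {k | x ∈ (Γ.piece k).carrier} := by
    ext k
    constructor
    · intro hk
      exact hk.1.subset (m.self_mem_face _)
    · intro hk
      have e : m.face m.idx = (Γ.model k hk).face (Γ.model k hk).idx := by
        rw [← m.minFace_eq, ← LocalModel.minFace_eq]
        exact hss.minFace_eq hP m.mem hk
      change IsPolytopeFace _ _
      rw [e]
      exact (Γ.model k hk).isPolytopeFace_face subset_rfl
  rw [hN] at h
  have h1 := m.faceDim_face m.idx
  have h2 := mP.faceDim_face mP.idx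
  omega

/-- If a facet of one polytope is contained in another, then it is their intersection. -/
theorem inter_eq_facet {j k : ι} (hjk : j ≠ k) {x : Fin n → ℝ}
    (m : LocalModel (Γ.piece j).carrier x) {i : Fin n} (hi : i ∈ m.idx)
    (hk : m.face {i} ⊆ (Γ.piece k).carrier) :
    (∀ y ∈ (Γ.piece k).carrier, m.basis.repr (y - x) i ≤ 0) ∧
      (Γ.piece j).carrier ∩ (Γ.piece k).carrier = m.face {i} := by
  have h1 : ∀ y ∈ (Γ.piece k).carrier, m.basis.repr (y - x) i ≤ 0 := by
    obtain ⟨w, hw, -, hwn, hwpos⟩ := m.exists_generic {i} univ_mem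
    let m₁ := m.shift hwn hw.1
    have hw0 : m.basis.repr (w - x) i = 0 := hw.2 i (Finset.mem_singleton_self i)
    have hidx : m₁.idx = {i} := by
      ext l
      simp only [m₁, LocalModel.shift, Finset.mem_filter, Finset.mem_singleton]
      constructor
      · rintro ⟨-, h⟩
        by_contra hne
        exact (hwpos l (by simpa using hne)).ne' h
      · rintro rfl
        exact ⟨hi, hw0⟩
    have hfe : m₁.face {i} = m.face {i} := by
      ext u
      simp only [LocalModel.mem_face, Finset.mem_singleton, forall_eq]
      rw [← m.repr_sub_eq hw0 u]
      rfl
    intro y hy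
    have := (m₁.opposite_halfSpace hidx (Γ.model k (hk hw)) (by rwa [hfe])
      (Γ.disjoint_interior j k hjk)).1 y hy
    rw [← m.repr_sub_eq hw0 y]
    exact this
  refine ⟨h1, ?_⟩
  ext y
  constructor
  · rintro ⟨hyj, hyk⟩
    refine ⟨hyj, fun l hl => ?_⟩
    rw [Finset.mem_singleton.1 hl]
    exact le_antisymm (h1 y hyk) (m.nonneg y hyj i hi)
  · intro hy
    exact ⟨hy.1, hk hy⟩

/-- At a point `x` of the polytope `j`, the facets of this polytope through `x` correspond to the
other polytopes through `x` and to the facets of `P` through `x`. The correspondence is injective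
by geometric reasons, and bijective since the semi-stability condition makes the numbers agree. -/
theorem IsSemistable.exists_facet_equiv [Finite ι] (hP : P.IsSimplicial) (hss : Γ.IsSemistable)
    {x : Fin n → ℝ} (mP : LocalModel P.carrier x) {j : ι}
    (m : LocalModel (Γ.piece j).carrier x) :
    ∃ e : m.idx ≃ {k // x ∈ (Γ.piece k).carrier ∧ k ≠ j} ⊕ mP.idx,
      (∀ k : {k // x ∈ (Γ.piece k).carrier ∧ k ≠ j},
        (Γ.piece j).carrier ∩ (Γ.piece k).carrier = m.face {(e.symm (Sum.inl k) : Fin n)} ∧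
        ∀ y ∈ (Γ.piece k).carrier, m.basis.repr (y - x) (e.symm (Sum.inl k)) ≤ 0) ∧
      ∀ a : mP.idx, ∃ c : ℝ, 0 < c ∧
        ∀ v, mP.basis.repr v a = c * m.basis.repr v (e.symm (Sum.inr a)) := by
  classical
  -- `R` relates a facet to the polytope, or to the facet of `P`, which contains it
  let R : m.idx → {k // x ∈ (Γ.piece k).carrier ∧ k ≠ j} ⊕ mP.idx → Prop := fun i o =>
    Sum.elim (fun k : {k // x ∈ (Γ.piece k).carrier ∧ k ≠ j} =>
      m.face {(i : Fin n)} ⊆ (Γ.piece k).carrier)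
      (fun a : mP.idx => ∃ c : ℝ, 0 < c ∧ ∀ v, mP.basis.repr v a = c * m.basis.repr v i) o
  have hex : ∀ i, ∃ o, R i o := by
    rintro ⟨i, hi⟩
    -- a point in the relative interior of the facet, near `x`
    obtain ⟨w, hw, hwP, hwn, hwpos⟩ := m.exists_generic {i} mP.eventually_shift
    by_cases hwI : w ∈ interior P.carrier
    · obtain ⟨k, hkj, hk⟩ := hss.exists_adjacent hP m hi hw hwI
      exact ⟨Sum.inl ⟨k, hk.1.subset (m.self_mem_face _), hkj⟩, hk.1.subset⟩
    · have hwPc := Γ.piece_subset j hw.1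
      let mw := mP.shift hwP hwPc
      have hne : mw.idx.Nonempty := by
        rw [Finset.nonempty_iff_ne_empty]
        intro h0
        exact hwI (mem_interior_iff_mem_nhds.2 (mw.mem_nhds_of_idx_eq_empty h0))
      obtain ⟨a, ha⟩ := hne
      have ha' : a ∈ mP.idx := (Finset.mem_filter.1 ha).1
      -- the facet of `P` through `w` contains all directions of the facet `i`
      have hbase : ∀ k, k ≠ i → ∀ s : ℝ, s ≠ 0 → 0 ≤ s * mP.basis.repr (m.basis k) a := by
        intro k hk s hs
        let m₁ := m.shift hwn hw.1
        obtain ⟨ε, hε, h, -⟩ := m₁.exists_add_smul_mem (s • m.basis k) (fun l hl => by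
          have hl0 : m.basis.repr (w - x) l = 0 := (Finset.mem_filter.1 hl).2
          have hli : l = i := by
            by_contra hne
            exact (hwpos l (by simpa using hne)).ne' hl0
          change 0 ≤ m.basis.repr (s • m.basis k) l
          rw [hli]
          simp [hk]) univ_mem
        have h2 := mw.nonneg _ (Γ.piece_subset j h) a ha
        rw [add_sub_cancel_left] at h2
        change 0 ≤ mP.basis.repr (ε • s • m.basis k) a at h2
        rw [map_smul, map_smul, Finsupp.smul_apply, Finsupp.smul_apply, smul_eq_mul,
          smul_eq_mul] at h2
        exact nonneg_of_mul_nonneg_right h2 hε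
      have hbk : ∀ k, k ≠ i → mP.basis.repr (m.basis k) a = 0 := by
        intro k hk
        have h1 := hbase k hk 1 one_ne_zero
        have h2 := hbase k hk (-1) (by norm_num)
        linarith
      have hmul : ∀ v, mP.basis.repr v a = mP.basis.repr (m.basis i) a * m.basis.repr v i := by
        intro v
        conv_lhs => rw [← m.basis.sum_repr v]
        rw [map_sum, Finsupp.finsetSum_apply, Finset.sum_eq_single i]
        · rw [map_smul, Finsupp.smul_apply, smul_eq_mul, mul_comm]
        · intro k _ hk
          rw [map_smul, Finsupp.smul_apply, hbk k hk, smul_zero]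
        · simp
      refine ⟨Sum.inr ⟨a, ha'⟩, _, lt_of_le_of_ne ?_ ?_, hmul⟩
      · obtain ⟨ε, hε, h, -⟩ := m.exists_add_smul_mem (m.basis i) (fun l _ => by
          rw [m.basis.repr_self, Finsupp.single_apply]; split_ifs <;> simp) univ_mem
        have h2 := mP.nonneg _ (Γ.piece_subset j h) a ha'
        rw [add_sub_cancel_left, map_smul, Finsupp.smul_apply, smul_eq_mul] at h2
        exact nonneg_of_mul_nonneg_right h2 hε
      · intro h0
        have := hmul (mP.basis a)
        rw [← h0, zero_mul, mP.basis.repr_self, Finsupp.single_eq_same] at this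
        exact one_ne_zero this
  choose φ hφ using hex
  have hinj : Function.Injective φ := by
    rintro ⟨i, hi⟩ ⟨i', hi'⟩ h
    by_contra hne
    have hne : i ≠ i' := fun h => hne (Subtype.ext h)
    have h1 := hφ ⟨i, hi⟩
    have h2 := hφ ⟨i', hi'⟩
    rw [← h] at h2
    rcases hφi : φ ⟨i, hi⟩ with k | a
    · rw [hφi] at h1 h2
      have e1 := (inter_eq_facet k.2.2.symm m hi h1).2
      have e2 := (inter_eq_facet k.2.2.symm m hi' h2).2
      obtain ⟨w, hw, -, -, hwpos⟩ := m.exists_generic {i} univ_mem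
      have hw2 := hw
      rw [← e1, e2] at hw2
      exact (hwpos i' (by simpa using hne.symm)).ne' (hw2.2 i' (Finset.mem_singleton_self _))
    · rw [hφi] at h1 h2
      obtain ⟨c, hc, h1⟩ := h1
      obtain ⟨c', hc', h2⟩ := h2
      have e1 := h1 (m.basis i)
      have e2 := h2 (m.basis i)
      simp only [m.basis.repr_self, Finsupp.single_eq_same, mul_one,
        Finsupp.single_eq_of_ne hne.symm, mul_zero] at e1 e2
      exact hc.ne' (e1.symm.trans e2)
  -- the numbers of elements agree by semi-stability
  have hcard := hss.ncard_add_card hP mP m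
  have hN : {k | x ∈ (Γ.piece k).carrier}.ncard
      = Nat.card {k // x ∈ (Γ.piece k).carrier ∧ k ≠ j} + 1 := by
    have : {k | x ∈ (Γ.piece k).carrier} = insert j {k | x ∈ (Γ.piece k).carrier ∧ k ≠ j} := by
      ext k
      by_cases h : k = j
      · simp [h, m.mem]
      · simp [h]
    rw [this, Set.ncard_insert_of_notMem (by simp)]
    rfl
  have hbij : Function.Bijective φ := by
    refine hinj.bijective_of_nat_card_le ?_
    rw [Nat.card_sum, Nat.card_eq_fintype_card (α := m.idx), Nat.card_eq_fintype_card (α := mP.idx),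
      Fintype.card_coe, Fintype.card_coe]
    omega
  refine ⟨Equiv.ofBijective φ hbij, fun k => ?_, fun a => ?_⟩
  · have h1 := hφ ((Equiv.ofBijective φ hbij).symm (Sum.inl k))
    have h2 : φ ((Equiv.ofBijective φ hbij).symm (Sum.inl k)) = Sum.inl k :=
      (Equiv.ofBijective φ hbij).apply_symm_apply _
    rw [h2] at h1
    have h3 := inter_eq_facet k.2.2.symm m (Subtype.prop _) h1
    exact ⟨h3.2, h3.1⟩
  · have h1 := hφ ((Equiv.ofBijective φ hbij).symm (Sum.inr a))
    have h2 : φ ((Equiv.ofBijective φ hbij).symm (Sum.inr a)) = Sum.inr a :=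
      (Equiv.ofBijective φ hbij).apply_symm_apply _
    rw [h2] at h1
    exact h1

theorem affineSpan_carrier (hP : P.IsSimplicial) : affineSpan ℝ P.carrier = ⊤ := by
  obtain ⟨x, hx⟩ := P.carrier_nonempty
  obtain ⟨m⟩ := hP.exists_localModel hx
  obtain ⟨y, -, hy, -⟩ := m.exists_mem_interior univ_mem
  have h := isOpen_interior.affineSpan_eq_top ⟨y, hy⟩
  exact top_le_iff.1 (h ▸ affineSpan_mono ℝ interior_subset)

/-- The common face of the polytopes in a set `S` of polytopes through a point `x`. -/
theorem IsSemistable.exists_iInter_eq_face [Finite ι] (hP : P.IsSimplicial) (hss : Γ.IsSemistable)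
    {x : Fin n → ℝ} {S : Set ι} (hx : ∀ k ∈ S, x ∈ (Γ.piece k).carrier) {j : ι} (hj : j ∈ S) :
    ∃ J ⊆ (Γ.model j (hx j hj)).idx, J.card + 1 = S.ncard ∧
      (Γ.model j (hx j hj)).face J = ⋂ k ∈ S, (Γ.piece k).carrier := by
  classical
  have : Fintype ι := Fintype.ofFinite ι
  obtain ⟨mP⟩ := hP.exists_localModel (Γ.piece_subset j (hx j hj))
  set m := Γ.model j (hx j hj)
  obtain ⟨e, he, -⟩ := hss.exists_facet_equiv hP mP m
  let T : Finset {k // x ∈ (Γ.piece k).carrier ∧ k ≠ j} := Finset.univ.filter fun k => k.1 ∈ S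
  let g : {k // x ∈ (Γ.piece k).carrier ∧ k ≠ j} → Fin n := fun k => e.symm (Sum.inl k)
  have hg : Function.Injective g := fun a b h => by
    have := e.symm.injective (Subtype.ext h)
    exact Sum.inl_injective this
  refine ⟨T.image g, ?_, ?_, ?_⟩
  · intro i hi
    obtain ⟨k, -, rfl⟩ := Finset.mem_image.1 hi
    exact Subtype.prop _
  · rw [Finset.card_image_of_injective _ hg]
    have h1 : S = insert j (Subtype.val '' (T : Set {k // x ∈ (Γ.piece k).carrier ∧ k ≠ j})) := by
      ext k
      by_cases h : k = j
      · simp [h, hj]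
      · simp only [Set.mem_insert_iff, h, false_or, Set.mem_image, Finset.mem_coe, T,
          Finset.mem_filter, Finset.mem_univ, true_and]
        exact ⟨fun hk => ⟨⟨k, hx k hk, h⟩, hk, rfl⟩, by rintro ⟨k', hk', rfl⟩; exact hk'⟩
    conv_rhs => rw [h1]
    rw [Set.ncard_insert_of_notMem (by rintro ⟨k, -, hk⟩; exact k.2.2 hk),
      Set.ncard_image_of_injective _ Subtype.val_injective, Set.ncard_coe_finset]
  · ext y
    simp only [LocalModel.mem_face, Finset.mem_image, Set.mem_iInter]
    constructor
    · rintro ⟨hy, h⟩ k hk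
      by_cases hkj : k = j
      · rw [hkj]; exact hy
      · let k' : {k // x ∈ (Γ.piece k).carrier ∧ k ≠ j} := ⟨k, hx k hk, hkj⟩
        have h1 : y ∈ m.face {g k'} := ⟨hy, fun i hi => h i ⟨k', by simp [T, k', hk],
          (Finset.mem_singleton.1 hi).symm⟩⟩
        rw [← (he k').1] at h1
        exact h1.2
    · intro h
      refine ⟨h j hj, ?_⟩
      rintro i ⟨k, hk, rfl⟩
      have h1 : y ∈ m.face {g k} := by
        rw [← (he k).1]
        exact ⟨h j hj, h k (by simpa [T] using hk)⟩
      exact h1.2 _ (Finset.mem_singleton_self _)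

/-- The common face of a set of polytopes with a common point lies in the interior of `P`, and these
polytopes are all those containing the face. Hence the dual complex is the nerve of the partition.
-/
theorem IsSemistable.mem_dualComplex_iff [Finite ι] (hP : P.IsSimplicial) (hss : Γ.IsSemistable)
    (S : Set ι) :
    S ∈ Γ.dualComplex ↔ S.Nonempty ∧ (⋂ k ∈ S, (Γ.piece k).carrier).Nonempty := by
  constructor
  · rintro ⟨σ, ⟨j, hj⟩, -, rfl⟩
    obtain ⟨x, hx⟩ := hj.2
    exact ⟨⟨j, hj⟩, x, Set.mem_iInter₂.2 fun k hk => hk.1.subset hx⟩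
  · rintro ⟨⟨j, hj⟩, x, hx'⟩
    have hx : ∀ k ∈ S, x ∈ (Γ.piece k).carrier := Set.mem_iInter₂.1 hx'
    clear hx'
    set σ := ⋂ k ∈ S, (Γ.piece k).carrier with hσ
    have hface : ∀ k ∈ S, (Γ.piece k).IsFace σ := by
      intro k hk
      obtain ⟨J, hJ, -, h⟩ := hss.exists_iInter_eq_face hP hx hk
      rw [hσ, ← h]
      exact (Γ.model k (hx k hk)).isPolytopeFace_face hJ
    have hconv : Convex ℝ σ := convex_iInter₂ fun k _ => (Γ.piece k).carrier_convex
    obtain ⟨y, hy⟩ := (intrinsicInterior_nonempty hconv).2 (hface j hj).2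
    have hσP : σ ⊆ P.carrier := (hface j hj).1.subset.trans (Γ.piece_subset j)
    obtain ⟨mP⟩ := hP.exists_localModel (hσP (intrinsicInterior_subset hy))
    have h1 := mP.carrier_face P.carrier_convex hσP hy
    have h2 := hss _ _ ⟨j, hface j hj⟩ (mP.isPolytopeFace_face subset_rfl) h1.2
    have h3 := mP.faceDim_face mP.idx
    obtain ⟨J, hJ, hJc, hJf⟩ := hss.exists_iInter_eq_face hP hx hj
    have h4 := (Γ.model j (hx j hj)).faceDim_face J
    rw [hJf, ← hσ] at h4
    have hSsub : S ⊆ Γ.piecesAt σ := fun k hk => hface k hk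
    have hfin : (Γ.piecesAt σ).Finite := Set.toFinite _
    -- the semi-stability condition for `σ` and its dimension leave no room for a facet of `P` or
    -- for a further polytope containing `σ`
    have h5 := Set.ncard_le_ncard hSsub hfin
    have hidx : mP.idx = ∅ := by
      rw [← Finset.card_eq_zero]
      omega
    refine ⟨σ, ⟨j, hface j hj⟩, ?_, Set.eq_of_subset_of_ncard_le hSsub (by omega) hfin⟩
    refine h1.2.trans ?_
    have h6 : mP.face mP.idx = P.carrier := by
      rw [hidx]; ext z; simp [LocalModel.mem_face]
    rw [h6]
    intro z hz
    rw [mem_intrinsicInterior_iff_eventually] at hz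
    rw [mem_interior_iff_mem_nhds]
    have := hz.2
    rw [affineSpan_carrier hP] at this
    filter_upwards [this] with u hu using hu trivial

end SimplicialPartition

end Combinatorics

/-! ### Integral equations of the walls -/

section WallForms

open Filter Topology

variable {n : ℕ}

/-- The linear form on `ℝⁿ` with integral coefficients `a`. -/
def realForm (a : Fin n → ℤ) : (Fin n → ℝ) →ₗ[ℝ] ℝ where
  toFun v := ∑ i, (a i : ℝ) * v i
  map_add' u v := by simp [mul_add, Finset.sum_add_distrib]
  map_smul' c v := by
    simp only [Pi.smul_apply, smul_eq_mul, RingHom.id_apply, Finset.mul_sum]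
    exact Finset.sum_congr rfl fun i _ => by ring

theorem realForm_apply (a : Fin n → ℤ) (v : Fin n → ℝ) :
    realForm a v = ∑ i, (a i : ℝ) * v i := rfl

theorem realForm_latticeToReal (a m : Fin n → ℤ) :
    realForm a (latticeToReal m) = ((∑ i, a i * m i : ℤ) : ℝ) := by
  simp [realForm_apply, latticeToReal]

theorem realForm_single (a : Fin n → ℤ) (i : Fin n) : realForm a (Pi.single i 1) = a i := by
  simp [realForm_apply, Pi.single_apply]

theorem realForm_sub (a b : Fin n → ℤ) : realForm (a - b) = realForm a - realForm b :=
  LinearMap.ext fun v => by simp [realForm_apply, sub_mul, Finset.sum_sub_distrib]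

theorem realForm_neg (a : Fin n → ℤ) : realForm (-a) = -realForm a :=
  LinearMap.ext fun v => by simp [realForm_apply]

/-- The value at a point of `ℝⁿ` of the affine function with integral coefficients `f`, whose
second component is the constant term. -/
def affineValue (f : (Fin n → ℤ) × ℤ) (x : Fin n → ℝ) : ℝ := realForm f.1 x + f.2

theorem affineValue_sub (f g : (Fin n → ℤ) × ℤ) (x : Fin n → ℝ) :
    affineValue (f - g) x = affineValue f x - affineValue g x := by
  simp only [affineValue, Prod.fst_sub, Prod.snd_sub, realForm_sub, LinearMap.sub_apply,
    Int.cast_sub]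
  ring

theorem affineValue_neg (f : (Fin n → ℤ) × ℤ) (x : Fin n → ℝ) :
    affineValue (-f) x = -affineValue f x := by
  simp only [affineValue, Prod.fst_neg, Prod.snd_neg, realForm_neg, LinearMap.neg_apply,
    Int.cast_neg]
  ring

theorem affineValue_eq_add (f : (Fin n → ℤ) × ℤ) (x y : Fin n → ℝ) :
    affineValue f y = affineValue f x + realForm f.1 (y - x) := by
  simp only [affineValue, map_sub]; ring

theorem IsPrimitiveVector.neg {v : Fin n → ℤ} (hv : IsPrimitiveVector v) :
    IsPrimitiveVector (-v) := by
  intro k w h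
  exact hv k (-w) (by rw [smul_neg, ← h, neg_neg])

/-- The coordinates of a basis of `ℝⁿ` consisting of lattice vectors are, up to positive factors,
primitive integral linear forms: the columns of the adjugate matrix are proportional to them. -/
theorem exists_primitive_realForm {b : Module.Basis (Fin n) ℝ (Fin n → ℝ)} {v : Fin n → Fin n → ℤ}
    (hb : ∀ i, b i = latticeToReal (v i)) (i : Fin n) :
    ∃ a : Fin n → ℤ, IsPrimitiveVector a ∧ ∃ c : ℝ, 0 < c ∧
      ∀ y, realForm a y = c * b.repr y i := by
  classical
  let M : Matrix (Fin n) (Fin n) ℤ := Matrix.of v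
  have hdet : M.det ≠ 0 := by
    intro h
    have h1 : LinearIndependent ℝ (M.map (Int.cast : ℤ → ℝ)).row := by
      convert! b.linearIndependent using 1
      ext r l
      rw [hb]
      rfl
    rw [Matrix.linearIndependent_rows_iff_isUnit, Matrix.isUnit_iff_isUnit_det] at h1
    have h2 : (M.map (Int.cast : ℤ → ℝ)).det = ((M.det : ℤ) : ℝ) := (Int.cast_det M).symm
    rw [h2, h] at h1
    simp at h1
  have key : ∀ (s : ℤ) y, realForm (fun l => s * M.adjugate l i) y
      = (s * M.det : ℤ) * b.repr y i := by
    intro s y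
    have : realForm (fun l => s * M.adjugate l i) = ((s * M.det : ℤ) : ℝ) • b.coord i := by
      refine b.ext fun r => ?_
      rw [hb, realForm_latticeToReal, ← hb, LinearMap.smul_apply, Module.Basis.coord_apply,
        b.repr_self, Finsupp.single_apply]
      have h1 := congrFun (congrFun (Matrix.mul_adjugate M) r) i
      rw [Matrix.mul_apply, Matrix.smul_apply, Matrix.one_apply] at h1
      have h2 : ∑ l, s * M.adjugate l i * v r l = s * (∑ l, M r l * M.adjugate l i) := by
        rw [Finset.mul_sum]
        exact Finset.sum_congr rfl fun l _ => by simp only [M, Matrix.of_apply]; ring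
      rw [h2, h1]
      split_ifs <;> simp
    rw [this]; rfl
  -- the sign of the determinant
  obtain ⟨s, hs⟩ : ∃ s : ℤ, 0 < s * M.det := by
    rcases lt_or_gt_of_ne hdet with h | h
    · exact ⟨-1, by linarith⟩
    · exact ⟨1, by linarith⟩
  have hne : (fun l => s * M.adjugate l i) ≠ 0 := by
    intro h0
    have := key s (b i)
    rw [h0, b.repr_self, Finsupp.single_eq_same] at this
    have h1 : realForm (0 : Fin n → ℤ) (b i) = 0 := by simp [realForm_apply]
    rw [h1, mul_one] at this
    exact hs.ne (by exact_mod_cast this)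
  obtain ⟨g, a, hg, ha, hga⟩ := exists_primitive_vector hne
  have hg' : (0 : ℝ) < g := by exact_mod_cast hg
  have hs' : (0 : ℝ) < (s * M.det : ℤ) := by exact_mod_cast hs
  refine ⟨a, ha, (g : ℝ)⁻¹ * (s * M.det : ℤ), by positivity, fun y => ?_⟩
  have h1 := key s y
  rw [hga] at h1
  have h2 : realForm (g • a) y = g * realForm a y := by
    simp only [realForm_apply, Finset.mul_sum, Pi.smul_apply, smul_eq_mul, Int.cast_mul, mul_assoc]
  rw [h2] at h1
  rw [mul_assoc, ← h1, ← mul_assoc, inv_mul_cancel₀ hg'.ne', one_mul]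

namespace SimplicialPartition

variable {P : LatticePolytope n} {ι : Type*} (Γ : SimplicialPartition P ι)

/-- `f` is the primitive integral equation of the wall between the polytopes `j` and `k`, with the
sign making it nonnegative on the polytope `j`. -/
structure IsWallForm (j k : ι) (f : (Fin n → ℤ) × ℤ) : Prop where
  primitive : IsPrimitiveVector f.1
  nonneg : ∀ y ∈ (Γ.piece j).carrier, 0 ≤ affineValue f y
  nonpos : ∀ y ∈ (Γ.piece k).carrier, affineValue f y ≤ 0
  mem_of_eq_zero : ∀ y ∈ (Γ.piece j).carrier, affineValue f y = 0 → y ∈ (Γ.piece k).carrier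

variable {Γ}

theorem IsSemistable.exists_isWallForm [Finite ι] (hP : P.IsSimplicial) (hss : Γ.IsSemistable)
    {j k : ι} (hjk : j ≠ k) {x : Fin n → ℝ} (hj : x ∈ (Γ.piece j).carrier)
    (hk : x ∈ (Γ.piece k).carrier) : ∃ f, Γ.IsWallForm j k f := by
  obtain ⟨mP⟩ := hP.exists_localModel (Γ.piece_subset j hj)
  obtain ⟨p, F, m, hm, hmF⟩ := (Γ.simplicial j).exists_frame_localModel hj
  obtain ⟨e, he, -⟩ := hss.exists_facet_equiv hP mP m
  obtain ⟨he1, he2⟩ := he ⟨k, hk, hjk.symm⟩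
  set i := e.symm (Sum.inl ⟨k, hk, hjk.symm⟩) with hi
  obtain ⟨a, ha, c, hc, hac⟩ := exists_primitive_realForm F.basis_eq (i : Fin n)
  obtain ⟨p₀, hp₀⟩ := F.lattice
  have hxp := hmF i i.2
  have hval : ∀ y, affineValue (a, -∑ l, a l * p₀ l) y = c * m.basis.repr (y - x) i := by
    intro y
    have h1 : affineValue (a, -∑ l, a l * p₀ l) p = 0 := by
      rw [affineValue, hp₀, realForm_latticeToReal]
      push_cast
      ring
    rw [affineValue_eq_add _ p y, h1, zero_add, hac, hm]
    have : y - p = (y - x) + (x - p) := by abel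
    rw [this, map_add, Finsupp.add_apply, hxp, add_zero]
  refine ⟨(a, -∑ l, a l * p₀ l), ha, fun y hy => ?_, fun y hy => ?_, fun y hy h => ?_⟩
  · rw [hval]
    exact mul_nonneg hc.le (m.nonneg y hy i i.2)
  · rw [hval]
    exact mul_nonpos_of_nonneg_of_nonpos hc.le (he2 y hy)
  · rw [hval, mul_eq_zero, or_iff_right hc.ne'] at h
    have : y ∈ m.face {(i : Fin n)} := ⟨hy, fun l hl => by rw [Finset.mem_singleton.1 hl, h]⟩
    rw [← he1] at this
    exact this.2

/-- The equation of a wall is determined by its sign and by being primitive. -/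
theorem IsSemistable.wallForm_unique [Finite ι] (hP : P.IsSimplicial) (hss : Γ.IsSemistable)
    {j k : ι} (hjk : j ≠ k) {x : Fin n → ℝ} (hj : x ∈ (Γ.piece j).carrier)
    (hk : x ∈ (Γ.piece k).carrier) {f g : (Fin n → ℤ) × ℤ}
    (hf : IsPrimitiveVector f.1) (hg : IsPrimitiveVector g.1)
    (hf0 : ∀ y ∈ (Γ.piece j).carrier ∩ (Γ.piece k).carrier, affineValue f y = 0)
    (hg0 : ∀ y ∈ (Γ.piece j).carrier ∩ (Γ.piece k).carrier, affineValue g y = 0)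
    (hfj : ∀ y ∈ (Γ.piece j).carrier, 0 ≤ affineValue f y)
    (hgj : ∀ y ∈ (Γ.piece j).carrier, 0 ≤ affineValue g y) : f = g := by
  obtain ⟨mP⟩ := hP.exists_localModel (Γ.piece_subset j hj)
  set m := Γ.model j hj
  obtain ⟨e, he, -⟩ := hss.exists_facet_equiv hP mP m
  obtain ⟨he1, -⟩ := he ⟨k, hk, hjk.symm⟩
  set i : Fin n := (e.symm (Sum.inl ⟨k, hk, hjk.symm⟩)).1 with hi
  -- the linear part of such an equation is a positive multiple of the coordinate of the wall
  have key : ∀ h : (Fin n → ℤ) × ℤ, IsPrimitiveVector h.1 →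
      (∀ y ∈ (Γ.piece j).carrier ∩ (Γ.piece k).carrier, affineValue h y = 0) →
      (∀ y ∈ (Γ.piece j).carrier, 0 ≤ affineValue h y) →
      ∃ c : ℝ, 0 < c ∧ ∀ v, realForm h.1 v = c * m.basis.repr v i := by
    intro h hprim h0 hnn
    have hx0 := h0 x ⟨hj, hk⟩
    have hb : ∀ l, ∃ ε : ℝ, 0 < ε ∧ x + ε • m.basis l ∈ (Γ.piece j).carrier := by
      intro l
      obtain ⟨ε, hε, h1, -⟩ := m.exists_add_smul_mem (m.basis l) (fun r _ => by
        rw [m.basis.repr_self, Finsupp.single_apply]; split_ifs <;> simp) univ_mem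
      exact ⟨ε, hε, h1⟩
    have hbl : ∀ l, l ≠ i → realForm h.1 (m.basis l) = 0 := by
      intro l hl
      obtain ⟨ε, hε, h1⟩ := hb l
      have h2 : x + ε • m.basis l ∈ m.face {i} := ⟨h1, fun r hr => by
        rw [Finset.mem_singleton.1 hr]
        simp [hl]⟩
      rw [← he1] at h2
      have h3 := h0 _ h2
      rw [affineValue_eq_add _ x, hx0, zero_add, add_sub_cancel_left, map_smul, smul_eq_mul,
        mul_eq_zero, or_iff_right hε.ne'] at h3
      exact h3
    have hmul : ∀ v, realForm h.1 v = realForm h.1 (m.basis i) * m.basis.repr v i := by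
      intro v
      conv_lhs => rw [← m.basis.sum_repr v]
      rw [map_sum, Finset.sum_eq_single i]
      · rw [map_smul, smul_eq_mul, mul_comm]
      · intro l _ hl
        rw [map_smul, hbl l hl, smul_zero]
      · simp
    refine ⟨_, lt_of_le_of_ne ?_ ?_, hmul⟩
    · obtain ⟨ε, hε, h1⟩ := hb i
      have h3 := hnn _ h1
      rw [affineValue_eq_add _ x, hx0, zero_add, add_sub_cancel_left, map_smul, smul_eq_mul] at h3
      exact nonneg_of_mul_nonneg_right h3 hε
    · intro h0
      apply hprim.ne_zero
      ext l
      have := hmul (Pi.single l 1)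
      rw [← h0, zero_mul, realForm_single] at this
      exact_mod_cast this
  obtain ⟨c, hc, hfc⟩ := key f hf hf0 hfj
  obtain ⟨d, hd, hgd⟩ := key g hg hg0 hgj
  have h1 : f.1 = g.1 := by
    refine hf.eq_of_smul hg (c := c / d) (by positivity) ?_
    ext l
    have e1 := hfc (Pi.single l 1)
    have e2 := hgd (Pi.single l 1)
    rw [realForm_single] at e1 e2
    simp only [latticeToReal, Pi.smul_apply, smul_eq_mul, e1, e2]
    field_simp
  refine Prod.ext h1 ?_
  have e1 := hf0 x ⟨hj, hk⟩
  have e2 := hg0 x ⟨hj, hk⟩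
  rw [affineValue, h1] at e1
  rw [affineValue] at e2
  have : (f.2 : ℝ) = g.2 := by linarith
  exact_mod_cast this

theorem IsWallForm.eq_zero {j k : ι} {f : (Fin n → ℤ) × ℤ} (hf : Γ.IsWallForm j k f)
    {y : Fin n → ℝ} (hy : y ∈ (Γ.piece j).carrier ∩ (Γ.piece k).carrier) :
    affineValue f y = 0 := le_antisymm (hf.nonpos y hy.2) (hf.nonneg y hy.1)

theorem IsSemistable.isWallForm_unique [Finite ι] (hP : P.IsSimplicial) (hss : Γ.IsSemistable)
    {j k : ι} (hjk : j ≠ k) {x : Fin n → ℝ} (hj : x ∈ (Γ.piece j).carrier)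
    (hk : x ∈ (Γ.piece k).carrier) {f g : (Fin n → ℤ) × ℤ}
    (hf : Γ.IsWallForm j k f) (hg : Γ.IsWallForm j k g) : f = g :=
  hss.wallForm_unique hP hjk hj hk hf.primitive hg.primitive (fun _ hy => hf.eq_zero hy)
    (fun _ hy => hg.eq_zero hy) hf.nonneg hg.nonneg

theorem IsSemistable.isWallForm_neg [Finite ι] (hP : P.IsSimplicial) (hss : Γ.IsSemistable)
    {j k : ι} (hjk : j ≠ k) {x : Fin n → ℝ} (hj : x ∈ (Γ.piece j).carrier)
    (hk : x ∈ (Γ.piece k).carrier) {f g : (Fin n → ℤ) × ℤ}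
    (hf : Γ.IsWallForm j k f) (hg : Γ.IsWallForm k j g) : f = -g :=
  hss.wallForm_unique hP hjk hj hk hf.primitive hg.primitive.neg (fun _ hy => hf.eq_zero hy)
    (fun y hy => by rw [affineValue_neg, hg.eq_zero ⟨hy.2, hy.1⟩, neg_zero]) hf.nonneg
    (fun y hy => by rw [affineValue_neg]; linarith [hg.nonpos y hy])

end SimplicialPartition

end WallForms

/-! ### The wall equations at a balanced non-singular vertex -/

section Cocycle

open Filter Topology

variable {n : ℕ}

theorem VertexFrame.face_univ {P : LatticePolytope n} {p : Fin n → ℝ} (F : VertexFrame P p)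
    (m : LocalModel P.carrier p) (hm : m.basis = F.basis) : m.face Finset.univ = {p} := by
  ext y
  rw [Set.mem_singleton_iff]
  constructor
  · rintro ⟨-, h⟩
    have : F.basis.repr (y - p) = 0 := by
      ext i
      rw [← hm]
      exact h i (Finset.mem_univ i)
    rw [LinearEquiv.map_eq_zero_iff, sub_eq_zero] at this
    exact this
  · rintro rfl
    exact m.self_mem_face _

/-- At a non-singular vertex the coordinates given by the primary vectors are integral. -/
theorem VertexFrame.exists_realForm_eq_coord {P : LatticePolytope n} {p : Fin n → ℝ}
    (F : VertexFrame P p) (hns : P.NonsingularAt p) (r : Fin n) :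
    ∃ a : Fin n → ℤ, realForm a = F.basis.coord r := by
  have h1 : ∀ m : Fin n → ℤ, ∃ z : ℤ, F.basis.coord r (latticeToReal m) = z := by
    intro m
    have hm : m ∈ Submodule.span ℤ (P.primaryVectors p) := by
      rw [show Submodule.span ℤ (P.primaryVectors p) = ⊤ from hns]; trivial
    induction hm using Submodule.span_induction with
    | mem v hv =>
      rw [F.primaryVectors_eq] at hv
      obtain ⟨i, rfl⟩ := hv
      rw [← F.basis_eq, Module.Basis.coord_apply, F.basis.repr_self, Finsupp.single_apply]
      exact ⟨if i = r then 1 else 0, by split_ifs <;> simp⟩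
    | zero => exact ⟨0, by rw [latticeToReal_zero, map_zero, Int.cast_zero]⟩
    | add u v _ _ hu hv =>
      obtain ⟨a, ha⟩ := hu
      obtain ⟨b, hb⟩ := hv
      exact ⟨a + b, by rw [latticeToReal_add, map_add, ha, hb, Int.cast_add]⟩
    | smul k v _ hv =>
      obtain ⟨a, ha⟩ := hv
      exact ⟨k * a, by rw [latticeToReal_zsmul, map_smul, ha, smul_eq_mul, Int.cast_mul]⟩
  choose a ha using fun l : Fin n => h1 (Pi.single l 1)
  refine ⟨a, (Pi.basisFun ℝ (Fin n)).ext fun l => ?_⟩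
  rw [Pi.basisFun_apply, realForm_single, ← ha]
  congr 1
  ext i
  by_cases h : i = l
  · subst h; simp [latticeToReal]
  · simp [latticeToReal, h]

namespace SimplicialPartition

variable {P : LatticePolytope n} {ι : Type*} {Γ : SimplicialPartition P ι}

theorem IsSemistable.isVertex_of_mem [Finite ι] (hP : P.IsSimplicial) (hss : Γ.IsSemistable)
    {p : Fin n → ℝ} {j k : ι} (hj : (Γ.piece j).IsVertex p) (hk : p ∈ (Γ.piece k).carrier) :
    (Γ.piece k).IsVertex p := by
  obtain ⟨F⟩ := (Γ.simplicial j).exists_vertexFrame hj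
  let m := F.localModel F.mem one_pos (by simpa using F.mem)
  have hidx : m.idx = Finset.univ := by
    ext i; simp [m, VertexFrame.localModel]
  have h := (Γ.model k hk).isPolytopeFace_face subset_rfl
  rw [← LocalModel.minFace_eq, hss.minFace_eq hP hk F.mem, m.minFace_eq, hidx,
    F.face_univ m rfl] at h
  exact h

/-- Near a balanced vertex `p` at which one of the polytopes is non-singular, the equations of the
walls are the differences of integral affine functions attached to the polytopes: if `τ` is the
face of `P` with `p` in its relative interior, then the edges in `τ` at `p` correspond to the
polytopes not containing them, and their primary vectors form, by the balancing condition, the rays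
of the fan of a projective space. -/
theorem IsSemistable.exists_wallForm_eq_sub [Finite ι] (hP : P.IsSimplicial)
    (hss : Γ.IsSemistable) {p : Fin n → ℝ} (hbal : Γ.BalancedAt p) {j₀ : ι}
    (hj₀ : (Γ.piece j₀).IsVertex p) (hns : (Γ.piece j₀).NonsingularAt p)
    (hthird : ∀ k k', ∃ l, l ≠ k ∧ l ≠ k' ∧ p ∈ (Γ.piece l).carrier) :
    ∃ G : ι → (Fin n → ℤ) × ℤ, ∀ i k, i ≠ k → p ∈ (Γ.piece i).carrier →
      p ∈ (Γ.piece k).carrier → Γ.IsWallForm i k (G k - G i) := by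
  classical
  have : Fintype ι := Fintype.ofFinite ι
  have hp₀ : p ∈ (Γ.piece j₀).carrier := hj₀.1.subset rfl
  obtain ⟨mP⟩ := hP.exists_localModel (Γ.piece_subset j₀ hp₀)
  -- the polytopes through `p`; all of them have `p` as a vertex
  let N := {l // p ∈ (Γ.piece l).carrier}
  let Fr : ∀ l : N, VertexFrame (Γ.piece l) p := fun l =>
    ((Γ.simplicial l).exists_vertexFrame (hss.isVertex_of_mem hP hj₀ l.2)).some
  let m : ∀ l : N, LocalModel (Γ.piece l).carrier p := fun l =>
    (Fr l).localModel (Fr l).mem one_pos (by simpa using (Fr l).mem)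
  have hidx : ∀ l r, r ∈ (m l).idx := fun l r => by simp [m, VertexFrame.localModel]
  choose e he1 he2 using fun l : N => hss.exists_facet_equiv hP mP (m l)
  -- `w l k` is the coordinate of `l` vanishing on the wall to `k`, and `bd l a` the one vanishing
  -- on the facet `a` of `P`
  let w : ∀ l k : N, k.1 ≠ l.1 → Fin n := fun l k h => ((e l).symm (Sum.inl ⟨k, k.2, h⟩)).1
  let bd : ∀ l : N, mP.idx → Fin n := fun l a => ((e l).symm (Sum.inr a)).1
  have hcover : ∀ (l : N) (r : Fin n), (∃ (k : N) (h : k.1 ≠ l.1), r = w l k h) ∨ ∃ a : mP.idx, r = bd l a := by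
    intro l r
    rcases hr : e l ⟨r, hidx l r⟩ with k | a
    · refine Or.inl ⟨⟨k.1, k.2.1⟩, k.2.2, ?_⟩
      have : (e l).symm (Sum.inl k) = ⟨r, hidx l r⟩ := by rw [← hr, Equiv.symm_apply_apply]
      exact (congrArg Subtype.val this).symm
    · refine Or.inr ⟨a, ?_⟩
      have : (e l).symm (Sum.inr a) = ⟨r, hidx l r⟩ := by rw [← hr, Equiv.symm_apply_apply]
      exact (congrArg Subtype.val this).symm
  have hwinj : ∀ (l k k' : N) (h : k.1 ≠ l.1) (h' : k'.1 ≠ l.1), w l k h = w l k' h' → k = k' := by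
    intro l k k' h h' heq
    have := Sum.inl_injective ((e l).symm.injective (Subtype.ext heq))
    exact Subtype.ext (congrArg (fun z => z.1) this)
  have hwbd : ∀ (l k : N) (h : k.1 ≠ l.1) (a : mP.idx), w l k h ≠ bd l a := by
    intro l k h a heq
    have := (e l).symm.injective (Subtype.ext heq)
    simp at this
  -- the defining properties of the two kinds of facets
  have hwall : ∀ (l k : N) (h : k.1 ≠ l.1), ∀ y ∈ (Γ.piece l).carrier,
      (Fr l).basis.repr (y - p) (w l k h) = 0 ↔ y ∈ (Γ.piece k).carrier := by
    intro l k h y hy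
    have h1 := (he1 l ⟨k, k.2, h⟩).1
    constructor
    · intro h0
      have : y ∈ (m l).face {w l k h} := ⟨hy, fun r hr => by rw [Finset.mem_singleton.1 hr]; exact h0⟩
      rw [← h1] at this
      exact this.2
    · intro hk
      have : y ∈ (m l).face {w l k h} := by rw [← h1]; exact ⟨hy, hk⟩
      exact this.2 _ (Finset.mem_singleton_self _)
  have hbdry : ∀ (l : N) (a : mP.idx), ∃ c : ℝ, 0 < c ∧
      ∀ v, mP.basis.repr v a = c * (Fr l).basis.repr v (bd l a) := he2
  -- the edge at `p` in `τ` which lies in all polytopes except `k`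
  let Ray : N → Set (Fin n → ℝ) := fun k =>
    {y | (∀ k' : N, k' ≠ k → y ∈ (Γ.piece k').carrier) ∧
      ∀ a : mP.idx, mP.basis.repr (y - p) a = 0}
  have hedge : ∀ (l k : N) (h : k.1 ≠ l.1), {y ∈ (Γ.piece l).carrier | ∀ r, r ≠ w l k h →
      (Fr l).basis.repr (y - p) r = 0} = Ray k := by
    intro l k h
    ext y
    constructor
    · rintro ⟨hy, h0⟩
      refine ⟨fun k' hk' => ?_, fun a => ?_⟩
      · by_cases hl : k'.1 = l.1
        · rw [hl]; exact hy
        · exact (hwall l k' hl y hy).1 (h0 _ fun hh => hk' (hwinj l _ _ hl h hh))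
      · obtain ⟨c, -, hc⟩ := hbdry l a
        rw [hc, h0 _ fun hh => hwbd l k h a hh.symm, mul_zero]
    · rintro ⟨h1, h2⟩
      have hy : y ∈ (Γ.piece l).carrier := h1 l fun hh => h (by rw [hh])
      refine ⟨hy, fun r hr => ?_⟩
      rcases hcover l r with ⟨k', h', rfl⟩ | ⟨a, rfl⟩
      · refine (hwall l k' h' y hy).2 (h1 k' ?_)
        rintro rfl
        exact hr rfl
      · obtain ⟨c, hc0, hc⟩ := hbdry l a
        have := h2 a
        rw [hc, mul_eq_zero, or_iff_right hc0.ne'] at this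
        exact this
  have hoth : ∀ k : N, ∃ l : N, k.1 ≠ l.1 := fun k => by
    obtain ⟨l, hl, -, hlp⟩ := hthird k k
    exact ⟨⟨l, hlp⟩, hl.symm⟩
  choose o ho using hoth
  -- the primary vector of the edge opposite to `k`, which does not depend on the polytope in which
  -- it is computed
  let u : N → Fin n → ℤ := fun k => (Fr (o k)).vec (w (o k) k (ho k))
  have hprimary : ∀ (l k : N) (h : k.1 ≠ l.1) (v : Fin n → ℤ), IsPrimaryVector (Ray k) p v ↔ v = (Fr l).vec (w l k h) := by
    intro l k h v
    rw [← hedge l k h]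
    exact (Fr l).isPrimaryVector_iff _ v
  have hu : ∀ (l k : N) (h : k.1 ≠ l.1), (Fr l).vec (w l k h) = u k := fun l k h =>
    (hprimary (o k) k (ho k) _).1 ((hprimary l k h _).2 rfl)
  have hub : ∀ (l k : N) (h : k.1 ≠ l.1), (Fr l).basis (w l k h) = latticeToReal (u k) := fun l k h => by
    rw [(Fr l).basis_eq, hu l k h]
  have huinj : Function.Injective u := by
    intro k k' hkk
    obtain ⟨l, hlk, hlk', hlp⟩ := hthird k k'
    have h1 := hub ⟨l, hlp⟩ k hlk.symm
    have h2 := hub ⟨l, hlp⟩ k' hlk'.symm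
    rw [hkk, ← h2] at h1
    exact hwinj ⟨l, hlp⟩ _ _ hlk.symm hlk'.symm ((Fr ⟨l, hlp⟩).basis.injective h1)
  -- the balancing condition
  have hset : Γ.primaryVectorsIn (mP.face mP.idx) p = Set.range u := by
    ext v
    constructor
    · rintro ⟨l, E, hE, hEτ, hv⟩
      have hlp : p ∈ (Γ.piece l).carrier := hE.1.1.subset (hE.2.2.1.subset rfl)
      rw [(Fr ⟨l, hlp⟩).edgesAt_eq] at hE
      obtain ⟨r, rfl⟩ := hE
      have hvr := ((Fr ⟨l, hlp⟩).isPrimaryVector_iff r v).1 hv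
      rcases hcover ⟨l, hlp⟩ r with ⟨k, h, rfl⟩ | ⟨a, rfl⟩
      · exact ⟨k, by rw [hvr, hu ⟨l, hlp⟩ k h]⟩
      · exfalso
        obtain ⟨ε, hε, h1⟩ := (Fr ⟨l, hlp⟩).tip (bd ⟨l, hlp⟩ a)
        have h2 : p + ε • (Fr ⟨l, hlp⟩).basis (bd ⟨l, hlp⟩ a) ∈ mP.face mP.idx :=
          hEτ ⟨h1, fun r hr => by simp [hr.symm]⟩
        have h3 := h2.2 a a.2
        obtain ⟨c, hc0, hc⟩ := hbdry ⟨l, hlp⟩ a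
        rw [add_sub_cancel_left, hc] at h3
        simp [hc0.ne', hε.ne'] at h3
    · rintro ⟨k, rfl⟩
      refine ⟨o k, Ray k, ?_, ?_, (hprimary _ _ (ho k) _).2 rfl⟩
      · rw [(Fr (o k)).edgesAt_eq]
        exact ⟨_, hedge _ _ (ho k)⟩
      · intro y hy
        exact ⟨Γ.piece_subset (o k) (hy.1 _ fun hh => ho k (by rw [hh])), fun a ha => hy.2 ⟨a, ha⟩⟩
  have hsum : ∑ k, u k = 0 := by
    have h1 := hbal _ (mP.isPolytopeFace_face subset_rfl) mP.mem_intrinsicInterior_face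
    rw [hset, finsum_mem_range huinj, finsum_eq_sum_of_fintype] at h1
    exact h1
  -- The linear forms `Gr k` are the coordinates of the non-singular polytope, and zero for this
  -- polytope itself. By the balancing condition their differences are the coordinates of the other
  -- polytopes.
  let o₀ : N := ⟨j₀, hp₀⟩
  let Gr : N → (Fin n → ℝ) →ₗ[ℝ] ℝ := fun k =>
    if h : k.1 ≠ o₀.1 then (Fr o₀).basis.coord (w o₀ k h) else 0
  have hGr0 : Gr o₀ = 0 := dif_neg (by simp)
  have hGrk : ∀ (k : N) (h : k.1 ≠ o₀.1), Gr k = (Fr o₀).basis.coord (w o₀ k h) := fun k h => dif_pos h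
  have hclaim1' : ∀ k k' : N, k' ≠ o₀ → Gr k (latticeToReal (u k')) = if k = k' then 1 else 0 := by
    intro k k' hk'
    have hk'' : k'.1 ≠ o₀.1 := fun hh => hk' (Subtype.ext hh)
    by_cases hk : k = o₀
    · rw [hk, hGr0, if_neg (Ne.symm hk'), LinearMap.zero_apply]
    · rw [hGrk k fun hh => hk (Subtype.ext hh), ← hub o₀ k' hk'', Module.Basis.coord_apply,
        Module.Basis.repr_self, Finsupp.single_apply]
      refine if_congr ⟨fun hh => (hwinj o₀ _ _ hk'' (fun hh => hk (Subtype.ext hh)) hh).symm, ?_⟩ rfl rfl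
      rintro rfl
      rfl
  have hclaim1 : ∀ k k' : N, Gr k (latticeToReal (u k'))
      = (if k = k' then 1 else 0) - if k' = o₀ then 1 else 0 := by
    intro k k'
    by_cases hk' : k' = o₀
    · have h1 : latticeToReal (u o₀) = -∑ l ∈ Finset.univ.erase o₀, latticeToReal (u l) := by
        rw [eq_neg_iff_add_eq_zero, Finset.add_sum_erase _ (fun l => latticeToReal (u l)) (Finset.mem_univ _)]
        have : ∀ s : Finset N, latticeToReal (∑ l ∈ s, u l) = ∑ l ∈ s, latticeToReal (u l) := by
          intro s
          ext i
          simp [latticeToReal]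
        rw [← this, hsum, latticeToReal_zero]
      rw [if_pos hk', hk', h1, map_neg, map_sum, Finset.sum_congr rfl fun l hl =>
        hclaim1' k l (Finset.ne_of_mem_erase hl), Finset.sum_ite_eq]
      by_cases hk : k = o₀ <;> simp [hk]
    · rw [hclaim1' k k' hk', if_neg hk', sub_zero]
  have hclaim2 : ∀ (i k : N) (h : k.1 ≠ i.1) (v : Fin n → ℝ),
      (Fr i).basis.repr v (w i k h) = Gr k v - Gr i v := by
    intro i k h v
    have : (Fr i).basis.coord (w i k h) = Gr k - Gr i := by
      refine (Fr i).basis.ext fun r => ?_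
      rw [Module.Basis.coord_apply, Module.Basis.repr_self, Finsupp.single_apply,
        LinearMap.sub_apply]
      rcases hcover i r with ⟨k', h', rfl⟩ | ⟨a, rfl⟩
      · rw [hub i k' h', hclaim1, hclaim1, if_neg (c := i = k') fun hh => h' (by rw [hh])]
        have : (w i k' h' = w i k h) ↔ k = k' := by
          refine ⟨fun hh => (hwinj i _ _ h' h hh).symm, ?_⟩
          rintro rfl
          rfl
        simp only [this]
        ring
      · rw [if_neg fun hh => hwbd i k h a hh.symm]
        obtain ⟨ε, hε, h1⟩ := (Fr i).tip (bd i a)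
        have h2 : ∀ k' : N, p + ε • (Fr i).basis (bd i a) ∈ (Γ.piece k').carrier := by
          intro k'
          by_cases hk' : k'.1 = i.1
          · rw [hk']; exact h1
          · refine (hwall i k' hk' _ h1).1 ?_
            rw [add_sub_cancel_left, map_smul, Finsupp.smul_apply, Module.Basis.repr_self,
              Finsupp.single_eq_of_ne (hwbd i k' hk' a), smul_zero]
        have h3 : ∀ k' : N, Gr k' ((Fr i).basis (bd i a)) = 0 := by
          intro k'
          by_cases hk' : k'.1 = o₀.1
          · rw [Subtype.ext hk', hGr0, LinearMap.zero_apply]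
          · have h4 := (hwall o₀ k' hk' _ (h2 o₀)).2 (h2 k')
            rw [add_sub_cancel_left, map_smul, Finsupp.smul_apply, smul_eq_mul, mul_eq_zero,
              or_iff_right hε.ne'] at h4
            rw [hGrk k' hk']
            exact h4
        rw [h3, h3, sub_zero]
    exact LinearMap.congr_fun this v
  -- integrality by non-singularity, and translation to the vertex `p`
  have hA : ∀ k : N, ∃ a : Fin n → ℤ, realForm a = Gr k := by
    intro k
    by_cases hk : k.1 = o₀.1
    · refine ⟨0, ?_⟩
      rw [Subtype.ext hk, hGr0]
      exact LinearMap.ext fun v => by simp [realForm_apply]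
    · rw [hGrk k hk]
      exact (Fr o₀).exists_realForm_eq_coord hns _
  choose a ha using hA
  obtain ⟨p₀, hp₀'⟩ := (Fr o₀).lattice
  refine ⟨fun l => if h : p ∈ (Γ.piece l).carrier then
    (a ⟨l, h⟩, -∑ r, a ⟨l, h⟩ r * p₀ r) else 0, fun i k hik hi hk => ?_⟩
  simp only [dif_pos hi, dif_pos hk]
  set i' : N := ⟨i, hi⟩
  set k' : N := ⟨k, hk⟩
  have hval0 : ∀ l : N, ∀ y, affineValue (a l, -∑ r, a l r * p₀ r) y = Gr l (y - p) := by
    intro l y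
    rw [map_sub, ← ha]
    have : realForm (a l) p = _ := (congrArg _ hp₀').trans (realForm_latticeToReal _ _)
    rw [this, affineValue]
    push_cast
    ring
  have hval : ∀ y, affineValue ((a k', -∑ r, a k' r * p₀ r) - (a i', -∑ r, a i' r * p₀ r)) y
      = (Fr i').basis.repr (y - p) (w i' k' hik.symm) := by
    intro y
    rw [affineValue_sub, hval0, hval0, hclaim2 i' k' hik.symm]
  refine ⟨?_, fun y hy => ?_, fun y hy => ?_, fun y hy h0 => ?_⟩
  · intro c v hcv
    -- the linear part has the value `1` on a lattice vector, so that it is primitive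
    have h1 : realForm (a k' - a i') (latticeToReal (u k')) = 1 := by
      rw [realForm_sub, ha, ha, LinearMap.sub_apply, ← hclaim2 i' k' hik.symm,
        ← hub i' k' hik.symm, Module.Basis.repr_self, Finsupp.single_eq_same]
    have h2 : a k' - a i' = c • v := hcv
    rw [h2, realForm_latticeToReal] at h1
    have h3 : ∑ r, (c • v) r * u k' r = 1 := by exact_mod_cast h1
    refine IsUnit.of_mul_eq_one (∑ r, v r * u k' r) ?_
    rw [← h3, Finset.mul_sum]
    exact Finset.sum_congr rfl fun r _ => by simp only [Pi.smul_apply, smul_eq_mul]; ring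
  · rw [hval]
    exact (Fr i').nonneg y hy _
  · rw [hval]
    exact (he1 i' ⟨k, hk, hik.symm⟩).2 y hy
  · rw [hval] at h0
    exact (hwall i' k' hik.symm y hy).1 h0

/-- The equations of the walls between the polytopes of a balanced semi-stable partition whose
triples of polytopes meet in non-singular vertices form a cocycle. -/
theorem IsSemistable.exists_wallForm_cocycle [Finite ι] (hP : P.IsSimplicial)
    (hss : Γ.IsSemistable) (hbal : Γ.IsBalanced) (htriple : Γ.TriplesMeetAtNonsingularVertex) :
    ∃ f : ι → ι → (Fin n → ℤ) × ℤ,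
      (∀ j k x, j ≠ k → x ∈ (Γ.piece j).carrier → x ∈ (Γ.piece k).carrier →
        Γ.IsWallForm j k (f j k)) ∧
      ∀ i j k x, x ∈ (Γ.piece i).carrier → x ∈ (Γ.piece j).carrier → x ∈ (Γ.piece k).carrier →
        f i j + f j k = f i k := by
  classical
  have hex : ∀ j k, ∃ f : (Fin n → ℤ) × ℤ, (j = k → f = 0) ∧ ∀ x, j ≠ k →
      x ∈ (Γ.piece j).carrier → x ∈ (Γ.piece k).carrier → Γ.IsWallForm j k f := by
    intro j k
    by_cases hjk : j = k
    · exact ⟨0, fun _ => rfl, fun _ h => absurd hjk h⟩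
    · by_cases hx : ∃ x, x ∈ (Γ.piece j).carrier ∧ x ∈ (Γ.piece k).carrier
      · obtain ⟨x, hj, hk⟩ := hx
        obtain ⟨f, hf⟩ := hss.exists_isWallForm hP hjk hj hk
        exact ⟨f, fun h => absurd h hjk, fun _ _ _ _ => hf⟩
      · push Not at hx
        exact ⟨0, fun _ => rfl, fun x _ hj hk => absurd hk (hx x hj)⟩
  choose f hf0 hf using hex
  refine ⟨f, fun j k x => hf j k x, fun i j k x hi hj hk => ?_⟩
  by_cases hij : i = j
  · rw [hf0 i j hij, zero_add, hij]
  by_cases hjk : j = k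
  · rw [hf0 j k hjk, add_zero, hjk]
  by_cases hik : i = k
  · subst hik
    rw [hf0 i i rfl, hss.isWallForm_neg hP hij hi hj (hf i j x hij hi hj) (hf j i x hjk hj hi),
      neg_add_cancel]
  -- three distinct polytopes: near a common non-singular vertex the cocycle is a coboundary
  obtain ⟨p, ⟨⟨hpi, hpj⟩, hpk⟩, hpv, j₀, hj₀, hns⟩ :=
    htriple i j k hij hjk hik ⟨x, ⟨hi, hj⟩, hk⟩
  obtain ⟨G, hG⟩ := hss.exists_wallForm_eq_sub hP (hbal p hpv) hj₀ hns (by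
    intro a b
    by_cases h1 : i = a ∨ i = b
    · by_cases h2 : j = a ∨ j = b
      · refine ⟨k, ?_, ?_, hpk⟩
        · rintro rfl; rcases h1 with h | h <;> rcases h2 with h' | h' <;> grind
        · rintro rfl; rcases h1 with h | h <;> rcases h2 with h' | h' <;> grind
      · push Not at h2
        exact ⟨j, h2.1, h2.2, hpj⟩
    · push Not at h1
      exact ⟨i, h1.1, h1.2, hpi⟩)
  have key : ∀ a b, a ≠ b → p ∈ (Γ.piece a).carrier → p ∈ (Γ.piece b).carrier →
      f a b = G b - G a := fun a b hab ha hb =>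
    hss.isWallForm_unique hP hab ha hb (hf a b p hab ha hb) (hG a b hab ha hb)
  rw [key i j hij hpi hpj, key j k hjk hpj hpk, key i k hik hpi hpk]
  abel

end SimplicialPartition

end Cocycle

/-! ### Cocycles on finite closed convex covers of a convex set -/

section Cech

variable {E G ι : Type*}

/-- Constants attached to the members of a finite closed cover of a connected set, which agree where
the members meet, are equal. -/
theorem eq_of_isPreconnected_cover [TopologicalSpace E] [Finite ι] {D : ι → Set E}
    (hD : ∀ i, IsClosed (D i)) {H : Set E} (hH : IsPreconnected H) (hcov : H ⊆ ⋃ i, D i)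
    {φ : ι → G} (hφ : ∀ i j, ∀ x ∈ H, x ∈ D i → x ∈ D j → φ i = φ j) {i j : ι}
    (hi : (H ∩ D i).Nonempty) (hj : (H ∩ D j).Nonempty) : φ i = φ j := by
  by_contra hne
  have hcl : ∀ s : Set ι, IsClosed (⋃ k ∈ s, D k) := fun s =>
    s.toFinite.isClosed_biUnion fun k _ => hD k
  obtain ⟨x, hx, hx1, hx2⟩ := isPreconnected_closed_iff.1 hH _ _ (hcl {k | φ k = φ i})
    (hcl {k | φ k ≠ φ i}) (fun y hy => by
      obtain ⟨k, hk⟩ := Set.mem_iUnion.1 (hcov hy)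
      by_cases h : φ k = φ i
      · exact Or.inl (Set.mem_biUnion (x := k) h hk)
      · exact Or.inr (Set.mem_biUnion (x := k) h hk))
    (hi.mono fun y hy => ⟨hy.1, Set.mem_biUnion (x := i) rfl hy.2⟩)
    (hj.mono fun y hy => ⟨hy.1, Set.mem_biUnion (x := j) (Ne.symm hne) hy.2⟩)
  simp only [Set.mem_iUnion] at hx1 hx2
  obtain ⟨a, ha, hxa⟩ := hx1
  obtain ⟨b, hb, hxb⟩ := hx2
  exact hb ((hφ b a x hx hxb hxa).trans ha)

variable [AddCommGroup G]

/-- On the set `C` the cocycle `c`, attached to a family of sets `D`, is the coboundary of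
constants attached to the members of `D`. -/
def IsCoboundaryOn (D : ι → Set E) (c : ι → ι → G) (C : Set E) : Prop :=
  ∃ g : ι → G, ∀ i j, ∀ x ∈ C, x ∈ D i → x ∈ D j → g i - g j = c i j

theorem IsCoboundaryOn.mono {D : ι → Set E} {c : ι → ι → G} {C C' : Set E}
    (h : IsCoboundaryOn D c C) (hC : C' ⊆ C) : IsCoboundaryOn D c C' := by
  obtain ⟨g, hg⟩ := h
  exact ⟨g, fun i j x hx => hg i j x (hC hx)⟩

variable [NormedAddCommGroup E] [NormedSpace ℝ E]

/-- Trivializations of a cocycle on the two sides of a hyperplane can be glued: they differ by a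
constant on the hyperplane section, which is convex. -/
theorem IsCoboundaryOn.glue [Finite ι] {D : ι → Set E} (hD : ∀ i, IsClosed (D i))
    (hconv : ∀ i, Convex ℝ (D i)) {c : ι → ι → G} {C : Set E} (hC : Convex ℝ C)
    (hcov : C ⊆ ⋃ i, D i) (f : E →L[ℝ] ℝ) (a : ℝ)
    (h1 : IsCoboundaryOn D c (C ∩ {x | f x ≤ a})) (h2 : IsCoboundaryOn D c (C ∩ {x | a ≤ f x})) :
    IsCoboundaryOn D c C := by
  classical
  obtain ⟨g1, hg1⟩ := h1
  obtain ⟨g2, hg2⟩ := h2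
  have hHc : Convex ℝ (C ∩ {x | f x = a}) := hC.inter (convex_hyperplane f.toLinearMap.isLinear a)
  obtain ⟨d, hd⟩ : ∃ d, ∀ i, ((C ∩ {x | f x = a}) ∩ D i).Nonempty → g1 i - g2 i = d := by
    by_cases h : ∃ i, ((C ∩ {x | f x = a}) ∩ D i).Nonempty
    · obtain ⟨i, hi⟩ := h
      refine ⟨g1 i - g2 i, fun j hj => ?_⟩
      refine eq_of_isPreconnected_cover hD hHc.isPreconnected (Set.inter_subset_left.trans hcov)
        (φ := fun i => g1 i - g2 i) ?_ hj hi
      rintro k l x ⟨hx, hxa⟩ hk hl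
      have e1 := hg1 k l x ⟨hx, le_of_eq hxa⟩ hk hl
      have e2 := hg2 k l x ⟨hx, ge_of_eq hxa⟩ hk hl
      rw [← e2] at e1
      exact sub_eq_sub_iff_sub_eq_sub.1 e1
    · push Not at h
      exact ⟨0, fun i hi => absurd hi (by rw [h i]; exact Set.not_nonempty_empty)⟩
  -- `g1` on the sets meeting the first half, and the shifted `g2` on the others
  let g : ι → G := fun i => if ((C ∩ {x | f x ≤ a}) ∩ D i).Nonempty then g1 i else g2 i + d
  have hga : ∀ i x, x ∈ C → f x ≤ a → x ∈ D i → g i = g1 i := fun i x hx hxa hi =>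
    if_pos ⟨x, ⟨hx, hxa⟩, hi⟩
  have hgb : ∀ i x, x ∈ C → a ≤ f x → x ∈ D i → g i = g2 i + d := by
    intro i x hx hxa hi
    by_cases h : ((C ∩ {x | f x ≤ a}) ∩ D i).Nonempty
    · obtain ⟨y, ⟨hy, hya⟩, hyi⟩ := h
      have : (C ∩ {x | f x = a} ∩ D i).Nonempty := by
        obtain ⟨z, hz, hza⟩ := (hC.inter (hconv i)).isPreconnected.intermediate_value
          (f := f) ⟨hy, hyi⟩ ⟨hx, hi⟩ f.continuous.continuousOn ⟨hya, hxa⟩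
        exact ⟨z, ⟨hz.1, hza⟩, hz.2⟩
      rw [hga i y hy hya hyi, ← hd i this]
      abel
    · exact if_neg h
  refine ⟨g, fun i j x hx hi hj => ?_⟩
  rcases le_total (f x) a with h | h
  · rw [hga i x hx h hi, hga j x hx h hj, hg1 i j x ⟨hx, h⟩ hi hj]
  · rw [hgb i x hx h hi, hgb j x hx h hj, add_sub_add_right_eq_sub, hg2 i j x ⟨hx, h⟩ hi hj]

/-- The first cohomology of a finite closed convex cover of a bounded convex set vanishes. -/
theorem exists_sub_eq_of_cocycle {n : ℕ} [Finite ι] {D : ι → Set (Fin n → ℝ)}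
    (hD : ∀ i, IsClosed (D i)) (hconv : ∀ i, Convex ℝ (D i)) {P : Set (Fin n → ℝ)}
    (hP : Convex ℝ P) (hPb : Bornology.IsBounded P) (hcov : ⋃ i, D i = P) {c : ι → ι → G}
    (hc : ∀ i j k x, x ∈ D i → x ∈ D j → x ∈ D k → c i j + c j k = c i k) :
    ∃ g : ι → G, ∀ i j x, x ∈ D i → x ∈ D j → g i - g j = c i j := by
  classical
  suffices h : IsCoboundaryOn D c P by
    obtain ⟨g, hg⟩ := h
    exact ⟨g, fun i j x hi => hg i j x (hcov ▸ Set.mem_iUnion_of_mem i hi) hi⟩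
  obtain ⟨R, hR0, hR⟩ := hPb.subset_closedBall_lt 0 0
  let I : BoxIntegral.Box (Fin n) := ⟨fun _ => -R, fun _ => R, fun _ => by linarith⟩
  suffices h : IsCoboundaryOn D c (P ∩ BoxIntegral.Box.Icc I) by
    refine h.mono fun x hx => ⟨hx, ?_⟩
    have h1 := mem_closedBall_zero_iff.1 (hR hx)
    have h2 := (pi_norm_le_iff_of_nonneg hR0.le).1 h1
    rw [BoxIntegral.Box.Icc_def]
    exact ⟨fun i => (abs_le.1 (h2 i)).1, fun i => (abs_le.1 (h2 i)).2⟩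
  -- it is enough to trivialize the cocycle on small boxes, and to glue the trivializations on the
  -- halves of a box
  refine BoxIntegral.Box.subbox_induction_on' (p := fun J =>
    IsCoboundaryOn D c (P ∩ BoxIntegral.Box.Icc J)) I (fun J _ hJ => ?_) (fun z _ => ?_)
  · -- the trivializations on the `2ⁿ` halves of a box are glued one coordinate at a time
    let m : Fin n → ℝ := fun i => (J.lower i + J.upper i) / 2
    let S : Finset (Fin n) → Set (Fin n) → Set (Fin n → ℝ) := fun T s =>
      {x | ∀ i ∈ T, (i ∈ s → m i ≤ x i) ∧ (i ∉ s → x i ≤ m i)}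
    have hS : ∀ T s, Convex ℝ (S T s) := by
      intro T s x hx y hy u v hu hv huv i hi
      simp only [Pi.add_apply, Pi.smul_apply, smul_eq_mul]
      constructor
      · intro his
        have h1 := (hx i hi).1 his
        have h2 := (hy i hi).1 his
        calc m i = u * m i + v * m i := by rw [← add_mul, huv, one_mul]
          _ ≤ _ := by gcongr
      · intro his
        have h1 := (hx i hi).2 his
        have h2 := (hy i hi).2 his
        calc _ ≤ u * m i + v * m i := by gcongr
          _ = m i := by rw [← add_mul, huv, one_mul]
    have hK : Convex ℝ (P ∩ BoxIntegral.Box.Icc J) := hP.inter (convex_Icc _ _)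
    have key : ∀ (T : Finset (Fin n)) (s : Set (Fin n)),
        IsCoboundaryOn D c ((P ∩ BoxIntegral.Box.Icc J) ∩ S Tᶜ s) := by
      intro T
      induction T using Finset.induction_on with
      | empty =>
        intro s
        refine (hJ s).mono fun x hx => ⟨hx.1.1, ?_⟩
        have h1 := hx.1.2
        rw [BoxIntegral.Box.Icc_def] at h1 ⊢
        constructor
        · intro i
          simp only [BoxIntegral.Box.splitCenterBox, Set.piecewise]
          split_ifs with h
          · exact (hx.2 i (by simp)).1 h
          · exact h1.1 i
        · intro i
          simp only [BoxIntegral.Box.splitCenterBox, Set.piecewise]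
          split_ifs with h
          · exact h1.2 i
          · exact (hx.2 i (by simp)).2 h
      | insert a T ha ih =>
        intro s
        refine IsCoboundaryOn.glue hD hconv (hK.inter (hS _ _))
          (fun x hx => by rw [hcov]; exact hx.1.1) (ContinuousLinearMap.proj a) (m a) ?_ ?_
        · refine (ih (s \ {a})).mono fun x hx => ⟨hx.1.1, fun i hi => ?_⟩
          by_cases hia : i = a
          · subst hia
            exact ⟨fun h => absurd rfl h.2, fun _ => hx.2⟩
          · have := hx.1.2 i (by simpa [hia] using hi)
            exact ⟨fun h => this.1 h.1, fun h => this.2 fun h' => h ⟨h', hia⟩⟩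
        · refine (ih (insert a s)).mono fun x hx => ⟨hx.1.1, fun i hi => ?_⟩
          by_cases hia : i = a
          · subst hia
            exact ⟨fun _ => hx.2, fun h => absurd (Set.mem_insert _ _) h⟩
          · have := hx.1.2 i (by simpa [hia] using hi)
            exact ⟨fun h => this.1 (h.resolve_left hia), fun h => this.2 fun h' => h (Or.inr h')⟩
    refine (key Finset.univ ∅).mono fun x hx => ⟨hx, fun i hi => by simp at hi⟩
  · -- a small box only meets sets through a given point
    have hU : ∀ i, ∃ U ∈ nhds z, z ∉ D i → Disjoint U (D i) := by
      intro i
      by_cases hz : z ∈ D i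
      · exact ⟨Set.univ, Filter.univ_mem, fun h => absurd hz h⟩
      · exact ⟨(D i)ᶜ, (hD i).isOpen_compl.mem_nhds hz, fun _ => disjoint_compl_left⟩
    choose U hUz hU using hU
    refine ⟨⋂ i, U i, mem_nhdsWithin_of_mem_nhds ((Filter.iInter_mem).2 hUz), fun J _ _ _ hJU _ => ?_⟩
    have hmem : ∀ i, ∀ x ∈ BoxIntegral.Box.Icc J, x ∈ D i → z ∈ D i := by
      intro i x hx hxi
      by_contra h
      exact Set.disjoint_left.1 (hU i h) (Set.mem_iInter.1 (hJU hx) i) hxi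
    by_cases hz : ∃ i, z ∈ D i
    · obtain ⟨k, hk⟩ := hz
      refine ⟨fun i => c i k, fun i j x hx hi hj => ?_⟩
      change c i k - c j k = c i j
      rw [← hc i j k z (hmem i x hx.2 hi) (hmem j x hx.2 hj) hk, add_sub_cancel_right]
    · exact ⟨0, fun i j x hx hi => absurd ⟨i, hmem i x hx.2 hi⟩ hz⟩

end Cech

/-! ### From local to global convexity of a piecewise linear function -/

section LocalConvexity

open Filter Topology

variable {E ι : Type*} [Finite ι]

theorem eventually_forall_mem_imp_mem [TopologicalSpace E] {D : ι → Set E}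
    (hD : ∀ i, IsClosed (D i)) (x : E) : ∀ᶠ z in 𝓝 x, ∀ k, z ∈ D k → x ∈ D k := by
  refine eventually_all.2 fun k => ?_
  by_cases hx : x ∈ D k
  · exact Eventually.of_forall fun _ _ => hx
  · filter_upwards [(hD k).isOpen_compl.mem_nhds hx] with z hz h
    exact absurd h hz

variable [NormedAddCommGroup E] [NormedSpace ℝ E]

/-- Let a convex set be covered by finitely many closed sets `D i`, and let `L i` be affine
functions such that `L j ≤ L i` on `D i` if `D i` meets `D j`. Then `L j ≤ L i` on `D i` for
all `i` and `j`: on a segment from `D j` to `D i`, the slope of the function that is `L k` on `D k`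
does not decrease. -/
theorem le_of_forall_adjacent_le {D : ι → Set E} (hD : ∀ i, IsClosed (D i))
    (hcov : Convex ℝ (⋃ i, D i)) (L : ι → E →ᵃ[ℝ] ℝ)
    (hL : ∀ i j, (D i ∩ D j).Nonempty → ∀ y ∈ D i, L j y ≤ L i y)
    {i j : ι} (hj : (D j).Nonempty) {y : E} (hy : y ∈ D i) : L j y ≤ L i y := by
  obtain ⟨x, hx⟩ := hj
  let γ : ℝ →ᵃ[ℝ] E := AffineMap.lineMap x y
  have hγ : Continuous γ := AffineMap.lineMap_continuous
  have hLγ : ∀ k t, L k (γ t) = L k x + t * (L k y - L k x) := by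
    intro k t
    rw [AffineMap.apply_lineMap, AffineMap.lineMap_apply_module']
    simp only [smul_eq_mul]; ring
  have hmem : ∀ t ∈ Set.Icc (0 : ℝ) 1, ∃ k, γ t ∈ D k := fun t ht => Set.mem_iUnion.1
    (hcov.segment_subset (Set.mem_iUnion_of_mem j hx) (Set.mem_iUnion_of_mem i hy)
      (by rw [segment_eq_image_lineMap]; exact ⟨t, ht, rfl⟩))
  -- the times at which, in a set `D k` reached, slope and value of `L k` are at least those of `L
  -- j`
  let s : Set ℝ := ⋃ k, {t | γ t ∈ D k ∧ L j y - L j x ≤ L k y - L k x ∧ L j (γ t) ≤ L k (γ t)}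
  have hs : IsClosed s := by
    refine isClosed_iUnion_of_finite fun k => ?_
    have h1 : IsClosed {t | L j (γ t) ≤ L k (γ t)} := by
      simp only [hLγ]
      exact isClosed_le (by fun_prop) (by fun_prop)
    exact ((hD k).preimage hγ).inter (isClosed_const.inter h1)
  have hsub : Set.Icc (0 : ℝ) 1 ⊆ s := by
    refine (hs.inter isClosed_Icc).Icc_subset_of_forall_exists_gt ?_ ?_
    · exact Set.mem_iUnion.2 ⟨j, by simpa [γ] using hx, le_rfl, le_rfl⟩
    · rintro t ⟨hts, ht0, ht1⟩ t' ht'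
      obtain ⟨k, hk, hk1, hk2⟩ := Set.mem_iUnion.1 hts
      have hev := (hγ.tendsto t).eventually (eventually_forall_mem_imp_mem hD (γ t))
      have hev' : ∀ᶠ r in 𝓝[>] t, r ∈ Set.Ioc t (min t' 1) :=
        Ioc_mem_nhdsGT (lt_min ht' ht1)
      obtain ⟨r, hr, hrt⟩ := ((hev.filter_mono nhdsWithin_le_nhds).and hev').exists
      obtain ⟨l, hl⟩ := hmem r ⟨ht0.trans hrt.1.le, hrt.2.trans (min_le_right _ _)⟩
      have hlt : γ t ∈ D l := hr l hl
      have e1 := hL k l ⟨_, hk, hlt⟩ _ hk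
      have e2 := hL l k ⟨_, hlt, hk⟩ _ hlt
      have e3 := hL l k ⟨_, hlt, hk⟩ _ hl
      refine ⟨r, Set.mem_iUnion.2 ⟨l, hl, ?_, ?_⟩, hrt.1, hrt.2.trans (min_le_left _ _)⟩
      · rw [hLγ, hLγ] at e1 e2 e3
        nlinarith [hrt.1]
      · refine le_trans ?_ e3
        rw [hLγ, hLγ] at hk2 ⊢
        nlinarith [hrt.1]
  obtain ⟨k, hk, -, hk2⟩ := Set.mem_iUnion.1 (hsub (Set.right_mem_Icc.2 zero_le_one))
  have h1 : γ 1 = y := AffineMap.lineMap_apply_one _ _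
  rw [h1] at hk hk2
  exact hk2.trans (hL i k ⟨y, hy, hk⟩ y hy)

/-- If equality `L j = L i` on `D i` forces membership in `D j` for adjacent sets, then it does so
for all sets: beyond the last point of a segment in `D j` the slope strictly increases. -/
theorem mem_of_eq_of_forall_adjacent {D : ι → Set E} (hD : ∀ i, IsClosed (D i))
    (hcov : Convex ℝ (⋃ i, D i)) (L : ι → E →ᵃ[ℝ] ℝ)
    (hL : ∀ i j, (D i ∩ D j).Nonempty → ∀ y ∈ D i, L j y ≤ L i y)
    (hL' : ∀ i j, (D i ∩ D j).Nonempty → ∀ y ∈ D i, L j y = L i y → y ∈ D j)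
    {i j : ι} (hj : (D j).Nonempty) {y : E} (hy : y ∈ D i) (h : L j y = L i y) : y ∈ D j := by
  by_contra hyj
  obtain ⟨x, hx⟩ := hj
  let γ : ℝ →ᵃ[ℝ] E := AffineMap.lineMap x y
  have hγ : Continuous γ := AffineMap.lineMap_continuous
  have hLγ : ∀ k t, L k (γ t) = L k x + t * (L k y - L k x) := by
    intro k t
    rw [AffineMap.apply_lineMap, AffineMap.lineMap_apply_module']
    simp only [smul_eq_mul]; ring
  have hmem : ∀ t ∈ Set.Icc (0 : ℝ) 1, ∃ k, γ t ∈ D k := fun t ht => Set.mem_iUnion.1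
    (hcov.segment_subset (Set.mem_iUnion_of_mem j hx) (Set.mem_iUnion_of_mem i hy)
      (by rw [segment_eq_image_lineMap]; exact ⟨t, ht, rfl⟩))
  -- the last point of the segment in `D j`
  obtain ⟨t, ⟨ht, htj⟩, hmax⟩ := (isCompact_Icc.inter_right ((hD j).preimage hγ)).exists_isGreatest
    (s := Set.Icc (0 : ℝ) 1 ∩ γ ⁻¹' D j) ⟨0, Set.left_mem_Icc.2 zero_le_one, by simpa [γ] using hx⟩
  have h1 : γ 1 = y := AffineMap.lineMap_apply_one _ _
  have ht1 : t < 1 := lt_of_le_of_ne ht.2 fun hh => hyj (by rw [← h1, ← hh]; exact htj)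
  have hev := (hγ.tendsto t).eventually (eventually_forall_mem_imp_mem hD (γ t))
  obtain ⟨r, hr, hrt⟩ := ((hev.filter_mono nhdsWithin_le_nhds).and (Ioc_mem_nhdsGT ht1)).exists
  have hr01 : r ∈ Set.Icc (0 : ℝ) 1 := ⟨ht.1.trans hrt.1.le, hrt.2⟩
  obtain ⟨l, hl⟩ := hmem r hr01
  have hlt : γ t ∈ D l := hr l hl
  have hrj : γ r ∉ D j := fun hh => (hmax ⟨hr01, hh⟩).not_gt hrt.1
  have e1 := hL j l ⟨_, htj, hlt⟩ _ htj
  have e2 := hL l j ⟨_, hlt, htj⟩ _ hl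
  have e3 : L j (γ r) ≠ L l (γ r) := fun hh => hrj (hL' l j ⟨_, hlt, htj⟩ _ hl hh)
  have e4 := lt_of_le_of_ne e2 e3
  -- just after leaving `D j` the function has a bigger slope, which contradicts the equality at `y`
  have e5 := le_of_forall_adjacent_le hD hcov L hL ⟨_, hlt⟩ hy
  rw [hLγ, hLγ] at e1 e4
  rw [← h] at e5
  nlinarith [hrt.1, mul_nonneg (sub_nonneg.2 hr01.2) (sub_nonneg.2 hrt.1.le)]

end LocalConvexity

/-! ### The convex piecewise linear function of the partition -/

section Potential

variable {n : ℕ}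

/-- The data defining the degeneration: integral affine functions `form j` on the polytopes of a
polyhedral partition of `P`, whose maximum is equal to `form j` exactly on the `j`-th polytope. -/
structure SimplicialPartition.Potential {P : LatticePolytope n} {ι : Type*}
    (Γ : SimplicialPartition P ι) where
  form : ι → (Fin n → ℤ) × ℤ
  le : ∀ i j, ∀ y ∈ (Γ.piece i).carrier, affineValue (form j) y ≤ affineValue (form i) y
  mem_of_eq : ∀ i j, ∀ y ∈ (Γ.piece i).carrier,
    affineValue (form j) y = affineValue (form i) y → y ∈ (Γ.piece j).carrier

/-- The affine function with linear part `f.1` and constant term `f.2`. -/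
def affineMapOfForm (f : (Fin n → ℤ) × ℤ) : (Fin n → ℝ) →ᵃ[ℝ] ℝ :=
  (realForm f.1).toAffineMap + AffineMap.const ℝ (Fin n → ℝ) (f.2 : ℝ)

/-- The cocycle of the wall equations is a coboundary, and the resulting affine functions, being
convex across each wall, are globally convex. -/
theorem SimplicialPartition.IsSemistable.exists_potential {P : LatticePolytope n}
    (hP : P.IsSimplicial) {ι : Type*} [Finite ι] {Γ : SimplicialPartition P ι}
    (hss : Γ.IsSemistable) (hbal : Γ.IsBalanced) (htriple : Γ.TriplesMeetAtNonsingularVertex) :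
    Nonempty Γ.Potential := by
  obtain ⟨f, hf, hc⟩ := hss.exists_wallForm_cocycle hP hbal htriple
  have hcl : ∀ i, IsClosed (Γ.piece i).carrier := fun i => (Γ.piece i).isCompact_carrier.isClosed
  obtain ⟨g, hg⟩ := exists_sub_eq_of_cocycle hcl (fun i => (Γ.piece i).carrier_convex)
    P.carrier_convex P.isCompact_carrier.isBounded Γ.union_eq hc
  have hcov : Convex ℝ (⋃ i, (Γ.piece i).carrier) := by
    rw [Γ.union_eq]; exact P.carrier_convex
  have hval : ∀ i j x, x ∈ (Γ.piece i).carrier → x ∈ (Γ.piece j).carrier → ∀ y,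
      affineValue (f i j) y = affineMapOfForm (g i) y - affineMapOfForm (g j) y := by
    intro i j x hi hj y
    rw [← hg i j x hi hj, affineValue_sub]
    rfl
  have hL : ∀ i j, ((Γ.piece i).carrier ∩ (Γ.piece j).carrier).Nonempty →
      ∀ y ∈ (Γ.piece i).carrier, affineMapOfForm (g j) y ≤ affineMapOfForm (g i) y := by
    rintro i j ⟨x, hi, hj⟩ y hy
    by_cases hij : i = j
    · rw [hij]
    · rw [← sub_nonneg, ← hval i j x hi hj]
      exact (hf i j x hij hi hj).nonneg y hy
  have hL' : ∀ i j, ((Γ.piece i).carrier ∩ (Γ.piece j).carrier).Nonempty →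
      ∀ y ∈ (Γ.piece i).carrier, affineMapOfForm (g j) y = affineMapOfForm (g i) y →
        y ∈ (Γ.piece j).carrier := by
    rintro i j ⟨x, hi, hj⟩ y hy h
    by_cases hij : i = j
    · rw [← hij]; exact hy
    · refine (hf i j x hij hi hj).mem_of_eq_zero y hy ?_
      rw [hval i j x hi hj, h, sub_self]
  exact ⟨⟨g, fun i j y hy => le_of_forall_adjacent_le hcl hcov _ hL
    (Γ.piece j).carrier_nonempty hy, fun i j y hy h => mem_of_eq_of_forall_adjacent hcl hcov _ hL hL'
      (Γ.piece j).carrier_nonempty hy h⟩⟩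

end Potential

/-! ### The projective spectrum of a graded monoid algebra and its affine charts -/

noncomputable section MonoidProj

open AddMonoidAlgebra hiding coeff
open HomogeneousLocalization

variable {H : Type} [AddCommGroup H]

/-- The degree `(h, k) ↦ k` on a monoid of pairs. -/
def degreeHom (N : AddSubmonoid (H × ℕ)) : N →+ ℕ := (AddMonoidHom.snd H ℕ).comp N.subtype

/-- The grading of the monoid algebra `ℂ[N]` by the degree `(h, k) ↦ k`. -/
abbrev monoidGrading (N : AddSubmonoid (H × ℕ)) : ℕ → Submodule ℂ (AddMonoidAlgebra ℂ N) :=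
  AddMonoidAlgebra.gradeBy ℂ (degreeHom N)

variable {N : AddSubmonoid (H × ℕ)}

theorem single_mem_monoidGrading (x : N) (c : ℂ) :
    (single x c : AddMonoidAlgebra ℂ N) ∈ monoidGrading N x.1.2 :=
  single_mem_gradeBy (degreeHom N) x c

/-- The map `(h, k) ↦ h - k w`, which dehomogenizes the exponents with respect to `(w, 1)`. -/
def chartHom (w : H) : H × ℕ →+ H where
  toFun x := x.1 - x.2 • w
  map_zero' := by simp
  map_add' x y := by
    simp only [Prod.fst_add, Prod.snd_add, add_smul]
    abel

/-- The monoid of the affine chart of `Proj ℂ[N]` in which the character `(w, 1)` does not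
vanish. -/
abbrev chartMonoid (N : AddSubmonoid (H × ℕ)) (w : H) : AddSubmonoid H := N.map (chartHom w)

/-- The dehomogenization of the exponents. -/
def toChart (N : AddSubmonoid (H × ℕ)) (w : H) : N →+ chartMonoid N w :=
  (chartHom w).addSubmonoidMap N

@[simp]
theorem toChart_coe (w : H) (x : N) : (toChart N w x : H) = x.1.1 - x.1.2 • w := rfl

theorem toChart_surjective (w : H) : Function.Surjective (toChart N w) :=
  (chartHom w).addSubmonoidMap_surjective N

theorem toChart_eq_zero {w : H} (hw : (w, 1) ∈ N) : toChart N w ⟨(w, 1), hw⟩ = 0 := by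
  ext; simp

/-- The dehomogenization homomorphism `ℂ[N] → ℂ[N_w]`. -/
def dehomogenize (N : AddSubmonoid (H × ℕ)) (w : H) :
    AddMonoidAlgebra ℂ N →+* AddMonoidAlgebra ℂ (chartMonoid N w) :=
  mapDomainRingHom ℂ (toChart N w)

@[simp]
theorem dehomogenize_single (w : H) (x : N) (c : ℂ) :
    dehomogenize N w (single x c) = single (toChart N w x) c := by
  rw [dehomogenize, mapDomainRingHom_apply, mapDomain_single]

/-- Dehomogenization is injective on homogeneous elements of a given degree. -/
theorem eq_zero_of_dehomogenize_eq_zero {w : H} {d : ℕ} {a : AddMonoidAlgebra ℂ N}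
    (ha : a ∈ monoidGrading N d) (h : dehomogenize N w a = 0) : a = 0 := by
  have hinj : Set.InjOn (toChart N w) (degreeHom N ⁻¹' {d}) := by
    intro x hx y hy hxy
    have h1 : x.1.2 = d := hx
    have h2 : y.1.2 = d := hy
    have h3 := congrArg Subtype.val hxy
    rw [toChart_coe, toChart_coe, h1, h2, sub_left_inj] at h3
    exact Subtype.ext (Prod.ext h3 (h1.trans h2.symm))
  have h1 : Finsupp.mapDomain (toChart N w) a.coeff = 0 := by
    rw [← coeff_mapDomain, ← mapDomainRingHom_apply]
    exact congrArg AddMonoidAlgebra.coeff h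
  have h2 := Finsupp.mapDomain_injOn (M := ℂ) _ hinj ha
    (by simp : ((0 : N →₀ ℂ).support : Set N) ⊆ _) (h1.trans Finsupp.mapDomain_zero.symm)
  exact AddMonoidAlgebra.coeff_injective h2

/-- The character `(w, 1)` as an element of `ℂ[N]`. -/
abbrev degreeOneChar {w : H} (hw : (w, 1) ∈ N) : AddMonoidAlgebra ℂ N := single ⟨(w, 1), hw⟩ 1

theorem degreeOneChar_mem {w : H} (hw : (w, 1) ∈ N) :
    degreeOneChar hw ∈ monoidGrading N 1 :=
  single_mem_monoidGrading ⟨(w, 1), hw⟩ 1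

theorem dehomogenize_degreeOneChar {w : H} (hw : (w, 1) ∈ N) :
    dehomogenize N w (degreeOneChar hw) = 1 := by
  rw [dehomogenize_single, toChart_eq_zero]; rfl

/-- The homomorphism from the ring of the chart to the monoid algebra `ℂ[N_w]`. -/
def awayToChart {w : H} (hw : (w, 1) ∈ N) :
    Away (monoidGrading N) (degreeOneChar hw) →+* AddMonoidAlgebra ℂ (chartMonoid N w) :=
  (IsLocalization.Away.lift (S := Localization.Away (degreeOneChar hw)) (degreeOneChar hw)
    (g := dehomogenize N w) (by rw [dehomogenize_degreeOneChar]; exact isUnit_one)).comp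
    (algebraMap _ _)

theorem awayToChart_mk {w : H} (hw : (w, 1) ∈ N) (k : ℕ) (a : AddMonoidAlgebra ℂ N)
    (ha : a ∈ monoidGrading N (k • 1)) :
    awayToChart hw (Away.mk _ (degreeOneChar_mem hw) k a ha) = dehomogenize N w a := by
  rw [awayToChart, RingHom.comp_apply, HomogeneousLocalization.algebraMap_apply, Away.val_mk,
    IsLocalization.Away.lift, Localization.mk_eq_mk', IsLocalization.lift_mk'_spec, map_pow,
    dehomogenize_degreeOneChar, one_pow, one_mul]

theorem awayToChart_fromZeroRingHom {w : H} (hw : (w, 1) ∈ N) (a : monoidGrading N 0) :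
    awayToChart hw (fromZeroRingHom (monoidGrading N) _ a) = dehomogenize N w a := by
  rw [← awayToChart_mk hw 0 a.1 (by simp)]
  rfl

theorem awayToChart_bijective {w : H} (hw : (w, 1) ∈ N) :
    Function.Bijective (awayToChart hw) := by
  constructor
  · rw [injective_iff_map_eq_zero]
    intro x hx
    obtain ⟨k, a, ha, rfl⟩ := Away.mk_surjective _ (degreeOneChar_mem hw) x
    rw [awayToChart_mk] at hx
    ext
    rw [Away.val_mk, eq_zero_of_dehomogenize_eq_zero ha hx, Localization.mk_zero,
      HomogeneousLocalization.val_zero]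
  · intro x
    induction x using AddMonoidAlgebra.induction_linear with
    | zero => exact ⟨0, map_zero _⟩
    | add x y hx hy =>
      obtain ⟨a, rfl⟩ := hx
      obtain ⟨b, rfl⟩ := hy
      exact ⟨a + b, map_add _ _ _⟩
    | single m c =>
      obtain ⟨y, rfl⟩ := toChart_surjective w m
      refine ⟨Away.mk _ (degreeOneChar_mem hw) y.1.2 (single y c) ?_, ?_⟩
      · rw [smul_eq_mul, mul_one]
        exact single_mem_monoidGrading y c
      · rw [awayToChart_mk, dehomogenize_single]

/-- The degree zero part of the localization of `ℂ[N]` at the character `(w, 1)` is the monoid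
algebra of the chart monoid. -/
def chartEquiv {w : H} (hw : (w, 1) ∈ N) :
    Away (monoidGrading N) (degreeOneChar hw) ≃+* AddMonoidAlgebra ℂ (chartMonoid N w) :=
  RingEquiv.ofBijective (awayToChart hw) (awayToChart_bijective hw)

/-- The affine chart `Spec ℂ[N_w] → Proj ℂ[N]`. -/
def chartι {w : H} (hw : (w, 1) ∈ N) :
    Spec (CommRingCat.of (AddMonoidAlgebra ℂ (chartMonoid N w))) ⟶ Proj (monoidGrading N) :=
  Spec.map (CommRingCat.ofHom (awayToChart hw)) ≫
    Proj.awayι (monoidGrading N) _ (degreeOneChar_mem hw) one_pos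

instance isIso_SpecMap_awayToChart {w : H} (hw : (w, 1) ∈ N) :
    IsIso (Spec.map (CommRingCat.ofHom (awayToChart hw))) := by
  have : IsIso (CommRingCat.ofHom (awayToChart hw)) :=
    (chartEquiv hw).toCommRingCatIso.isIso_hom
  infer_instance

instance isOpenImmersion_chartι {w : H} (hw : (w, 1) ∈ N) : IsOpenImmersion (chartι hw) := by
  unfold chartι; infer_instance

theorem opensRange_chartι {w : H} (hw : (w, 1) ∈ N) :
    (chartι hw).opensRange = Proj.basicOpen (monoidGrading N) (degreeOneChar hw) := by
  exact (Scheme.Hom.opensRange_comp_of_isIso _ _).trans (Proj.opensRange_awayι _ _ _ _)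

/-- The morphism from `Proj ℂ[N]` to the spectrum of a ring over which the degree zero part of
`ℂ[N]` is an algebra. -/
def structureMap (N : AddSubmonoid (H × ℕ)) {R : Type} [CommRing R] (ρ : R →+* monoidGrading N 0) :
    Proj (monoidGrading N) ⟶ Spec (CommRingCat.of R) :=
  Proj.toSpecZero (monoidGrading N) ≫ Spec.map (CommRingCat.ofHom ρ)

/-- The homomorphism on coordinate rings giving the restriction of `structureMap` to a chart. -/
def chartStructure {R : Type} [CommRing R] (ρ : R →+* monoidGrading N 0) (w : H) :
    R →+* AddMonoidAlgebra ℂ (chartMonoid N w) :=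
  ((dehomogenize N w).comp (algebraMap (monoidGrading N 0) (AddMonoidAlgebra ℂ N))).comp ρ

theorem chartStructure_apply {R : Type} [CommRing R] (ρ : R →+* monoidGrading N 0) (w : H) (r : R) :
    chartStructure ρ w r = dehomogenize N w (ρ r) := rfl

theorem chartι_structureMap {R : Type} [CommRing R] (ρ : R →+* monoidGrading N 0) {w : H}
    (hw : (w, 1) ∈ N) : chartι hw ≫ structureMap N ρ =
      Spec.map (CommRingCat.ofHom (chartStructure ρ w)) := by
  rw [chartι, structureMap, Category.assoc, Proj.awayι_toSpecZero_assoc, ← Spec.map_comp,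
    ← Spec.map_comp, ← CommRingCat.ofHom_comp, ← CommRingCat.ofHom_comp]
  congr 2
  exact RingHom.ext fun r => awayToChart_fromZeroRingHom hw (ρ r)

theorem chartι_preimage_basicOpen_of_pos {w : H} (hw : (w, 1) ∈ N) (x : N) (hx : 0 < x.1.2) :
    chartι hw ⁻¹ᵁ Proj.basicOpen (monoidGrading N) (single x 1) =
      PrimeSpectrum.basicOpen (single (toChart N w x) 1) := by
  rw [chartι, Scheme.Hom.comp_preimage, Proj.awayι_preimage_basicOpen _ _ _
    (single_mem_monoidGrading x 1) hx]
  change PrimeSpectrum.basicOpen (awayToChart hw _) = _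
  rw [awayToChart_mk, pow_one, dehomogenize_single]

theorem chartι_preimage_basicOpen {w : H} (hw : (w, 1) ∈ N) (x : N) :
    chartι hw ⁻¹ᵁ Proj.basicOpen (monoidGrading N) (single x 1) =
      PrimeSpectrum.basicOpen (single (toChart N w x) 1) := by
  have h1 := chartι_preimage_basicOpen_of_pos hw (x + ⟨(w, 1), hw⟩) (by simp)
  have h2 : (single (x + ⟨(w, 1), hw⟩) 1 : AddMonoidAlgebra ℂ N)
      = single x 1 * degreeOneChar hw := by rw [single_mul_single, one_mul]
  rw [map_add, toChart_eq_zero, add_zero, h2, Proj.basicOpen_mul, ← opensRange_chartι] at h1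
  rw [← h1]
  ext y
  simp

theorem mem_of_forall_single_mem {S : Type*} [AddCommMonoid S] {I : Ideal (AddMonoidAlgebra ℂ S)}
    {a : AddMonoidAlgebra ℂ S} (h : ∀ x ∈ a.coeff.support, single x 1 ∈ I) : a ∈ I := by
  rw [← a.sum_coeff_single]
  refine Ideal.sum_mem _ fun x hx => ?_
  have : (single x (a.coeff x) : AddMonoidAlgebra ℂ S) = single 0 (a.coeff x) * single x 1 := by
    rw [single_mul_single, zero_add, mul_one]
  rw [this]
  exact Ideal.mul_mem_left _ _ (h x hx)

/-- Every character of positive degree has a power divisible by a character of degree one. This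
condition guarantees that the charts cover `Proj ℂ[N]`. -/
def IsCoveredInDegreeOne (N : AddSubmonoid (H × ℕ)) : Prop :=
  ∀ x ∈ N, 0 < x.2 → ∃ w, (w, 1) ∈ N ∧ ∃ e : ℕ, ∃ y ∈ N, e • x = y + (w, 1)

theorem IsCoveredInDegreeOne.exists_mem_basicOpen (hN : IsCoveredInDegreeOne N)
    (y : Proj (monoidGrading N)) : ∃ w, ∃ hw : (w, 1) ∈ N,
      y ∈ Proj.basicOpen (monoidGrading N) (degreeOneChar hw) := by
  by_contra hcon
  push Not at hcon
  refine y.not_irrelevant_le ((HomogeneousIdeal.irrelevant_le _).2 fun d hd a ha => ?_)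
  refine mem_of_forall_single_mem fun x hx => ?_
  have hxd : x.1.2 = d := ha x hx
  obtain ⟨w, hw, e, z, hz, hez⟩ := hN x x.2 (hxd ▸ hd)
  have h1 : degreeOneChar hw ∈ y.asHomogeneousIdeal.toIdeal := not_not.1 (hcon w hw)
  refine y.isPrime.mem_of_pow_mem e ?_
  have h2 : e • x = ⟨z, hz⟩ + ⟨(w, 1), hw⟩ := Subtype.ext hez
  rw [single_pow, one_pow, h2, ← one_mul (1 : ℂ), ← single_mul_single]
  exact Ideal.mul_mem_left _ _ h1

/-- The cover of `Proj ℂ[N]` by the charts belonging to the characters of degree one. -/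
@[simps I₀ X f]
def chartCover (hN : IsCoveredInDegreeOne N) : (Proj (monoidGrading N)).AffineOpenCover where
  I₀ := {w // (w, 1) ∈ N}
  X w := CommRingCat.of (AddMonoidAlgebra ℂ (chartMonoid N w.1))
  f w := chartι w.2
  idx y := ⟨_, (hN.exists_mem_basicOpen y).choose_spec.choose⟩
  covers y := by
    have h := (hN.exists_mem_basicOpen y).choose_spec.choose_spec
    rw [← opensRange_chartι] at h
    exact h

theorem isDomain_of_injective {S T : Type*} [AddMonoid S] [AddMonoid T] [IsDomain (AddMonoidAlgebra ℂ T)]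
    (f : S →+ T) (hf : Function.Injective f) : IsDomain (AddMonoidAlgebra ℂ S) :=
  (mapDomain_injective (R := ℂ) hf).isDomain (mapDomainRingHom ℂ f)

instance isDomain_submonoid {T : Type*} [AddMonoid T] [IsDomain (AddMonoidAlgebra ℂ T)]
    (S : AddSubmonoid T) : IsDomain (AddMonoidAlgebra ℂ S) :=
  isDomain_of_injective S.subtype Subtype.val_injective

/-- The generic point of `Proj ℂ[N]`. -/
def genericPt [IsDomain (AddMonoidAlgebra ℂ N)] {w : H} (hw : (w, 1) ∈ N) :
    ProjectiveSpectrum (monoidGrading N) where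
  asHomogeneousIdeal := ⊥
  isPrime := Ideal.isPrime_bot
  not_irrelevant_le h := by
    have h1 := (HomogeneousIdeal.irrelevant_le _).1 h 1 one_pos (degreeOneChar_mem hw)
    have h2 : degreeOneChar hw = 0 := h1
    simp at h2

theorem genericPt_le [IsDomain (AddMonoidAlgebra ℂ N)] {w : H} (hw : (w, 1) ∈ N)
    (y : ProjectiveSpectrum (monoidGrading N)) : genericPt hw ≤ y :=
  (bot_le : ⊥ ≤ y.asHomogeneousIdeal)

theorem closure_genericPt [IsDomain (AddMonoidAlgebra ℂ N)] {w : H} (hw : (w, 1) ∈ N) :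
    closure {genericPt hw} = (Set.univ : Set (ProjectiveSpectrum (monoidGrading N))) :=
  Set.eq_univ_of_forall fun y =>
    (ProjectiveSpectrum.le_iff_mem_closure _ _ _).1 (genericPt_le hw y)

theorem isIntegral_proj [IsDomain (AddMonoidAlgebra ℂ H)] [IsDomain (AddMonoidAlgebra ℂ N)]
    (hN : IsCoveredInDegreeOne N) {w : H} (hw : (w, 1) ∈ N) :
    IsIntegral (Proj (monoidGrading N)) := by
  have h1 : IsReduced (Proj (monoidGrading N)) := by
    have : ∀ i, IsReduced ((chartCover hN).openCover.X i) := fun i => by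
      change IsReduced (Spec (CommRingCat.of (AddMonoidAlgebra ℂ (chartMonoid N i.1))))
      infer_instance
    exact IsReduced.of_openCover _ (chartCover hN).openCover
  have h2 : IrreducibleSpace (Proj (monoidGrading N)) := by
    change IrreducibleSpace (ProjectiveSpectrum (monoidGrading N))
    rw [irreducibleSpace_def, Set.top_eq_univ, ← closure_genericPt hw]
    exact isIrreducible_singleton.closure
  exact isIntegral_of_irreducibleSpace_of_isReduced _

end MonoidProj

/-! ### Morphisms between projective spectra of graded monoid algebras -/

noncomputable section MonoidProjMap

open AddMonoidAlgebra hiding coeff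
open HomogeneousLocalization HomogeneousIdeal

section General

variable {A B : Type} [CommRing A] [CommRing B] {σ τ : Type} [SetLike σ A] [AddSubgroupClass σ A]
  [SetLike τ B] [AddSubgroupClass τ B] {𝒜 : ℕ → σ} {ℬ : ℕ → τ} [GradedRing 𝒜] [GradedRing ℬ]
  (f : 𝒜 →+*ᵍ ℬ) (hf : irrelevant ℬ ≤ (irrelevant 𝒜).map f)

theorem isPullback_awayι_map {i : ℕ} (hi : 0 < i) {s : A} (hs : s ∈ 𝒜 i) :
    IsPullback (Spec.map (CommRingCat.ofHom (Away.map f s)))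
      (Proj.awayι ℬ (f s) (f.2 hs) hi) (Proj.awayι 𝒜 s hs hi) (Proj.map f hf) := by
  refine IsOpenImmersion.isPullback _ _ _ _ (Proj.awayι_comp_map f hf hi s hs) ?_
  rw [Proj.opensRange_awayι, Proj.opensRange_awayι, Proj.map_preimage_basicOpen]

theorem isClosedImmersion_projMap (hsurj : Function.Surjective f) :
    IsClosedImmersion (Proj.map f hf) := by
  suffices h : ∀ (d : ℕ) (hd : 0 < d) (s : A) (hs : s ∈ 𝒜 d),
      IsClosedImmersion (pullback.snd (Proj.map f hf) (Proj.awayι 𝒜 s hs hd)) from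
    IsZariskiLocalAtTarget.of_openCover (Proj.affineOpenCover 𝒜).openCover
      fun i => h _ i.1.2 _ i.2.2
  intro d hd s hs
  have h1 := (isPullback_awayι_map f hf hd hs).flip
  have h2 : Function.Surjective (Away.map f s) := by
    intro y
    obtain ⟨k, b, hb, rfl⟩ := Away.mk_surjective ℬ (f.2 hs) y
    obtain ⟨a, rfl⟩ := hsurj b
    refine ⟨Away.mk 𝒜 hs k (DirectSum.decompose 𝒜 a (k • d)) (SetLike.coe_mem _), ?_⟩
    rw [Away.map_mk]
    have : f (DirectSum.decompose 𝒜 a (k • d)) = f a := by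
      rw [map_directSumDecompose 𝒜 ℬ f, DirectSum.decompose_of_mem_same ℬ hb]
    ext
    rw [Away.val_mk, Away.val_mk]
    simp only [this]
    rfl
  have h3 : IsClosedImmersion (Spec.map (CommRingCat.ofHom (Away.map f s))) :=
    IsClosedImmersion.spec_of_surjective _ h2
  rw [← h1.isoPullback_inv_snd]
  infer_instance

theorem awayι_map_of_eq {i : ℕ} (hi : 0 < i) {s : A} (hs : s ∈ 𝒜 i) {s' : B} (hs' : s' ∈ ℬ i)
    (h : f s = s') (g : Away 𝒜 s →+* Away ℬ s')
    (hg : ∀ k a ha, g (Away.mk 𝒜 hs k a ha) = Away.mk ℬ hs' k (f a) (f.2 ha)) :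
    Proj.awayι ℬ s' hs' hi ≫ Proj.map f hf =
      Spec.map (CommRingCat.ofHom g) ≫ Proj.awayι 𝒜 s hs hi := by
  subst h
  rw [Proj.awayι_comp_map f hf hi s hs]
  congr 3
  refine RingHom.ext fun x => ?_
  obtain ⟨k, a, ha, rfl⟩ := Away.mk_surjective 𝒜 hs x
  rw [hg, Away.map_mk]

theorem fromZeroRingHom_eq_mk {i : ℕ} {s : A} (hs : s ∈ 𝒜 i) (a : 𝒜 0) :
    fromZeroRingHom 𝒜 (.powers s) a = Away.mk 𝒜 hs 0 a (by simp) := by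
  ext
  rw [Away.val_mk]
  change Localization.mk _ ⟨1, _⟩ = _
  simp only [pow_zero]

/-- A morphism of projective spectra is compatible with the morphisms to an affine scheme if the
homomorphism of graded rings is compatible with the homomorphisms to the degree zero parts. -/
theorem projMap_toSpecZero {R : Type} [CommRing R] (ρ : R →+* 𝒜 0) (ρ' : R →+* ℬ 0)
    (h : ∀ r, f (ρ r : A) = (ρ' r : B)) :
    Proj.map f hf ≫ Proj.toSpecZero 𝒜 ≫ Spec.map (CommRingCat.ofHom ρ) =
      Proj.toSpecZero ℬ ≫ Spec.map (CommRingCat.ofHom ρ') := by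
  suffices h : ∀ (d : ℕ) (hd : 0 < d) (s : A) (hs : s ∈ 𝒜 d),
      Proj.awayι ℬ (f s) (f.2 hs) hd ≫ Proj.map f hf ≫ Proj.toSpecZero 𝒜 ≫
        Spec.map (CommRingCat.ofHom ρ) =
      Proj.awayι ℬ (f s) (f.2 hs) hd ≫ Proj.toSpecZero ℬ ≫ Spec.map (CommRingCat.ofHom ρ') from
    (Proj.mapAffineOpenCover f hf).openCover.hom_ext _ _ fun i => h _ i.1.2 _ i.2.2
  intro d hd s hs
  rw [Proj.awayι_comp_map_assoc f hf hd _ hs, Proj.awayι_toSpecZero_assoc,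
    Proj.awayι_toSpecZero_assoc, ← Spec.map_comp, ← Spec.map_comp, ← Spec.map_comp,
    ← CommRingCat.ofHom_comp, ← CommRingCat.ofHom_comp, ← CommRingCat.ofHom_comp]
  congr 2
  refine RingHom.ext fun r => HomogeneousLocalization.val_injective _ ?_
  change (Away.map f s (fromZeroRingHom 𝒜 (.powers s) (ρ r))).val =
    (fromZeroRingHom ℬ (.powers (f s)) (ρ' r)).val
  rw [fromZeroRingHom_eq_mk hs, fromZeroRingHom_eq_mk (s := f s) (f.2 hs), Away.map_mk, Away.val_mk,
    Away.val_mk]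
  simp only [h]

end General

variable {H H' : Type} [AddCommGroup H] [AddCommGroup H'] {N : AddSubmonoid (H × ℕ)}
  {N' : AddSubmonoid (H' × ℕ)}

theorem irrelevant_le_map (f : monoidGrading N →+*ᵍ monoidGrading N')
    (h : ∀ x : N', 0 < x.1.2 → ∃ d, 0 < d ∧ ∃ a ∈ monoidGrading N d, ∃ b, single x 1 = f a * b) :
    irrelevant (monoidGrading N') ≤ (irrelevant (monoidGrading N)).map f := by
  refine (HomogeneousIdeal.irrelevant_le _).2 fun d hd a ha => mem_of_forall_single_mem fun x hx => ?_
  have hxd : x.1.2 = d := ha x hx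
  obtain ⟨d', hd', a', ha', b, hb⟩ := h x (hxd ▸ hd)
  rw [hb]
  refine Ideal.mul_mem_right _ _ (Ideal.mem_map_of_mem _ ?_)
  exact (HomogeneousIdeal.irrelevant_le _).1 le_rfl d' hd' ha'

/-- The homomorphism `g` describes the homomorphism `f` of graded rings in the charts at the
characters `w` and `w'` of degree one. -/
structure IsChartMap (f : monoidGrading N →+*ᵍ monoidGrading N') {w : H} (hw : (w, 1) ∈ N) {w' : H'}
    (hw' : (w', 1) ∈ N')
    (g : AddMonoidAlgebra ℂ (chartMonoid N w) →+* AddMonoidAlgebra ℂ (chartMonoid N' w')) : Prop where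
  map_char : f (degreeOneChar hw) = degreeOneChar hw'
  comm : ∀ a, g (dehomogenize N w a) = dehomogenize N' w' (f a)

variable {f : monoidGrading N →+*ᵍ monoidGrading N'}
    (hf : irrelevant (monoidGrading N') ≤ (irrelevant (monoidGrading N)).map f)

theorem IsChartMap.isPullback {w : H} {hw : (w, 1) ∈ N} {w' : H'} {hw' : (w', 1) ∈ N'}
    {g : AddMonoidAlgebra ℂ (chartMonoid N w) →+* AddMonoidAlgebra ℂ (chartMonoid N' w')}
    (hg : IsChartMap f hw hw' g) :
    IsPullback (Spec.map (CommRingCat.ofHom g)) (chartι hw') (chartι hw) (Proj.map f hf) := by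
  refine IsOpenImmersion.isPullback _ _ _ _ ?_ ?_
  · let g' := ((chartEquiv hw').symm.toRingHom.comp g).comp (awayToChart hw)
    have hg' : (awayToChart hw').comp g' = g.comp (awayToChart hw) := RingHom.ext fun x =>
      (chartEquiv hw').apply_symm_apply _
    have h1 := awayι_map_of_eq f hf one_pos (degreeOneChar_mem hw) (degreeOneChar_mem hw')
      hg.map_char g' (fun k a ha => by
        apply (chartEquiv hw').injective
        change (awayToChart hw').comp g' _ = awayToChart hw' _
        rw [hg', awayToChart_mk, RingHom.comp_apply, awayToChart_mk, hg.comm])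
    rw [chartι, chartι, Category.assoc, h1, ← Spec.map_comp_assoc, ← Spec.map_comp_assoc,
      ← CommRingCat.ofHom_comp, ← CommRingCat.ofHom_comp, hg']
  · rw [opensRange_chartι, opensRange_chartι, Proj.map_preimage_basicOpen, hg.map_char]

theorem projMap_structureMap {R : Type} [CommRing R] {ρ : R →+* monoidGrading N 0}
    {ρ' : R →+* monoidGrading N' 0}
    (h : ∀ r, f (ρ r : AddMonoidAlgebra ℂ N) = (ρ' r : AddMonoidAlgebra ℂ N')) :
    Proj.map f hf ≫ structureMap N ρ = structureMap N' ρ' :=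
  projMap_toSpecZero f hf ρ ρ' h

/-- A morphism of projective spectra is a base change if it is one in the charts. -/
theorem isPullback_projMap_of_charts (hN : IsCoveredInDegreeOne N) {R S : Type} [CommRing R]
    [CommRing S] (φ : R →+* S) {ρ : R →+* monoidGrading N 0} {ρ' : S →+* monoidGrading N' 0}
    (h : ∀ w, ∀ hw : (w, 1) ∈ N, ∃ w', ∃ hw' : (w', 1) ∈ N', ∃ g, IsChartMap f hw hw' g ∧
      IsPullback (Spec.map (CommRingCat.ofHom g)) (Spec.map (CommRingCat.ofHom (chartStructure ρ' w')))
        (Spec.map (CommRingCat.ofHom (chartStructure ρ w))) (Spec.map (CommRingCat.ofHom φ))) :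
    IsPullback (Proj.map f hf) (structureMap N' ρ') (structureMap N ρ)
      (Spec.map (CommRingCat.ofHom φ)) := by
  suffices h' : ∀ (w : H) (hw : (w, 1) ∈ N),
      IsPullback (pullback.snd (Proj.map f hf) (chartι hw))
        (pullback.fst (Proj.map f hf) (chartι hw) ≫ structureMap N' ρ')
        (chartι hw ≫ structureMap N ρ) (Spec.map (CommRingCat.ofHom φ)) from
    Scheme.isPullback_of_openCover _ _ _ _ (chartCover hN).openCover fun i => h' i.1 i.2
  intro w hw
  obtain ⟨w', hw', g, hg, hpb⟩ := h w hw
  have h1 := (hg.isPullback hf).flip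
  rw [chartι_structureMap]
  refine IsPullback.of_iso hpb h1.isoPullback (Iso.refl _) (Iso.refl _) (Iso.refl _) ?_ ?_ ?_ ?_
  · rw [Iso.refl_hom, Category.comp_id, h1.isoPullback_hom_snd]
  · rw [Iso.refl_hom, Category.comp_id, h1.isoPullback_hom_fst_assoc, chartι_structureMap]
  · simp
  · simp

end MonoidProjMap

/-! ### Homomorphisms of graded monoid algebras -/

noncomputable section MonoidAlgebraMaps

open AddMonoidAlgebra hiding coeff

variable {H H' : Type} [AddCommGroup H] [AddCommGroup H'] {N : AddSubmonoid (H × ℕ)}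
  {N' : AddSubmonoid (H' × ℕ)}

/-- The homomorphism of graded monoid algebras given by a degree preserving homomorphism of
monoids. -/
def gradedMapOfHom (φ : N →+ N') (hφ : ∀ x, (φ x).1.2 = x.1.2) :
    monoidGrading N →+*ᵍ monoidGrading N' where
  toRingHom := mapDomainRingHom ℂ φ
  map_mem := by
    classical
    intro d a ha y hy
    rw [mapDomainRingHom_apply, coeff_mapDomain] at hy
    obtain ⟨x, hx, rfl⟩ := Finset.mem_image.1 (Finsupp.mapDomain_support hy)
    exact (hφ x).trans (ha x hx)

@[simp]
theorem gradedMapOfHom_single (φ : N →+ N') (hφ : ∀ x, (φ x).1.2 = x.1.2) (x : N) (c : ℂ) :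
    gradedMapOfHom φ hφ (single x c) = single (φ x) c := by
  change mapDomainRingHom ℂ φ (single x c) = _
  rw [mapDomainRingHom_apply, mapDomain_single]

/-- If the submonoid `s(N')` is a face of `N`, i.e. if the summands of its elements lie in it, then
there is a homomorphism `ℂ[N] → ℂ[N']` which maps the characters outside the face to zero. -/
def faceProj (s : N' →+ N) (hs : Function.Injective s)
    (hface : ∀ x y, x + y ∈ Set.range s → x ∈ Set.range s) :
    AddMonoidAlgebra ℂ N →+* AddMonoidAlgebra ℂ N' := by
  classical
  exact (AddMonoidAlgebra.lift ℂ (AddMonoidAlgebra ℂ N') N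
    { toFun := fun x => if h : ∃ y, s y = x.toAdd then single h.choose 1 else 0
      map_one' := by
        have h : ∃ y, s y = (1 : Multiplicative N).toAdd := ⟨0, map_zero s⟩
        rw [dif_pos h, hs (h.choose_spec.trans (map_zero s).symm)]
        rfl
      map_mul' := fun x x' => by
        by_cases h : ∃ y, s y = (x * x').toAdd
        · have h1 : ∃ y, s y = x.toAdd := hface _ _ h
          have h2 : ∃ y, s y = x'.toAdd := hface _ x.toAdd (by
            obtain ⟨y, hy⟩ := h
            exact ⟨y, by rw [hy, toAdd_mul, add_comm]⟩)
          rw [dif_pos h, dif_pos h1, dif_pos h2, single_mul_single, one_mul]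
          congr 1
          apply hs
          rw [h.choose_spec, map_add, h1.choose_spec, h2.choose_spec, toAdd_mul]
        · rw [dif_neg h]
          by_cases h1 : ∃ y, s y = x.toAdd
          · have h2 : ¬ ∃ y, s y = x'.toAdd := by
              rintro ⟨y', hy'⟩
              obtain ⟨y, hy⟩ := h1
              exact h ⟨y + y', by rw [map_add, hy, hy', toAdd_mul]⟩
            rw [dif_neg h2, mul_zero]
          · rw [dif_neg h1, zero_mul] }).toRingHom

section FaceProj

variable (s : N' →+ N) (hs : Function.Injective s)
  (hface : ∀ x y, x + y ∈ Set.range s → x ∈ Set.range s)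

theorem faceProj_single (y : N') (c : ℂ) : faceProj s hs hface (single (s y) c) = single y c := by
  classical
  have h : ∃ y', s y' = (Multiplicative.ofAdd (s y)).toAdd := ⟨y, rfl⟩
  have h1 : h.choose = y := hs h.choose_spec
  refine (lift_single _ _ _).trans ?_
  change c • (dite _ _ _) = _
  rw [dif_pos h, h1, smul_single, smul_eq_mul, mul_one]

theorem faceProj_single_of_notMem {x : N} (hx : x ∉ Set.range s) (c : ℂ) :
    faceProj s hs hface (single x c) = 0 := by
  classical
  refine (lift_single _ _ _).trans ?_
  change c • (dite _ _ _) = _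
  have h : ¬ ∃ y, s y = (Multiplicative.ofAdd x).toAdd := hx
  rw [dif_neg h, smul_zero]

theorem coeff_faceProj (a : AddMonoidAlgebra ℂ N) (y : N') :
    (faceProj s hs hface a).coeff y = a.coeff (s y) := by
  classical
  induction a using AddMonoidAlgebra.induction_linear with
  | zero => simp
  | add a b ha hb => rw [map_add, AddMonoidAlgebra.coeff_add, AddMonoidAlgebra.coeff_add,
      Finsupp.add_apply, Finsupp.add_apply, ha, hb]
  | single x c =>
    by_cases hx : x ∈ Set.range s
    · obtain ⟨y', rfl⟩ := hx
      rw [faceProj_single, coeff_single, coeff_single, Finsupp.single_apply, Finsupp.single_apply]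
      simp only [hs.eq_iff]
    · rw [faceProj_single_of_notMem s hs hface hx, AddMonoidAlgebra.coeff_zero,
        Finsupp.zero_apply, coeff_single,
        Finsupp.single_eq_of_ne]
      rintro h
      exact hx ⟨y, h⟩

theorem faceProj_surjective : Function.Surjective (faceProj s hs hface) := by
  intro b
  induction b using AddMonoidAlgebra.induction_linear with
  | zero => exact ⟨0, map_zero _⟩
  | add x y hx hy =>
    obtain ⟨a, rfl⟩ := hx
    obtain ⟨b, rfl⟩ := hy
    exact ⟨a + b, map_add _ _ _⟩
  | single y c => exact ⟨single (s y) c, faceProj_single s hs hface y c⟩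

theorem notMem_range_of_faceProj_eq_zero {a : AddMonoidAlgebra ℂ N} (ha : faceProj s hs hface a = 0)
    {x : N} (hx : x ∈ a.coeff.support) : x ∉ Set.range s := by
  rintro ⟨y, rfl⟩
  rw [Finsupp.mem_support_iff, ← coeff_faceProj s hs hface, ha] at hx
  exact hx rfl

/-- The projection to the monoid algebra of a face as a homomorphism of graded rings. -/
def gradedFaceProj (hdeg : ∀ y, (s y).1.2 = y.1.2) : monoidGrading N →+*ᵍ monoidGrading N' where
  toRingHom := faceProj s hs hface
  map_mem := by
    intro d a ha y hy
    rw [Finsupp.mem_support_iff, coeff_faceProj s hs hface] at hy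
    exact (hdeg y).symm.trans (ha _ (Finsupp.mem_support_iff.2 hy))

theorem gradedFaceProj_apply (hdeg : ∀ y, (s y).1.2 = y.1.2) (a : AddMonoidAlgebra ℂ N) :
    gradedFaceProj s hs hface hdeg a = faceProj s hs hface a := rfl

theorem irrelevant_le_map_gradedFaceProj (hdeg : ∀ y, (s y).1.2 = y.1.2) :
    HomogeneousIdeal.irrelevant (monoidGrading N') ≤
      (HomogeneousIdeal.irrelevant (monoidGrading N)).map (gradedFaceProj s hs hface hdeg) := by
  refine irrelevant_le_map _ fun y hy => ⟨y.1.2, hy, single (s y) 1, ?_, 1, ?_⟩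
  · rw [← hdeg y]
    exact single_mem_monoidGrading (s y) 1
  · rw [gradedFaceProj_apply, faceProj_single, mul_one]

end FaceProj

end MonoidAlgebraMaps

/-! ### The cone over a lattice polytope -/

section ConeMonoid

open Filter Topology

variable {n : ℕ}

namespace LatticePolytope

variable (Q : LatticePolytope n)

theorem mem_coneMonoid {x : (Fin n → ℤ) × ℕ} :
    x ∈ Q.coneMonoid ↔ latticeToReal x.1 ∈ (x.2 : ℝ) • Q.carrier := Iff.rfl

theorem mem_coneMonoid_one {v : Fin n → ℤ} : (v, 1) ∈ Q.coneMonoid ↔ latticeToReal v ∈ Q.carrier := by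
  rw [mem_coneMonoid]; simp

theorem mem_coneMonoid_iff_of_pos {x : (Fin n → ℤ) × ℕ} (hx : 0 < x.2) :
    x ∈ Q.coneMonoid ↔ (x.2 : ℝ)⁻¹ • latticeToReal x.1 ∈ Q.carrier := by
  rw [mem_coneMonoid, Set.mem_smul_set_iff_inv_smul_mem₀ (by positivity)]

theorem eq_zero_of_mem_coneMonoid {x : (Fin n → ℤ) × ℕ} (hx : x ∈ Q.coneMonoid) (h0 : x.2 = 0) :
    x = 0 := by
  rw [mem_coneMonoid, h0, Nat.cast_zero, Set.zero_smul_set Q.carrier_nonempty] at hx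
  exact Prod.ext (latticeToReal_injective (hx.trans latticeToReal_zero.symm)) h0

theorem coneMonoid_mono {Q' : LatticePolytope n} (h : Q.carrier ⊆ Q'.carrier) :
    Q.coneMonoid ≤ Q'.coneMonoid := fun _ hx => Set.smul_set_mono h hx

/-- The cone over a lattice polytope consists of the non-negative combinations of the points
`(v, 1)`. -/
theorem exists_weights {V : Finset (Fin n → ℤ)}
    (hV : Q.carrier = convexHull ℝ (latticeToReal '' (V : Set (Fin n → ℤ))))
    {c : ℝ} (hc : 0 ≤ c) {y : Fin n → ℝ} :
    y ∈ c • Q.carrier ↔ ∃ a : (Fin n → ℤ) → ℝ, (∀ v ∈ V, 0 ≤ a v) ∧ ∑ v ∈ V, a v = c ∧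
      ∑ v ∈ V, a v • latticeToReal v = y := by
  classical
  have himg : latticeToReal '' (V : Set (Fin n → ℤ)) = ((V.image latticeToReal : Finset _) : Set _) := by
    simp
  have hsum : ∀ {M : Type} [AddCommMonoid M] (g : (Fin n → ℝ) → M),
      ∑ y ∈ V.image latticeToReal, g y = ∑ v ∈ V, g (latticeToReal v) := fun g =>
    Finset.sum_image fun _ _ _ _ h => latticeToReal_injective h
  constructor
  · rintro ⟨z, hz, rfl⟩
    rw [hV, himg, Finset.mem_convexHull'] at hz
    obtain ⟨b, hb0, hb1, hbz⟩ := hz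
    rw [hsum] at hb1 hbz
    refine ⟨fun v => c * b (latticeToReal v), fun v hv =>
      mul_nonneg hc (hb0 _ (Finset.mem_image_of_mem _ hv)), ?_, ?_⟩
    · rw [← Finset.mul_sum, hb1, mul_one]
    · simp only [mul_smul]
      rw [← Finset.smul_sum, hbz]
  · rintro ⟨a, ha0, ha1, rfl⟩
    rcases hc.eq_or_lt with rfl | hc'
    · rw [Set.zero_smul_set Q.carrier_nonempty, Set.mem_zero]
      rw [Finset.sum_eq_zero_iff_of_nonneg ha0] at ha1
      exact Finset.sum_eq_zero fun v hv => by rw [ha1 v hv, zero_smul]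
    · rw [Set.mem_smul_set_iff_inv_smul_mem₀ hc'.ne', Finset.smul_sum]
      simp only [smul_smul]
      refine Q.carrier_convex.sum_mem (fun v hv => mul_nonneg (inv_nonneg.2 hc) (ha0 v hv)) ?_ ?_
      · rw [← Finset.mul_sum, ha1, inv_mul_cancel₀ hc'.ne']
      · intro v hv
        rw [hV]
        exact subset_convexHull _ _ ⟨v, hv, rfl⟩

/-- Every point of the cone has a multiple from which a vertex can be split off. -/
theorem isCoveredInDegreeOne_coneMonoid : IsCoveredInDegreeOne Q.coneMonoid := by
  classical
  obtain ⟨V, hVne, hV⟩ := Q.exists_points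
  rintro ⟨m, k⟩ hx hk
  have hk' : (0 : ℝ) < k := Nat.cast_pos.2 hk
  obtain ⟨a, ha0, ha1, ham⟩ := (Q.exists_weights hV hk'.le).1 hx
  obtain ⟨v, hv, hav⟩ : ∃ v ∈ V, 0 < a v := by
    by_contra hcon
    push Not at hcon
    have := Finset.sum_nonpos hcon
    linarith
  obtain ⟨e, he⟩ := exists_nat_ge (a v)⁻¹
  have hea : 1 ≤ e * a v := by
    calc 1 = (a v)⁻¹ * a v := (inv_mul_cancel₀ hav.ne').symm
      _ ≤ _ := by gcongr
  have hsingle : ∑ u ∈ V, (if u = v then (1 : ℝ) else 0) = 1 := by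
    rw [Finset.sum_ite_eq' V v, if_pos hv]
  have hek : (1 : ℝ) ≤ e * k := by
    rw [← ha1, Finset.mul_sum]
    exact hea.trans (Finset.single_le_sum (f := fun u => (e : ℝ) * a u)
      (fun u hu => mul_nonneg (Nat.cast_nonneg e) (ha0 u hu)) hv)
  have hek' : 1 ≤ e * k := by exact_mod_cast hek
  -- the weight of `v` in `e • x` is at least one
  refine ⟨v, Q.mem_coneMonoid_one.2 (by rw [hV]; exact subset_convexHull _ _ ⟨v, hv, rfl⟩), e,
    (e • m - v, e * k - 1), ?_, ?_⟩
  · rw [mem_coneMonoid, exists_weights Q hV (Nat.cast_nonneg _)]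
    refine ⟨fun u => e * a u - if u = v then 1 else 0, fun u hu => ?_, ?_, ?_⟩
    · beta_reduce
      by_cases h : u = v
      · rw [if_pos h, h]; linarith
      · rw [if_neg h, sub_zero]
        exact mul_nonneg (Nat.cast_nonneg e) (ha0 u hu)
    · rw [Finset.sum_sub_distrib, hsingle, ← Finset.mul_sum, ha1]
      push_cast [Nat.cast_sub hek']
      ring
    · simp only [sub_smul, mul_smul, ite_smul, one_smul, zero_smul]
      rw [Finset.sum_sub_distrib, Finset.sum_ite_eq' V v, if_pos hv, ← Finset.smul_sum, ham,
        latticeToReal_sub, latticeToReal_nsmul, Nat.cast_smul_eq_nsmul]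
  · ext1
    · simp
    · simp only [Prod.smul_mk, Prod.mk_add_mk, smul_eq_mul]
      omega

theorem finite_setOf_latticeToReal_mem {s : Set (Fin n → ℝ)} (hs : Bornology.IsBounded s) :
    {m : Fin n → ℤ | latticeToReal m ∈ s}.Finite := by
  obtain ⟨R, hR⟩ := hs.subset_closedBall 0
  refine (Set.finite_Icc (fun _ => -⌈R⌉) (fun _ => ⌈R⌉)).subset fun m hm => ?_
  have h1 : ‖latticeToReal m‖ ≤ R := mem_closedBall_zero_iff.1 (hR hm)
  have h2 : ∀ i, |(m i : ℝ)| ≤ ⌈R⌉ := fun i => (norm_le_pi_norm (latticeToReal m) i).trans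
    (h1.trans (Int.le_ceil R))
  have h3 : ∀ i, |m i| ≤ ⌈R⌉ := fun i => by exact_mod_cast h2 i
  exact ⟨fun i => (abs_le.1 (h3 i)).1, fun i => (abs_le.1 (h3 i)).2⟩

/-- The monoid of lattice points of the cone is finitely generated: splitting off integral multiples
of the vertices leaves a remainder of bounded degree. -/
theorem fg_coneMonoid : Q.coneMonoid.FG := by
  classical
  obtain ⟨V, hVne, hV⟩ := Q.exists_points
  let S : Set ((Fin n → ℤ) × ℕ) := {x | x ∈ Q.coneMonoid ∧ x.2 ≤ V.card}
  have hSfin : S.Finite := by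
    have h1 : (⋃ k ∈ Finset.range (V.card + 1),
        (fun m : Fin n → ℤ => (m, k)) '' {m | latticeToReal m ∈ (k : ℝ) • Q.carrier}).Finite :=
      Set.Finite.biUnion (Finset.finite_toSet _) fun k _ =>
        (finite_setOf_latticeToReal_mem (Q.isCompact_carrier.isBounded.smul₀ _)).image _
    refine h1.subset fun x hx => ?_
    rw [Set.mem_iUnion₂]
    exact ⟨x.2, Finset.mem_range.2 (Nat.lt_succ_of_le hx.2), x.1, hx.1, rfl⟩
  rw [AddSubmonoid.fg_iff]
  refine ⟨S, le_antisymm ((AddSubmonoid.closure_le).2 fun x hx => hx.1) fun x hx => ?_, hSfin⟩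
  obtain ⟨a, ha0, ha1, ham⟩ := (Q.exists_weights hV (Nat.cast_nonneg _)).1 hx
  -- the integral parts of the weights
  let b : (Fin n → ℤ) → ℕ := fun v => ⌊a v⌋₊
  have hb : ∀ v ∈ V, (b v : ℝ) ≤ a v := fun v hv => Nat.floor_le (ha0 v hv)
  have hsum : ∑ v ∈ V, b v ≤ x.2 := by
    have : (∑ v ∈ V, (b v : ℝ)) ≤ x.2 := by
      rw [← ha1]; exact Finset.sum_le_sum hb
    exact_mod_cast this
  have hvS : ∀ v ∈ V, (v, 1) ∈ S := fun v hv =>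
    ⟨Q.mem_coneMonoid_one.2 (by rw [hV]; exact subset_convexHull _ _ ⟨v, hv, rfl⟩),
      Finset.card_pos.2 hVne⟩
  have hr : (x.1 - ∑ v ∈ V, b v • v, x.2 - ∑ v ∈ V, b v) ∈ S := by
    constructor
    · rw [mem_coneMonoid, exists_weights Q hV (Nat.cast_nonneg _)]
      refine ⟨fun v => a v - b v, fun v hv => sub_nonneg.2 (hb v hv), ?_, ?_⟩
      · rw [Finset.sum_sub_distrib, ha1, Nat.cast_sub hsum, Nat.cast_sum]
      · simp only [sub_smul]
        rw [Finset.sum_sub_distrib, ham]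
        ext i
        simp [latticeToReal]
    · have h1 : ((x.2 - ∑ v ∈ V, b v : ℕ) : ℝ) ≤ V.card := by
        rw [Nat.cast_sub hsum, Nat.cast_sum, ← ha1, ← Finset.sum_sub_distrib]
        calc ∑ v ∈ V, (a v - b v) ≤ ∑ v ∈ V, (1 : ℝ) :=
              Finset.sum_le_sum fun v _ => by
                have := Nat.lt_floor_add_one (a v)
                linarith
          _ = V.card := by simp
      exact_mod_cast h1
  have hx' : x = (x.1 - ∑ v ∈ V, b v • v, x.2 - ∑ v ∈ V, b v) + ∑ v ∈ V, b v • (v, 1) := by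
    ext1
    · rw [Prod.fst_add, Prod.fst_sum]; simp
    · rw [Prod.snd_add, Prod.snd_sum]; simp [hsum]
  rw [hx']
  refine add_mem (AddSubmonoid.subset_closure hr) (AddSubmonoid.sum_mem _ fun v hv =>
    AddSubmonoid.nsmul_mem _ (AddSubmonoid.subset_closure (hvS v hv)) _)

theorem mem_of_nsmul_mem_coneMonoid {e : ℕ} (he : 0 < e) {x : (Fin n → ℤ) × ℕ}
    (hx : e • x ∈ Q.coneMonoid) : x ∈ Q.coneMonoid := by
  have he' : (e : ℝ) ≠ 0 := by positivity
  rw [mem_coneMonoid] at hx ⊢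
  rw [Prod.smul_fst, Prod.smul_snd, latticeToReal_nsmul, smul_eq_mul, Nat.cast_mul, mul_smul,
    Set.smul_mem_smul_set_iff₀ he'] at hx
  exact hx

/-- A full-dimensional polytope has multiples which contain lattice points with a given
difference. -/
theorem exists_mem_coneMonoid_add (hQ : (interior Q.carrier).Nonempty) (v : Fin n → ℤ) :
    ∃ m k, (m, k) ∈ Q.coneMonoid ∧ (m + v, k) ∈ Q.coneMonoid := by
  obtain ⟨c, hc⟩ := hQ
  obtain ⟨r, hr, hball⟩ := Metric.isOpen_iff.1 isOpen_interior c hc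
  obtain ⟨k, hk⟩ := exists_nat_gt ((1 + ‖latticeToReal v‖) / r)
  have hk0 : (0 : ℝ) < k := lt_of_le_of_lt (by positivity) hk
  have hk1 : 1 + ‖latticeToReal v‖ < k * r := (div_lt_iff₀ hr).1 hk
  have key : ∀ u : Fin n → ℤ, ‖latticeToReal u - (k : ℝ) • c‖ ≤ 1 + ‖latticeToReal v‖ →
      (u, k) ∈ Q.coneMonoid := by
    intro u hu
    rw [mem_coneMonoid_iff_of_pos _ (by exact_mod_cast hk0)]
    refine interior_subset (hball ?_)
    rw [mem_ball_iff_norm]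
    have h1 : (k : ℝ)⁻¹ • latticeToReal u - c = (k : ℝ)⁻¹ • (latticeToReal u - (k : ℝ) • c) := by
      rw [smul_sub, inv_smul_smul₀ hk0.ne']
    rw [h1, norm_smul, norm_inv, Real.norm_natCast, inv_mul_lt_iff₀ hk0]
    exact hu.trans_lt hk1
  -- a lattice point near the multiple `k • c` of the center of a ball
  let m : Fin n → ℤ := fun i => ⌊k * c i⌋
  have hm : ‖latticeToReal m - (k : ℝ) • c‖ ≤ 1 := by
    refine (pi_norm_le_iff_of_nonneg zero_le_one).2 fun i => ?_
    have h1 := Int.floor_le (k * c i)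
    have h2 := Int.lt_floor_add_one (k * c i)
    rw [Real.norm_eq_abs, abs_le]
    simp only [latticeToReal, m, Pi.sub_apply, Pi.smul_apply, smul_eq_mul]
    constructor <;> linarith
  refine ⟨m, k, key m (hm.trans (le_add_of_nonneg_right (norm_nonneg _))), key _ ?_⟩
  rw [latticeToReal_add, add_sub_right_comm]
  exact (norm_add_le _ _).trans (by gcongr)

end LatticePolytope

end ConeMonoid

/-! ### The monoids of the degeneration -/

noncomputable section TotalMonoid

variable {n : ℕ}

/-- The homogenization of the integral affine function `f`. -/
def homForm (f : (Fin n → ℤ) × ℤ) : (Fin n → ℤ) × ℕ →+ ℤ where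
  toFun x := ∑ i, f.1 i * x.1 i + f.2 * x.2
  map_zero' := by simp
  map_add' x y := by
    simp only [Prod.fst_add, Prod.snd_add, Pi.add_apply, mul_add, Finset.sum_add_distrib,
      Nat.cast_add]
    ring

theorem homForm_eq_mul_affineValue (f : (Fin n → ℤ) × ℤ) {x : (Fin n → ℤ) × ℕ} (hx : 0 < x.2) :
    (homForm f x : ℝ) = x.2 * affineValue f ((x.2 : ℝ)⁻¹ • latticeToReal x.1) := by
  have hx' : (x.2 : ℝ) ≠ 0 := by positivity
  rw [affineValue, map_smul, realForm_latticeToReal, smul_eq_mul, mul_add, ← mul_assoc,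
    mul_inv_cancel₀ hx', one_mul]
  simp [homForm, mul_comm]

/-- The projection `((m, l), k) ↦ (m, k)`. -/
def forgetHeight : ((Fin n → ℤ) × ℤ) × ℕ →+ (Fin n → ℤ) × ℕ where
  toFun x := (x.1.1, x.2)
  map_zero' := rfl
  map_add' _ _ := rfl

variable {P : LatticePolytope n} {ι : Type*} {Γ : SimplicialPartition P ι}

theorem SimplicialPartition.nonempty_index (Γ : SimplicialPartition P ι) : Nonempty ι := by
  obtain ⟨y, hy⟩ := P.carrier_nonempty
  obtain ⟨j, -⟩ := Γ.exists_mem_piece hy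
  exact ⟨j⟩

theorem SimplicialPartition.exists_mem_coneMonoid (Γ : SimplicialPartition P ι)
    {x : (Fin n → ℤ) × ℕ} (hx : x ∈ P.coneMonoid) : ∃ j, x ∈ (Γ.piece j).coneMonoid := by
  rcases Nat.eq_zero_or_pos x.2 with h | h
  · obtain ⟨j⟩ := Γ.nonempty_index
    exact ⟨j, P.eq_zero_of_mem_coneMonoid hx h ▸ zero_mem _⟩
  · obtain ⟨j, hj⟩ := Γ.exists_mem_piece ((P.mem_coneMonoid_iff_of_pos h).1 hx)
    exact ⟨j, ((Γ.piece j).mem_coneMonoid_iff_of_pos h).2 hj⟩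

theorem SimplicialPartition.coneMonoid_piece_le (Γ : SimplicialPartition P ι) (j : ι) :
    (Γ.piece j).coneMonoid ≤ P.coneMonoid :=
  (Γ.piece j).coneMonoid_mono (Γ.piece_subset j)

namespace SimplicialPartition.Potential

variable (pot : Γ.Potential)

/-- The homogeneous linear form which belongs to the `j`-th polytope of the partition. -/
def height (j : ι) : (Fin n → ℤ) × ℕ →+ ℤ := homForm (pot.form j)

variable {pot}

theorem height_le {i : ι} (j : ι) {x : (Fin n → ℤ) × ℕ} (hx : x ∈ (Γ.piece i).coneMonoid) :
    pot.height j x ≤ pot.height i x := by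
  rcases Nat.eq_zero_or_pos x.2 with h | h
  · rw [LatticePolytope.eq_zero_of_mem_coneMonoid _ hx h, map_zero, map_zero]
  · have h1 := pot.le i j _ ((LatticePolytope.mem_coneMonoid_iff_of_pos _ h).1 hx)
    have h2 : (pot.height j x : ℝ) ≤ pot.height i x := by
      rw [height, height, homForm_eq_mul_affineValue _ h, homForm_eq_mul_affineValue _ h]
      gcongr
    exact_mod_cast h2

theorem mem_of_height_eq {i j : ι} {x : (Fin n → ℤ) × ℕ} (hx : x ∈ (Γ.piece i).coneMonoid)
    (hij : pot.height j x = pot.height i x) : x ∈ (Γ.piece j).coneMonoid := by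
  rcases Nat.eq_zero_or_pos x.2 with h | h
  · rw [LatticePolytope.eq_zero_of_mem_coneMonoid _ hx h]
    exact zero_mem _
  · rw [LatticePolytope.mem_coneMonoid_iff_of_pos _ h] at hx ⊢
    refine pot.mem_of_eq i j _ hx ?_
    have h2 : (pot.height j x : ℝ) = pot.height i x := by rw [hij]
    rw [height, height, homForm_eq_mul_affineValue _ h, homForm_eq_mul_affineValue _ h] at h2
    exact mul_left_cancel₀ (by positivity) h2

variable (pot)

/-- The monoid of the total space of the degeneration: the lattice points `((m, l), k)` of the cone
over the unbounded polyhedron of the points above the graph of the maximum of the forms. -/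
def totalMonoid : AddSubmonoid (((Fin n → ℤ) × ℤ) × ℕ) where
  carrier := {x | forgetHeight x ∈ P.coneMonoid ∧ ∀ j, pot.height j (forgetHeight x) ≤ x.1.2}
  zero_mem' := by
    refine ⟨?_, fun j => ?_⟩
    · rw [map_zero]
      exact zero_mem _
    · rw [map_zero, map_zero]
      exact le_rfl
  add_mem' {x y} hx hy := by
    refine ⟨?_, fun j => ?_⟩
    · rw [map_add]
      exact add_mem hx.1 hy.1
    · rw [map_add, map_add]
      exact add_le_add (hx.2 j) (hy.2 j)

variable {pot}

theorem mem_totalMonoid_of_mem {j : ι} {x : ((Fin n → ℤ) × ℤ) × ℕ}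
    (hx : (x.1.1, x.2) ∈ (Γ.piece j).coneMonoid) (h : pot.height j (x.1.1, x.2) ≤ x.1.2) :
    x ∈ pot.totalMonoid :=
  ⟨Γ.coneMonoid_piece_le j hx, fun i => (height_le i hx).trans h⟩

theorem vertical_mem : (((0, 1), 0) : ((Fin n → ℤ) × ℤ) × ℕ) ∈ pot.totalMonoid :=
  ⟨zero_mem _, fun j => (map_zero (pot.height j)).le.trans zero_le_one⟩

variable (pot)

/-- The exponent of the parameter `t` of the degeneration. -/
def vertical : pot.totalMonoid := ⟨((0, 1), 0), vertical_mem⟩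

/-- The map of the cone over the `j`-th polytope to the graph of its linear form. -/
def graphHom (j : ι) : (Fin n → ℤ) × ℕ →+ ((Fin n → ℤ) × ℤ) × ℕ where
  toFun x := ((x.1, pot.height j x), x.2)
  map_zero' := by simp
  map_add' x y := by simp

/-- The embedding of the cone over the `j`-th polytope as a lower face of the monoid of the total
space. -/
def faceHom (j : ι) : (Γ.piece j).coneMonoid →+ pot.totalMonoid where
  toFun x := ⟨pot.graphHom j x, mem_totalMonoid_of_mem (j := j) x.2 le_rfl⟩
  map_zero' := Subtype.ext (map_zero (pot.graphHom j))
  map_add' _ _ := Subtype.ext (map_add (pot.graphHom j) _ _)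

@[simp]
theorem faceHom_coe (j : ι) (x : (Γ.piece j).coneMonoid) :
    (pot.faceHom j x : ((Fin n → ℤ) × ℤ) × ℕ) = ((x.1.1, pot.height j x.1), x.1.2) := rfl

theorem faceHom_injective (j : ι) : Function.Injective (pot.faceHom j) := by
  intro x y h
  have h' := congrArg Subtype.val h
  simp only [faceHom_coe, Prod.mk.injEq] at h'
  exact Subtype.ext (Prod.ext h'.1.1 h'.2)

variable {pot}

/-- The graph of the `j`-th form touches the monoid only over the cone of the `j`-th polytope. -/
theorem mem_range_faceHom {j : ι} {x : pot.totalMonoid} :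
    x ∈ Set.range (pot.faceHom j) ↔ x.1.1.2 = pot.height j (x.1.1.1, x.1.2) := by
  constructor
  · rintro ⟨y, rfl⟩
    rfl
  · intro h
    obtain ⟨i, hi⟩ := Γ.exists_mem_coneMonoid x.2.1
    have h1 : pot.height j (x.1.1.1, x.1.2) = pot.height i (x.1.1.1, x.1.2) :=
      le_antisymm (height_le j hi) ((x.2.2 i).trans h.le)
    refine ⟨⟨(x.1.1.1, x.1.2), mem_of_height_eq hi h1⟩, Subtype.ext ?_⟩
    rw [faceHom_coe, ← h]

/-- The elements of the monoid which lie on the graph of the `j`-th form are those at which a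
nonnegative additive function vanishes, so they form a face. -/
theorem isFace_range_faceHom (j : ι) (x y : pot.totalMonoid)
    (h : x + y ∈ Set.range (pot.faceHom j)) : x ∈ Set.range (pot.faceHom j) := by
  rw [mem_range_faceHom] at h ⊢
  have h1 : x.1.1.2 + y.1.1.2 = pot.height j (x.1.1.1, x.1.2) + pot.height j (y.1.1.1, y.1.2) := by
    rw [← map_add]; exact h
  have h2 : pot.height j (x.1.1.1, x.1.2) ≤ x.1.1.2 := x.2.2 j
  have h3 : pot.height j (y.1.1.1, y.1.2) ≤ y.1.1.2 := y.2.2 j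
  omega

/-- The heights are integers, so an element strictly above the graphs of all forms remains in the
monoid when the height is lowered by one. -/
theorem exists_eq_vertical_add {x : pot.totalMonoid} (hx : ∀ j, x ∉ Set.range (pot.faceHom j)) :
    ∃ y, x = pot.vertical + y := by
  refine ⟨⟨((x.1.1.1, x.1.1.2 - 1), x.1.2), x.2.1, fun j => ?_⟩, Subtype.ext ?_⟩
  · have h1 : pot.height j (x.1.1.1, x.1.2) ≤ x.1.1.2 := x.2.2 j
    have h2 := mt mem_range_faceHom.2 (hx j)
    change pot.height j (x.1.1.1, x.1.2) ≤ x.1.1.2 - 1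
    omega
  · ext1
    · exact Prod.ext (zero_add _).symm (add_sub_cancel _ _).symm
    · exact (zero_add _).symm

theorem vertical_notMem_range (j : ι) : pot.vertical ∉ Set.range (pot.faceHom j) := by
  rw [mem_range_faceHom]
  change (1 : ℤ) ≠ pot.height j 0
  rw [map_zero]
  exact one_ne_zero

theorem nsmul_mem_totalMonoid {e : ℕ} (he : 0 < e) {x : ((Fin n → ℤ) × ℤ) × ℕ}
    (hx : e • x ∈ pot.totalMonoid) : x ∈ pot.totalMonoid := by
  refine ⟨?_, fun j => ?_⟩
  · exact P.mem_of_nsmul_mem_coneMonoid he hx.1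
  · have h1 : pot.height j (e • (x.1.1, x.2)) ≤ e • x.1.2 := hx.2 j
    rw [map_nsmul] at h1
    simp only [nsmul_eq_mul] at h1
    exact le_of_mul_le_mul_left h1 (by exact_mod_cast he)

theorem isCoveredInDegreeOne_totalMonoid : IsCoveredInDegreeOne pot.totalMonoid := by
  intro x hx hpos
  obtain ⟨j, hj⟩ := Γ.exists_mem_coneMonoid hx.1
  obtain ⟨w, hw, e, y, hy, h⟩ := (Γ.piece j).isCoveredInDegreeOne_coneMonoid _ hj hpos
  refine ⟨(w, pot.height j (w, 1)), mem_totalMonoid_of_mem (j := j) hw le_rfl, e,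
    ((y.1, e • x.1.2 - pot.height j (w, 1)), y.2),
    mem_totalMonoid_of_mem (j := j) hy ?_, ?_⟩
  · have h1 : e • pot.height j (x.1.1, x.2) = pot.height j y + pot.height j (w, 1) := by
      rw [← map_nsmul, ← map_add]
      exact congrArg _ h
    have h2 : e • pot.height j (x.1.1, x.2) ≤ e • x.1.2 := nsmul_le_nsmul_right (hx.2 j) e
    change pot.height j y ≤ _
    simp only
    linarith
  · have h1 : e • x.1.1 = y.1 + w := congrArg Prod.fst h
    have h2 : e • x.2 = y.2 + 1 := congrArg Prod.snd h
    refine Prod.ext (Prod.ext h1 (sub_add_cancel _ _).symm) h2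

/-- The monoid is generated by the graphs over the cones of the polytopes and the vertical vector.
-/
theorem fg_totalMonoid [Finite ι] : pot.totalMonoid.FG := by
  have h : pot.totalMonoid = (⨆ j, (Γ.piece j).coneMonoid.map (pot.graphHom j)) ⊔
      AddSubmonoid.closure {((0, 1), 0)} := by
    refine le_antisymm (fun x hx => ?_) (sup_le (iSup_le fun j => ?_) ?_)
    · obtain ⟨j, hj⟩ := Γ.exists_mem_coneMonoid hx.1
      have h1 : x = pot.graphHom j (x.1.1, x.2) +
          (x.1.2 - pot.height j (x.1.1, x.2)).toNat • (((0, 1), 0) : ((Fin n → ℤ) × ℤ) × ℕ) := by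
        have h2 : pot.height j (x.1.1, x.2) ≤ x.1.2 := hx.2 j
        ext1
        · ext1
          · simp [graphHom]
          · simp [graphHom, h2]
        · simp [graphHom]
      rw [h1]
      refine AddSubmonoid.add_mem_sup ?_ (AddSubmonoid.nsmul_mem _
        (AddSubmonoid.subset_closure (Set.mem_singleton _)) _)
      exact (le_iSup (fun i => (Γ.piece i).coneMonoid.map (pot.graphHom i)) j)
        (AddSubmonoid.mem_map_of_mem _ hj)
    · rw [AddSubmonoid.map_le_iff_le_comap]
      intro x hx
      exact mem_totalMonoid_of_mem (x := pot.graphHom j x) (j := j) hx (le_refl (pot.height j x))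
    · rw [AddSubmonoid.closure_le, Set.singleton_subset_iff]
      exact vertical_mem
  rw [h]
  refine AddSubmonoid.FG.sup (AddSubmonoid.FG.iSup _ fun j => ?_) ⟨{((0, 1), 0)}, by simp⟩
  exact (Γ.piece j).fg_coneMonoid.map _

/-- The differences of elements of the monoid of the same degree fill the lattice. -/
theorem exists_sub_eq [Finite ι] (hP : (interior P.carrier).Nonempty) (h : (Fin n → ℤ) × ℤ) :
    ∃ x ∈ pot.totalMonoid, ∃ y ∈ pot.totalMonoid, x.2 = y.2 ∧ x.1 - y.1 = h := by
  obtain ⟨m, k, h1, h2⟩ := P.exists_mem_coneMonoid_add hP h.1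
  obtain ⟨a, ha⟩ := (Set.finite_range fun j => pot.height j (m, k)).bddAbove
  obtain ⟨b, hb⟩ := (Set.finite_range fun j => pot.height j (m + h.1, k) - h.2).bddAbove
  refine ⟨((m + h.1, max a b + h.2), k), ⟨h2, fun j => ?_⟩, ((m, max a b), k), ⟨h1, fun j => ?_⟩,
    rfl, ?_⟩
  · have h3 : pot.height j (m + h.1, k) - h.2 ≤ max a b := (hb ⟨j, rfl⟩).trans (le_max_right a b)
    change pot.height j (m + h.1, k) ≤ max a b + h.2
    linarith
  · exact (ha ⟨j, rfl⟩).trans (le_max_left a b)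
  · exact Prod.ext (add_sub_cancel_left _ _) (add_sub_cancel_left _ _)

end SimplicialPartition.Potential

namespace LatticePolytope

variable (P)

/-- The monoid of the product of the toric variety of `P` with the punctured line. -/
def productMonoid : AddSubmonoid (((Fin n → ℤ) × ℤ) × ℕ) := P.coneMonoid.comap forgetHeight

end LatticePolytope

end TotalMonoid

/-! ### Localizations of monoid algebras -/

noncomputable section MonoidLocalization

open AddMonoidAlgebra hiding coeff

/-- The localization of a monoid algebra at a character is the monoid algebra in which the exponent
of the character has become invertible. -/
theorem isLocalizationAway_single {S T : Type} [AddCommMonoid S] [AddCommMonoid T] (i : S →+ T)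
    (hi : Function.Injective i) (u : S) (v : T) (huv : i u + v = 0)
    (h : ∀ x : T, ∃ (e : ℕ) (y : S), i y = x + e • i u) :
    letI := (mapDomainRingHom ℂ i).toAlgebra
    IsLocalization.Away (single u 1 : AddMonoidAlgebra ℂ S) (AddMonoidAlgebra ℂ T) := by
  let := (mapDomainRingHom ℂ i).toAlgebra
  have halg : ∀ (x : S) (c : ℂ),
      algebraMap (AddMonoidAlgebra ℂ S) (AddMonoidAlgebra ℂ T) (single x c) = single (i x) c := by
    intro x c
    change mapDomainRingHom ℂ i (single x c) = _
    rw [mapDomainRingHom_apply, mapDomain_single]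
  have hpow : ∀ e : ℕ, (single u 1 : AddMonoidAlgebra ℂ S) ^ e = single (e • u) 1 := fun e => by
    rw [single_pow, one_pow]
  refine ⟨?_, ?_, ?_⟩
  · rintro ⟨_, e, rfl⟩
    refine IsUnit.of_mul_eq_one (single (e • v) 1) ?_
    change algebraMap _ _ ((single u 1 : AddMonoidAlgebra ℂ S) ^ e) * _ = 1
    rw [hpow, halg, single_mul_single, map_nsmul, ← smul_add, huv, smul_zero, one_mul]
    rfl
  · intro z
    suffices h' : ∃ (e : ℕ) (a : AddMonoidAlgebra ℂ S),
        z * algebraMap _ _ (single (e • u) 1 : AddMonoidAlgebra ℂ S) = algebraMap _ _ a by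
      obtain ⟨e, a, ha⟩ := h'
      exact ⟨(a, ⟨_, e, rfl⟩), by rw [← ha, ← hpow]⟩
    induction z using AddMonoidAlgebra.induction_linear with
    | zero => exact ⟨0, 0, by rw [zero_mul, map_zero]⟩
    | add z z' hz hz' =>
      obtain ⟨e, a, ha⟩ := hz
      obtain ⟨e', a', ha'⟩ := hz'
      refine ⟨e + e', a * single (e' • u) 1 + a' * single (e • u) 1, ?_⟩
      have hadd : (single ((e + e') • u) 1 : AddMonoidAlgebra ℂ S)
          = single (e • u) 1 * single (e' • u) 1 := by
        rw [single_mul_single, one_mul, add_smul]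
      rw [map_add, map_mul, map_mul, ← ha, ← ha', hadd, map_mul]
      ring
    | single x c =>
      obtain ⟨e, y, hy⟩ := h x
      refine ⟨e, single y c, ?_⟩
      rw [halg, halg, single_mul_single, mul_one, hy, map_nsmul]
  · intro a b hab
    exact ⟨1, by rw [mapDomain_injective hi hab]⟩

/-- In a finitely generated monoid there is an element some multiple of which exceeds any given
element. -/
theorem exists_forall_exists_nsmul_eq_add {S : Type*} [AddCommMonoid S] [AddMonoid.FG S] :
    ∃ u : S, ∀ x : S, ∃ (e : ℕ) (y : S), e • u = x + y := by
  classical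
  obtain ⟨G, hG⟩ := AddMonoid.FG.fg_top (M := S)
  refine ⟨∑ g ∈ G, g, fun x => ?_⟩
  have hx : x ∈ AddSubmonoid.closure (G : Set S) := hG ▸ AddSubmonoid.mem_top x
  induction hx using AddSubmonoid.closure_induction with
  | mem x hx => exact ⟨1, ∑ g ∈ G.erase x, g, by
      rw [one_smul]; exact (Finset.add_sum_erase G (fun g => g) hx).symm⟩
  | zero => exact ⟨0, 0, by simp⟩
  | add x y _ _ hx hy =>
    obtain ⟨e, z, hz⟩ := hx
    obtain ⟨e', z', hz'⟩ := hy
    exact ⟨e + e', z + z', by rw [add_smul, hz, hz']; abel⟩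

section Toric

variable {d : ℕ} {T : Type} [AddCommGroup T]

/-- The torus is the complement of the zero set of a character in the interior of the cone. -/
theorem torusIn_eq_basicOpen (S : AddSubmonoid (Fin d → ℤ)) (hS : IsToricMonoid S) (u : S)
    (hu : ∀ x : S, ∃ (e : ℕ) (y : S), e • u = x + y) :
    torusIn S = (PrimeSpectrum.basicOpen (single u (1 : ℂ)) : Set (PrimeSpectrum _)) := by
  have h : ∀ x : Fin d → ℤ, ∃ (e : ℕ) (y : S), S.subtype y = x + e • S.subtype u := by
    intro x
    have hx : x ∈ AddSubgroup.closure (S : Set (Fin d → ℤ)) := hS.2.1 ▸ AddSubgroup.mem_top x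
    induction hx using AddSubgroup.closure_induction with
    | mem x hx => exact ⟨0, ⟨x, hx⟩, by simp⟩
    | zero => exact ⟨0, 0, by simp⟩
    | add x y _ _ hx hy =>
      obtain ⟨e, z, hz⟩ := hx
      obtain ⟨e', z', hz'⟩ := hy
      exact ⟨e + e', z + z', by rw [map_add, hz, hz', add_smul]; abel⟩
    | neg x _ hx =>
      obtain ⟨e, z, hz⟩ := hx
      obtain ⟨e', z', hz'⟩ := hu z
      have h1 : e' • S.subtype u = S.subtype z + S.subtype z' := by
        rw [← map_nsmul, hz', map_add]
      refine ⟨e', z' + e • u, ?_⟩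
      rw [map_add, map_nsmul, h1, hz]
      abel
  let := (mapDomainRingHom ℂ S.subtype).toAlgebra
  have := isLocalizationAway_single S.subtype Subtype.val_injective u (-u : Fin d → ℤ)
    (add_neg_cancel _) h
  exact PrimeSpectrum.localization_away_comap_range _ _

/-- The isomorphism of affine toric varieties given by an isomorphism of the lattices. -/
def affineToricIso (κ : T ≃+ (Fin d → ℤ)) (M : AddSubmonoid T) :
    Spec (CommRingCat.of (AddMonoidAlgebra ℂ M)) ⟶ affineToric (M.map κ) :=
  Spec.map (AddMonoidAlgebra.domCongr ℂ ℂ (κ.addSubmonoidMap M)).symm.toRingEquiv.toCommRingCatIso.hom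

instance (κ : T ≃+ (Fin d → ℤ)) (M : AddSubmonoid T) : IsIso (affineToricIso κ M) := by
  unfold affineToricIso
  infer_instance

end Toric

end MonoidLocalization

/-! ### The morphism to the affine line given by a character of degree zero -/

noncomputable section Parameter

open AddMonoidAlgebra hiding coeff

variable {H : Type} [AddCommGroup H] {N : AddSubmonoid (H × ℕ)} {t : N} (ht : t.1.2 = 0)

/-- The homomorphism `ℂ[X] → ℂ[N]₀` which maps the variable to a character of degree zero. -/
def paramHom : ℂ[X] →+* monoidGrading N 0 :=
  (Polynomial.aeval (R := ℂ) (A := monoidGrading N 0)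
    ⟨single t 1, ht ▸ single_mem_monoidGrading t 1⟩).toRingHom

theorem coe_paramHom (f : ℂ[X]) :
    (paramHom ht f : AddMonoidAlgebra ℂ N) = Polynomial.aeval (R := ℂ) (single t (1 : ℂ)) f := by
  have h : ((algebraMap (monoidGrading N 0) (AddMonoidAlgebra ℂ N)).comp (paramHom ht)) =
      (Polynomial.aeval (R := ℂ) (single t (1 : ℂ))).toRingHom := by
    refine Polynomial.ringHom_ext (fun c => ?_) ?_
    · simp only [paramHom, AlgHom.toRingHom_eq_coe, RingHom.comp_apply, RingHom.coe_coe,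
        Polynomial.aeval_C]
      rfl
    · simp only [paramHom, AlgHom.toRingHom_eq_coe, RingHom.comp_apply, RingHom.coe_coe,
        Polynomial.aeval_X]
      rfl
  exact RingHom.congr_fun h f

theorem chartStructure_paramHom (w : H) : chartStructure (paramHom ht) w =
    (Polynomial.aeval (R := ℂ) (single (toChart N w t) (1 : ℂ))).toRingHom := by
  refine Polynomial.ringHom_ext (fun c => ?_) ?_
  · rw [chartStructure_apply, coe_paramHom]
    simp only [AlgHom.toRingHom_eq_coe, RingHom.coe_coe, Polynomial.aeval_C]
    change dehomogenize N w (single 0 c) = single 0 c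
    rw [dehomogenize_single, map_zero]
  · rw [chartStructure_apply, coe_paramHom]
    simp only [AlgHom.toRingHom_eq_coe, RingHom.coe_coe, Polynomial.aeval_X, dehomogenize_single]

theorem isProper_structureMap_paramHom [AddMonoid.FG N] (h0 : ∀ x : N, x.1.2 = 0 → ∃ e : ℕ, x = e • t) :
    IsProper (structureMap N (paramHom ht)) := by
  have : IsScalarTower ℂ (monoidGrading N 0) (AddMonoidAlgebra ℂ N) :=
    IsScalarTower.of_algebraMap_eq (R := ℂ) (S := monoidGrading N 0)
      (A := AddMonoidAlgebra ℂ N) fun _ => rfl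
  have h2 : Algebra.FiniteType (monoidGrading N 0) (AddMonoidAlgebra ℂ N) :=
    .of_restrictScalars_finiteType ℂ _ _
  -- the degree zero part is generated by the parameter, so that the family is a closed subscheme of
  -- a projective scheme over the line
  have h3 : Function.Surjective (paramHom ht) := by
    rintro ⟨a, ha⟩
    suffices h : ∃ f, Polynomial.aeval (R := ℂ) (single t (1 : ℂ)) f = a by
      obtain ⟨f, hf⟩ := h
      exact ⟨f, Subtype.ext ((coe_paramHom ht f).trans hf)⟩
    refine ⟨∑ x ∈ a.coeff.support.attach,
      Polynomial.monomial (h0 x.1 (ha x.1 x.2)).choose (a.coeff x.1), ?_⟩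
    rw [map_sum]
    conv_rhs => rw [← a.sum_coeff_single, Finsupp.sum, ← Finset.sum_attach]
    refine Finset.sum_congr rfl fun x _ => ?_
    rw [Polynomial.aeval_monomial, single_pow, one_pow, ← (h0 x.1 (ha x.1 x.2)).choose_spec]
    change single 0 _ * _ = _
    rw [single_mul_single, zero_add, mul_one]
    rfl
  have h4 : IsClosedImmersion (Spec.map (CommRingCat.ofHom (paramHom ht))) :=
    IsClosedImmersion.spec_of_surjective _ h3
  unfold structureMap
  infer_instance

theorem coeff_aeval_single {S : Type*} [AddCommMonoid S] {s : S}
    (hs : Function.Injective fun e : ℕ => e • s) (f : ℂ[X]) (e : ℕ) :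
    (Polynomial.aeval (R := ℂ) (single s (1 : ℂ)) f).coeff (e • s) = f.coeff e := by
  classical
  induction f using Polynomial.induction_on' with
  | add p q hp hq => rw [map_add, AddMonoidAlgebra.coeff_add, Finsupp.add_apply, hp, hq,
      Polynomial.coeff_add]
  | monomial k c =>
    rw [Polynomial.aeval_monomial, single_pow, one_pow]
    change (single 0 c * single (k • s) 1 : AddMonoidAlgebra ℂ S).coeff _ = _
    rw [single_mul_single, zero_add, mul_one, AddMonoidAlgebra.coeff_single, Polynomial.coeff_monomial,
      Finsupp.single_apply]
    simp only [hs.eq_iff]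

theorem flat_structureMap_paramHom [IsDomain (AddMonoidAlgebra ℂ H)] (hN : IsCoveredInDegreeOne N)
    (hinj : Function.Injective fun e : ℕ => e • t.1.1) : Flat (structureMap N (paramHom ht)) := by
  have hflat : IsZariskiLocalAtSource @Flat.{0} :=
    HasRingHomProperty.instIsZariskiLocalAtSource (Q := RingHom.Flat)
  suffices h : ∀ (w : H) (hw : (w, 1) ∈ N), Flat (chartι hw ≫ structureMap N (paramHom ht)) from
    IsZariskiLocalAtSource.of_openCover (P := @Flat.{0}) (chartCover hN).openCover fun i => h i.1 i.2
  intro w hw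
  rw [chartι_structureMap, Flat.SpecMap_iff, CommRingCat.hom_ofHom, chartStructure_paramHom]
  have hs : Function.Injective fun e : ℕ => e • toChart N w t := by
    intro e e' h
    have h' := congrArg Subtype.val h
    simp only [AddSubmonoidClass.coe_nsmul, toChart_coe, ht, zero_smul, sub_zero] at h'
    exact hinj h'
  algebraize [(Polynomial.aeval (R := ℂ) (single (toChart N w t) (1 : ℂ))).toRingHom]
  have h1 : Function.Injective (algebraMap ℂ[X] (AddMonoidAlgebra ℂ (chartMonoid N w))) := by
    rw [injective_iff_map_eq_zero]
    intro f hf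
    ext e
    rw [← coeff_aeval_single hs]
    have : Polynomial.aeval (R := ℂ) (single (toChart N w t) (1 : ℂ)) f = 0 := hf
    rw [this]
    rfl
  -- torsion-free modules over a principal ideal domain are flat
  have h2 : FaithfulSMul ℂ[X] (AddMonoidAlgebra ℂ (chartMonoid N w)) :=
    (faithfulSMul_iff_algebraMap_injective _ _).2 h1
  change Module.Flat ℂ[X] (AddMonoidAlgebra ℂ (chartMonoid N w))
  infer_instance

/-- The charts of a saturated and finitely generated graded monoid are normal affine toric
varieties. -/
theorem isToricMonoid_chartMonoid {d : ℕ} (κ : H ≃+ (Fin d → ℤ)) {w : H} (hw : (w, 1) ∈ N) (hfg : N.FG)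
    (hsub : ∀ h : H, ∃ x ∈ N, ∃ y ∈ N, x.2 = y.2 ∧ x.1 - y.1 = h)
    (hsat : ∀ {e : ℕ}, 0 < e → ∀ {x : H × ℕ}, e • x ∈ N → x ∈ N) :
    IsToricMonoid ((chartMonoid N w).map κ) := by
  refine ⟨(hfg.map _).map (κ : H →+ (Fin d → ℤ)), ?_, ?_⟩
  · rw [AddSubgroup.eq_top_iff']
    intro z
    obtain ⟨x, hx, y, hy, hxy, hz⟩ := hsub (κ.symm z)
    have h1 : z = κ (chartHom w x) - κ (chartHom w y) := by
      rw [← map_sub]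
      change z = κ ((x.1 - x.2 • w) - (y.1 - y.2 • w))
      rw [hxy, sub_sub_sub_cancel_right, hz, AddEquiv.apply_symm_apply]
    rw [h1]
    exact sub_mem (AddSubgroup.subset_closure ⟨_, ⟨x, hx, rfl⟩, rfl⟩)
      (AddSubgroup.subset_closure ⟨_, ⟨y, hy, rfl⟩, rfl⟩)
  · rintro e z he ⟨_, ⟨x, hx, rfl⟩, hz⟩
    have hz' : κ (chartHom w x) = e • z := hz
    have h1 : chartHom w x = e • κ.symm z := by
      rw [← map_nsmul, ← hz', AddEquiv.symm_apply_apply]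
    obtain ⟨e, rfl⟩ := Nat.exists_eq_succ_of_ne_zero he.ne'
    have h2 : (κ.symm z + x.2 • w, x.2) ∈ N := by
      refine hsat he ?_
      have : (e + 1) • (κ.symm z + x.2 • w, x.2) = x + (e * x.2) • (w, 1) := by
        have h3 : x.1 = (e + 1) • κ.symm z + x.2 • w := sub_eq_iff_eq_add.1 h1
        ext1
        · simp only [Prod.smul_fst, Prod.fst_add]
          rw [h3]
          simp only [smul_add, mul_smul, add_smul, one_smul]
          abel
        · simp only [Prod.smul_snd, Prod.snd_add, smul_eq_mul]
          ring
      rw [this]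
      exact add_mem hx (AddSubmonoid.nsmul_mem _ hw _)
    refine ⟨_, ⟨_, h2, rfl⟩, ?_⟩
    change κ ((κ.symm z + x.2 • w) - x.2 • w) = z
    rw [add_sub_cancel_right, AddEquiv.apply_symm_apply]

/-- In the chart at a character of degree one the family is an affine toric variety with a
character. -/
theorem isToroidalAt_structureMap_paramHom {d : ℕ} (κ : H ≃+ (Fin d → ℤ)) (hN : IsCoveredInDegreeOne N)
    (hfg : N.FG) (hsub : ∀ h : H, ∃ x ∈ N, ∃ y ∈ N, x.2 = y.2 ∧ x.1 - y.1 = h)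
    (hsat : ∀ {e : ℕ}, 0 < e → ∀ {x : H × ℕ}, e • x ∈ N → x ∈ N) {u : N}
    (hu : ∀ x : N, ∃ (e : ℕ) (y : N), e • u = x + y) (y : Proj (monoidGrading N)) :
    IsToroidalAt (structureMap N (paramHom ht))
      (Proj.basicOpen (monoidGrading N) (single u 1)) y := by
  obtain ⟨w, hw, hy⟩ := hN.exists_mem_basicOpen y
  rw [← opensRange_chartι] at hy
  let E := κ.addSubmonoidMap (chartMonoid N w)
  have hS := isToricMonoid_chartMonoid κ hw hfg hsub hsat
  refine ⟨d, (chartMonoid N w).map κ, E (toChart N w t), _, chartι hw,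
    affineToricIso κ (chartMonoid N w), hS, inferInstance, inferInstance, hy, ?_, ?_⟩
  · have h1 : ∀ x : (chartMonoid N w).map κ, ∃ (e : ℕ)
        (y : (chartMonoid N w).map κ), e • E (toChart N w u) = x + y := by
      intro x
      obtain ⟨x, rfl⟩ := E.surjective x
      obtain ⟨x, rfl⟩ := toChart_surjective w x
      obtain ⟨e, y, hy⟩ := hu x
      exact ⟨e, E (toChart N w y), by
        rw [← map_nsmul, ← map_nsmul, hy, map_add, map_add]⟩
    rw [torusIn_eq_basicOpen _ hS _ h1]
    have h2 := congrArg (fun U : TopologicalSpace.Opens _ => U.carrier)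
      (chartι_preimage_basicOpen hw u)
    refine h2.trans ?_
    change _ = (PrimeSpectrum.basicOpen ((AddMonoidAlgebra.domCongr ℂ ℂ E).symm (single _ 1))).carrier
    rw [AddMonoidAlgebra.domCongr_symm, AddMonoidAlgebra.domCongr_single, AddEquiv.symm_apply_apply]
  · change _ = Spec.map _ ≫ Spec.map (CommRingCat.ofHom
      (Polynomial.aeval (R := ℂ) (single (E (toChart N w t)) (1 : ℂ))).toRingHom)
    rw [chartι_structureMap, ← Spec.map_comp, chartStructure_paramHom]
    congr 1
    ext1
    refine Polynomial.ringHom_ext (fun c => ?_) ?_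
    · change Polynomial.aeval (R := ℂ) _ (C c) =
        (AddMonoidAlgebra.domCongr ℂ ℂ E).symm (Polynomial.aeval (R := ℂ) _ (C c))
      rw [Polynomial.aeval_C, Polynomial.aeval_C, AlgEquiv.commutes]
    · change Polynomial.aeval (R := ℂ) _ X =
        (AddMonoidAlgebra.domCongr ℂ ℂ E).symm (Polynomial.aeval (R := ℂ) _ X)
      rw [Polynomial.aeval_X, Polynomial.aeval_X, AddMonoidAlgebra.domCongr_symm,
        AddMonoidAlgebra.domCongr_single, AddEquiv.symm_apply_apply]

end Parameter

/-! ### Base change of projective spectra of monoid algebras -/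

noncomputable section MonoidBaseChange

open AddMonoidAlgebra hiding coeff

/-- The base change of a morphism of affine schemes to a basic open subset of the target. -/
theorem isPullback_SpecMap_of_isLocalizationAway {A B A' B' : Type} [CommRing A] [CommRing B]
    [CommRing A'] [CommRing B'] [Algebra A A'] [Algebra B B'] (f : A →+* B) (g : A' →+* B') (r : A)
    [IsLocalization.Away r A'] [IsLocalization.Away (f r) B']
    (h : g.comp (algebraMap A A') = (algebraMap B B').comp f) :
    IsPullback (Spec.map (CommRingCat.ofHom (algebraMap B B'))) (Spec.map (CommRingCat.ofHom g))
      (Spec.map (CommRingCat.ofHom f)) (Spec.map (CommRingCat.ofHom (algebraMap A A'))) := by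
  have h1 := IsOpenImmersion.of_isLocalization (S := A') r
  have h2 := IsOpenImmersion.of_isLocalization (S := B') (f r)
  refine (IsOpenImmersion.isPullback _ _ _ _ ?_ ?_).flip
  · rw [← Spec.map_comp, ← Spec.map_comp, ← CommRingCat.ofHom_comp, ← CommRingCat.ofHom_comp, h]
  · have h3 : (Spec.map (CommRingCat.ofHom (algebraMap A A'))).opensRange =
        PrimeSpectrum.basicOpen r :=
      TopologicalSpace.Opens.ext (PrimeSpectrum.localization_away_comap_range A' r)
    have h4 : (Spec.map (CommRingCat.ofHom (algebraMap B B'))).opensRange =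
        PrimeSpectrum.basicOpen (f r) :=
      TopologicalSpace.Opens.ext (PrimeSpectrum.localization_away_comap_range B' (f r))
    rw [h3, h4]
    rfl

/-- The monoid algebra of a product of monoids is the tensor product of the monoid algebras. -/
theorem isPushout_mapDomainRingHom {S T U : Type} [AddCommMonoid S] [AddCommMonoid T]
    [AddCommMonoid U] (i : S →+ U) (j : T →+ U) (e : U →+ S × T) (hei : ∀ s, e (i s) = (s, 0))
    (hej : ∀ t, e (j t) = (0, t)) (he : ∀ u, i (e u).1 + j (e u).2 = u) :
    IsPushout (CommRingCat.ofHom (algebraMap ℂ (AddMonoidAlgebra ℂ S)))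
      (CommRingCat.ofHom (algebraMap ℂ (AddMonoidAlgebra ℂ T)))
      (CommRingCat.ofHom (mapDomainRingHom ℂ i)) (CommRingCat.ofHom (mapDomainRingHom ℂ j)) := by
  have hi : ∀ s (c : ℂ), mapDomainRingHom ℂ i (single s c) = single (i s) c := fun s c => by
    rw [mapDomainRingHom_apply, mapDomain_single]
  have hj : ∀ s (c : ℂ), mapDomainRingHom ℂ j (single s c) = single (j s) c := fun s c => by
    rw [mapDomainRingHom_apply, mapDomain_single]
  have hS : ∀ c : ℂ, algebraMap ℂ (AddMonoidAlgebra ℂ S) c = single 0 c := fun _ => rfl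
  have hT : ∀ c : ℂ, algebraMap ℂ (AddMonoidAlgebra ℂ T) c = single 0 c := fun _ => rfl
  have w : CommSq (CommRingCat.ofHom (algebraMap ℂ (AddMonoidAlgebra ℂ S)))
      (CommRingCat.ofHom (algebraMap ℂ (AddMonoidAlgebra ℂ T)))
      (CommRingCat.ofHom (mapDomainRingHom ℂ i)) (CommRingCat.ofHom (mapDomainRingHom ℂ j)) := by
    refine ⟨CommRingCat.hom_ext (RingHom.ext fun c => ?_)⟩
    change mapDomainRingHom ℂ i (algebraMap ℂ _ c) = mapDomainRingHom ℂ j (algebraMap ℂ _ c)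
    rw [hS, hT, hi, hj, map_zero, map_zero]
  have hpair : ∀ (R : Type) [CommRing R] (a : AddMonoidAlgebra ℂ S →+* R)
      (b : AddMonoidAlgebra ℂ T →+* R), (∀ c : ℂ, a (single 0 c) = b (single 0 c)) →
      ∃ f : AddMonoidAlgebra ℂ U →+* R, (∀ s c, f (single (i s) c) = a (single s c)) ∧
        ∀ t c, f (single (j t) c) = b (single t c) := by
    intro R _ a b hab
    -- on characters the induced homomorphism is the product of `a` and `b`
    let g : Multiplicative U →* R :=
      { toFun := fun u => a (single (e u.toAdd).1 1) * b (single (e u.toAdd).2 1)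
        map_one' := by
          rw [toAdd_one, map_zero]
          change a 1 * b 1 = 1
          rw [map_one, map_one, one_mul]
        map_mul' := fun u v => by
          have h1 : ∀ x y : S, single (x + y) 1 = (single x 1 * single y 1 : AddMonoidAlgebra ℂ S) :=
            fun x y => by rw [single_mul_single, one_mul]
          have h2 : ∀ x y : T, single (x + y) 1 = (single x 1 * single y 1 : AddMonoidAlgebra ℂ T) :=
            fun x y => by rw [single_mul_single, one_mul]
          rw [toAdd_mul, map_add, Prod.fst_add, Prod.snd_add, h1, h2, map_mul, map_mul]
          ring }
    have hg : ∀ u : U, g (Multiplicative.ofAdd u) = a (single (e u).1 1) * b (single (e u).2 1) :=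
      fun _ => rfl
    let F := liftNCRingHom (a.comp (algebraMap ℂ (AddMonoidAlgebra ℂ S))) g
      fun _ _ => Commute.all _ _
    have hF : ∀ u c, F (single u c) = a (single 0 c) * g (Multiplicative.ofAdd u) := fun u c =>
      liftNCRingHom_single _ _ _ u c
    refine ⟨F, fun s c => ?_, fun t c => ?_⟩
    · rw [hF, hg, hei]
      change a (single 0 c) * (a (single s 1) * b 1) = _
      rw [map_one, mul_one, ← map_mul, single_mul_single, zero_add, mul_one]
    · rw [hF, hg, hej, hab]
      change b (single 0 c) * (a 1 * b (single t 1)) = _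
      rw [map_one, one_mul, ← map_mul, single_mul_single, zero_add, mul_one]
  refine ⟨w, ⟨PushoutCocone.isColimitAux' _ fun s => Classical.indefiniteDescription _ ?_⟩⟩
  obtain ⟨f, hf, hf'⟩ := hpair s.pt s.inl.hom s.inr.hom fun c =>
    RingHom.congr_fun (congrArg CommRingCat.Hom.hom s.condition) c
  have key : ∀ (g : AddMonoidAlgebra ℂ U →+* s.pt),
      (CommRingCat.ofHom (mapDomainRingHom ℂ i) ≫ CommRingCat.ofHom g = s.inl ↔
        ∀ x c, g (single (i x) c) = s.inl.hom (single x c)) ∧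
      (CommRingCat.ofHom (mapDomainRingHom ℂ j) ≫ CommRingCat.ofHom g = s.inr ↔
        ∀ x c, g (single (j x) c) = s.inr.hom (single x c)) := by
    refine fun g => ⟨⟨fun h x c => ?_, fun h => ?_⟩, ⟨fun h x c => ?_, fun h => ?_⟩⟩
    · rw [← hi]
      exact RingHom.congr_fun (congrArg CommRingCat.Hom.hom h) _
    · have h' : ∀ x c, g (mapDomainRingHom ℂ i (single x c)) = s.inl.hom (single x c) := fun x c => by
        rw [hi, h]
      exact CommRingCat.hom_ext (AddMonoidAlgebra.ringHom_ext (h' 0) fun x => h' x 1)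
    · rw [← hj]
      exact RingHom.congr_fun (congrArg CommRingCat.Hom.hom h) _
    · have h' : ∀ x c, g (mapDomainRingHom ℂ j (single x c)) = s.inr.hom (single x c) := fun x c => by
        rw [hj, h]
      exact CommRingCat.hom_ext (AddMonoidAlgebra.ringHom_ext (h' 0) fun x => h' x 1)
  have huniq : ∀ g : AddMonoidAlgebra ℂ U →+* s.pt,
      CommRingCat.ofHom (mapDomainRingHom ℂ i) ≫ CommRingCat.ofHom g = s.inl →
      CommRingCat.ofHom (mapDomainRingHom ℂ j) ≫ CommRingCat.ofHom g = s.inr → g = f := by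
    intro g h1 h2
    have h1' := (key g).1.1 h1
    have h2' := (key g).2.1 h2
    refine AddMonoidAlgebra.ringHom_ext (fun c => ?_) fun x => ?_
    · rw [← map_zero i, h1', hf]
    · have h3 : (single x 1 : AddMonoidAlgebra ℂ U) =
          single (i (e x).1) 1 * single (j (e x).2) 1 := by
        rw [single_mul_single, he, one_mul]
      rw [h3, map_mul, map_mul, h1', h2', hf, hf']
  exact ⟨CommRingCat.ofHom f, (key f).1.2 hf, (key f).2.2 hf',
    fun {m} h1 h2 => CommRingCat.hom_ext (huniq m.hom h1 h2)⟩

variable {H : Type} [AddCommGroup H]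

/-- The homomorphism `ℂ[T, T⁻¹] → ℂ[N]₀` given by a one parameter group of characters of degree
zero. -/
def laurentHom {N : AddSubmonoid (H × ℕ)} (v : ℤ →+ N) (hv : ∀ l, (v l).1.2 = 0) :
    LaurentPolynomial ℂ →+* monoidGrading N 0 :=
  (AddMonoidAlgebra.lift ℂ (monoidGrading N 0) ℤ
    { toFun := fun l => ⟨single (v l.toAdd) 1, hv l.toAdd ▸ single_mem_monoidGrading (v l.toAdd) 1⟩
      map_one' := Subtype.ext (by
        change (single (v 0) 1 : AddMonoidAlgebra ℂ N) = single 0 1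
        rw [map_zero])
      map_mul' := fun l l' => Subtype.ext (by
        change (single (v (l.toAdd + l'.toAdd)) 1 : AddMonoidAlgebra ℂ N) =
          single (v l.toAdd) 1 * single (v l'.toAdd) 1
        rw [single_mul_single, one_mul, map_add]) }).toRingHom

theorem coe_laurentHom_single {N : AddSubmonoid (H × ℕ)} (v : ℤ →+ N) (hv : ∀ l, (v l).1.2 = 0)
    (l : ℤ) (c : ℂ) : (laurentHom v hv (single l c) : AddMonoidAlgebra ℂ N) = single (v l) c := by
  have h : laurentHom v hv (single l c) = c •
      ⟨single (v l) 1, hv l ▸ single_mem_monoidGrading (v l) 1⟩ := lift_single _ _ _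
  rw [h]
  change c • single (v l) (1 : ℂ) = _
  rw [smul_single, smul_eq_mul, mul_one]

theorem chartStructure_laurentHom {N : AddSubmonoid (H × ℕ)} (v : ℤ →+ N) (hv : ∀ l, (v l).1.2 = 0)
    (w : H) : chartStructure (laurentHom v hv) w = mapDomainRingHom ℂ ((toChart N w).comp v) := by
  have h : ∀ l c, chartStructure (laurentHom v hv) w (single l c) =
      mapDomainRingHom ℂ ((toChart N w).comp v) (single l c) := by
    intro l c
    rw [chartStructure_apply, coe_laurentHom_single, dehomogenize_single, mapDomainRingHom_apply,
      mapDomain_single]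
    rfl
  exact AddMonoidAlgebra.ringHom_ext (fun c => h 0 c) fun l => h l 1

section Invert

variable {N N' : AddSubmonoid (H × ℕ)} (hle : N ≤ N')

/-- The inclusion of the monoid algebra of a submonoid. -/
def gradedInclusion : monoidGrading N →+*ᵍ monoidGrading N' :=
  gradedMapOfHom (AddSubmonoid.inclusion hle) fun x =>
    congrArg Prod.snd (AddSubmonoid.coe_inclusion hle x)

theorem gradedInclusion_single (x : N) (c : ℂ) :
    gradedInclusion hle (single x c) = single (AddSubmonoid.inclusion hle x) c :=
  gradedMapOfHom_single _ _ x c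

theorem irrelevant_le_map_gradedInclusion {t : N} (ht : t.1.2 = 0) (v : ℤ →+ N')
    (hvt : v 1 = AddSubmonoid.inclusion hle t)
    (hex : ∀ x ∈ N', ∃ e : ℕ, x + e • t.1 ∈ N) :
    HomogeneousIdeal.irrelevant (monoidGrading N') ≤
      (HomogeneousIdeal.irrelevant (monoidGrading N)).map (gradedInclusion hle) := by
  refine irrelevant_le_map _ fun x hx => ?_
  obtain ⟨e, he⟩ := hex x x.2
  have hd : (x.1 + e • t.1).2 = x.1.2 := by
    rw [Prod.snd_add, Prod.smul_snd, ht, smul_zero, add_zero]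
  refine ⟨x.1.2, hx, single ⟨_, he⟩ 1, ?_, single (v (-(e : ℤ))) 1, ?_⟩
  · rw [← hd]
    exact single_mem_monoidGrading ⟨_, he⟩ 1
  · rw [gradedInclusion_single, single_mul_single, one_mul]
    congr 1
    have h1 : v e + v (-(e : ℤ)) = 0 := by rw [← map_add, add_neg_cancel, map_zero]
    have h2 : v e = e • AddSubmonoid.inclusion hle t := by
      rw [← hvt, ← map_nsmul, nsmul_eq_mul, mul_one]
    have h3 : AddSubmonoid.inclusion hle ⟨_, he⟩ = x + v e := by
      rw [h2]
      rfl
    rw [h3, add_assoc, h1, add_zero]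

/-- Inverting a character of degree zero is the base change to the punctured line. -/
theorem isPullback_invert (hN : IsCoveredInDegreeOne N) {t : N} (ht : t.1.2 = 0) (v : ℤ →+ N')
    (hv : ∀ l, (v l).1.2 = 0) (hvt : v 1 = AddSubmonoid.inclusion hle t)
    (hex : ∀ x ∈ N', ∃ e : ℕ, x + e • t.1 ∈ N) :
    IsPullback (Proj.map (gradedInclusion hle) (irrelevant_le_map_gradedInclusion hle ht v hvt hex))
      (structureMap N' (laurentHom v hv)) (structureMap N (paramHom ht)) puncturedLineι := by
  refine isPullback_projMap_of_charts _ hN _ fun w hw => ?_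
  have hle' : chartMonoid N w ≤ chartMonoid N' w := AddSubmonoid.monotone_map hle
  refine ⟨w, hle hw, mapDomainRingHom ℂ (AddSubmonoid.inclusion hle'), ⟨?_, ?_⟩, ?_⟩
  · rw [gradedInclusion_single]
    rfl
  · intro a
    have h : (mapDomainRingHom ℂ (AddSubmonoid.inclusion hle')).comp (dehomogenize N w) =
        (dehomogenize N' w).comp (gradedInclusion hle : _ →+* _) := by
      have h' : ∀ x c, mapDomainRingHom ℂ (AddSubmonoid.inclusion hle') (dehomogenize N w (single x c))
          = dehomogenize N' w (gradedInclusion hle (single x c)) := fun x c => by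
        rw [gradedInclusion_single, dehomogenize_single, dehomogenize_single,
          mapDomainRingHom_apply, mapDomain_single]
        rfl
      exact AddMonoidAlgebra.ringHom_ext (h' 0) fun x => h' x 1
    exact RingHom.congr_fun h a
  · let := (mapDomainRingHom ℂ (AddSubmonoid.inclusion hle')).toAlgebra
    have h1 : toChart N' w (v 1) = AddSubmonoid.inclusion hle' (toChart N w t) := by
      rw [hvt]
      rfl
    have h2 : IsLocalization.Away (single (toChart N w t) 1 : AddMonoidAlgebra ℂ (chartMonoid N w))
        (AddMonoidAlgebra ℂ (chartMonoid N' w)) := by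
      refine isLocalizationAway_single (AddSubmonoid.inclusion hle')
        (AddSubmonoid.inclusion_injective hle') (toChart N w t) (toChart N' w (v (-1))) ?_ fun x => ?_
      · rw [← h1, ← map_add, ← map_add, add_neg_cancel, map_zero, map_zero]
      · obtain ⟨x, rfl⟩ := toChart_surjective w x
        obtain ⟨e, he⟩ := hex x x.2
        refine ⟨e, toChart N w ⟨_, he⟩, ?_⟩
        rw [← h1, hvt, ← map_nsmul, ← map_add]
        rfl
    have h3 : chartStructure (paramHom ht) w X = single (toChart N w t) 1 := by
      rw [chartStructure_paramHom]
      exact Polynomial.aeval_X _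
    rw [← h3] at h2
    refine isPullback_SpecMap_of_isLocalizationAway (chartStructure (paramHom ht) w)
      (chartStructure (laurentHom v hv) w) X ?_
    refine Polynomial.ringHom_ext (fun c => ?_) ?_
    · rw [RingHom.comp_apply, RingHom.comp_apply, LaurentPolynomial.algebraMap_eq_toLaurent,
        Polynomial.toLaurent_C, chartStructure_laurentHom, chartStructure_paramHom]
      change mapDomainRingHom ℂ _ (single 0 c) =
        mapDomainRingHom ℂ _ (Polynomial.aeval (R := ℂ) _ (C c))
      rw [Polynomial.aeval_C]
      change _ = mapDomainRingHom ℂ _ (single 0 c)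
      rw [mapDomainRingHom_apply, mapDomain_single, mapDomainRingHom_apply, mapDomain_single,
        map_zero, map_zero]
    · rw [RingHom.comp_apply, RingHom.comp_apply, LaurentPolynomial.algebraMap_eq_toLaurent,
        Polynomial.toLaurent_X, chartStructure_laurentHom, h3]
      change mapDomainRingHom ℂ _ (single 1 1) = mapDomainRingHom ℂ _ (single _ 1)
      rw [mapDomainRingHom_apply, mapDomain_single, mapDomainRingHom_apply, mapDomain_single, ← h1]
      rfl

end Invert

end MonoidBaseChange

/-! ### The family over the affine line -/

noncomputable section Family

open AddMonoidAlgebra hiding coeff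

variable {n : ℕ}

namespace LatticePolytope

variable (P : LatticePolytope n)

/-- The embedding `(m, k) ↦ ((m, 0), k)`. -/
def zeroSection : P.coneMonoid →+ P.productMonoid where
  toFun x := ⟨((x.1.1, 0), x.1.2), x.2⟩
  map_zero' := rfl
  map_add' _ _ := rfl

/-- The exponents of the powers of the coordinate of the punctured line. -/
def verticalHom : ℤ →+ P.productMonoid where
  toFun l := ⟨((0, l), 0), zero_mem P.coneMonoid⟩
  map_zero' := rfl
  map_add' l l' := Subtype.ext (by
    change (((0 : Fin n → ℤ), l + l'), 0) = (((0 + 0 : Fin n → ℤ), l + l'), 0 + 0)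
    rw [add_zero])

theorem zeroSection_add_verticalHom (x : P.productMonoid) :
    x = P.zeroSection ⟨(x.1.1.1, x.1.2), x.2⟩ + P.verticalHom x.1.1.2 := by
  refine Subtype.ext (Prod.ext (Prod.ext ?_ ?_) ?_)
  · exact (add_zero _).symm
  · exact (zero_add _).symm
  · exact (add_zero _).symm

/-- The inclusion of the polytope algebra of `P` in the algebra of the product family. -/
def gradedZeroSection : monoidGrading P.coneMonoid →+*ᵍ monoidGrading P.productMonoid :=
  gradedMapOfHom P.zeroSection fun _ => rfl

theorem gradedZeroSection_single (x : P.coneMonoid) (c : ℂ) :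
    P.gradedZeroSection (single x c) = single (P.zeroSection x) c :=
  gradedMapOfHom_single _ _ x c

theorem irrelevant_le_map_gradedZeroSection :
    HomogeneousIdeal.irrelevant (monoidGrading P.productMonoid) ≤
      (HomogeneousIdeal.irrelevant (monoidGrading P.coneMonoid)).map P.gradedZeroSection := by
  refine irrelevant_le_map _ fun x hx => ⟨x.1.2, hx, single ⟨(x.1.1.1, x.1.2), x.2⟩ 1,
    single_mem_monoidGrading (N := P.coneMonoid) ⟨(x.1.1.1, x.1.2), x.2⟩ 1,
    single (P.verticalHom x.1.1.2) 1, ?_⟩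
  rw [gradedZeroSection_single, single_mul_single, one_mul, ← zeroSection_add_verticalHom]

/-- The projection of the product of a toric variety with the punctured line. -/
def productProj : Proj (monoidGrading P.productMonoid) ⟶ P.toricVariety :=
  Proj.map P.gradedZeroSection P.irrelevant_le_map_gradedZeroSection

theorem degree_verticalHom (l : ℤ) : (P.verticalHom l).1.2 = 0 := rfl

/-- The product of a toric variety with the punctured line as a projective spectrum. -/
theorem isPullback_product :
    IsPullback P.productProj
      (structureMap P.productMonoid (laurentHom P.verticalHom P.degree_verticalHom))
      P.toricStructure (Spec.map (CommRingCat.ofHom (algebraMap ℂ (LaurentPolynomial ℂ)))) := by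
  change IsPullback (Proj.map P.gradedZeroSection P.irrelevant_le_map_gradedZeroSection) _
    (structureMap P.coneMonoid (algebraMap ℂ (monoidGrading P.coneMonoid 0))) _
  refine isPullback_projMap_of_charts _ P.isCoveredInDegreeOne_coneMonoid _ fun w hw => ?_
  -- the chart monoid of the product is the product of the chart monoid and `ℤ`
  let i : chartMonoid P.coneMonoid w →+ chartMonoid P.productMonoid (w, 0) :=
    { toFun := fun x => ⟨(x.1, 0), by
        obtain ⟨y, hy, hyx⟩ := x.2
        refine ⟨((y.1, 0), y.2), hy, Prod.ext hyx ?_⟩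
        change 0 - y.2 • (0 : ℤ) = 0
        rw [smul_zero, sub_zero]⟩
      map_zero' := rfl
      map_add' := fun x y => Subtype.ext (Prod.ext rfl (add_zero (0 : ℤ)).symm) }
  have hi : ∀ x, i (toChart P.coneMonoid w x) = toChart P.productMonoid (w, 0) (P.zeroSection x) := by
    refine fun x => Subtype.ext (Prod.ext rfl ?_)
    change 0 = 0 - x.1.2 • (0 : ℤ)
    rw [smul_zero, sub_zero]
  let e : chartMonoid P.productMonoid (w, 0) →+ chartMonoid P.coneMonoid w × ℤ :=
    { toFun := fun x => (⟨x.1.1, by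
        obtain ⟨y, hy, hyx⟩ := x.2
        exact ⟨(y.1.1, y.2), hy, congrArg Prod.fst hyx⟩⟩, x.1.2)
      map_zero' := rfl
      map_add' := fun _ _ => rfl }
  have hei : ∀ x, e (i x) = (x, 0) := fun _ => rfl
  have hej : ∀ l, e (toChart P.productMonoid (w, 0) (P.verticalHom l)) = (0, l) := by
    refine fun l => Prod.ext (Subtype.ext ?_) ?_
    · change (0 : Fin n → ℤ) - 0 • w = 0
      rw [zero_smul, sub_zero]
    · change l - 0 • (0 : ℤ) = l
      rw [zero_smul, sub_zero]
  have he_inj : Function.Injective e := by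
    intro x y hxy
    have h1 : x.1.1 = y.1.1 := congrArg (fun z : chartMonoid P.coneMonoid w × ℤ => z.1.1) hxy
    have h2 : x.1.2 = y.1.2 := congrArg (fun z : chartMonoid P.coneMonoid w × ℤ => z.2) hxy
    exact Subtype.ext (Prod.ext h1 h2)
  refine ⟨(w, 0), hw, mapDomainRingHom ℂ i, ⟨?_, ?_⟩, ?_⟩
  · rw [gradedZeroSection_single]
    rfl
  · intro a
    have h : (mapDomainRingHom ℂ i).comp (dehomogenize P.coneMonoid w) =
        (dehomogenize P.productMonoid (w, 0)).comp (P.gradedZeroSection : _ →+* _) := by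
      have h' : ∀ x c, mapDomainRingHom ℂ i (dehomogenize P.coneMonoid w (single x c))
          = dehomogenize P.productMonoid (w, 0) (P.gradedZeroSection (single x c)) := fun x c => by
        rw [gradedZeroSection_single, dehomogenize_single, dehomogenize_single,
          mapDomainRingHom_apply, mapDomain_single, hi]
      exact AddMonoidAlgebra.ringHom_ext (h' 0) fun x => h' x 1
    exact RingHom.congr_fun h a
  · have h1 : chartStructure (algebraMap ℂ (monoidGrading P.coneMonoid 0)) w =
        algebraMap ℂ (AddMonoidAlgebra ℂ (chartMonoid P.coneMonoid w)) := by
      refine RingHom.ext fun c => ?_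
      rw [chartStructure_apply]
      change dehomogenize P.coneMonoid w (single 0 c) = single 0 c
      rw [dehomogenize_single, map_zero]
    rw [h1, chartStructure_laurentHom]
    refine isPullback_SpecMap_of_isPushout _ _ _ _ (isPushout_mapDomainRingHom i _ e hei hej ?_)
    intro x
    apply he_inj
    rw [map_add, hei]
    exact (congrArg _ (hej _)).trans (Prod.ext (add_zero _) (zero_add _))

theorem exists_mem_carrier : ∃ v, latticeToReal v ∈ P.carrier := by
  obtain ⟨V, ⟨v, hv⟩, hV⟩ := P.exists_points
  exact ⟨v, hV ▸ subset_convexHull _ _ ⟨v, hv, rfl⟩⟩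

theorem isIntegral_toricVariety : IsIntegral P.toricVariety := by
  obtain ⟨w, hw⟩ := P.exists_mem_carrier
  exact isIntegral_proj P.isCoveredInDegreeOne_coneMonoid (P.mem_coneMonoid_one.2 hw)

end LatticePolytope

theorem puncturedLineι_comp_complexLineStructure : puncturedLineι ≫ complexLineStructure =
    Spec.map (CommRingCat.ofHom (algebraMap ℂ (LaurentPolynomial ℂ))) := by
  rw [puncturedLineι, complexLineStructure, ← Spec.map_comp, ← CommRingCat.ofHom_comp]
  congr 2
  refine RingHom.ext fun c => ?_
  change algebraMap ℂ[X] (LaurentPolynomial ℂ) (C c) = _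
  rw [LaurentPolynomial.algebraMap_eq_toLaurent, Polynomial.toLaurent_C]
  rfl

variable {P : LatticePolytope n} {ι : Type*} {Γ : SimplicialPartition P ι}

namespace SimplicialPartition.Potential

variable (pot : Γ.Potential)

theorem degree_vertical : pot.vertical.1.2 = 0 := rfl

/-- The total space of the degeneration. -/
abbrev totalSpace : Scheme := Proj (monoidGrading pot.totalMonoid)

/-- The degeneration given by a potential. -/
def family : pot.totalSpace ⟶ complexLine :=
  structureMap pot.totalMonoid (paramHom pot.degree_vertical)

theorem exists_degree_one_mem : ∃ w, (w, 1) ∈ pot.totalMonoid := by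
  obtain ⟨v, hv⟩ := P.exists_mem_carrier
  obtain ⟨j, hj⟩ := Γ.exists_mem_coneMonoid (P.mem_coneMonoid_one.2 hv)
  exact ⟨(v, pot.height j (v, 1)), mem_totalMonoid_of_mem (j := j) hj le_rfl⟩

theorem isIntegral_totalSpace : IsIntegral pot.totalSpace := by
  obtain ⟨w, hw⟩ := pot.exists_degree_one_mem
  exact isIntegral_proj isCoveredInDegreeOne_totalMonoid hw

/-- The elements of degree zero are the multiples of the vertical vector, since `P` is bounded. -/
theorem isProper_family [Finite ι] : IsProper pot.family := by
  have : AddMonoid.FG pot.totalMonoid := (AddMonoid.fg_iff_addSubmonoid_fg _).2 fg_totalMonoid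
  refine isProper_structureMap_paramHom _ fun x hx => ?_
  have h0 : (x.1.1.1, x.1.2) = 0 := P.eq_zero_of_mem_coneMonoid x.2.1 hx
  obtain ⟨j⟩ := Γ.nonempty_index
  have h1 : 0 ≤ x.1.1.2 := by
    have h2 : pot.height j (x.1.1.1, x.1.2) ≤ x.1.1.2 := x.2.2 j
    rwa [h0, map_zero] at h2
  refine ⟨x.1.1.2.toNat, Subtype.ext ?_⟩
  rw [AddSubmonoidClass.coe_nsmul]
  change _ = x.1.1.2.toNat • (((0 : Fin n → ℤ), (1 : ℤ)), 0)
  refine Prod.ext (Prod.ext ?_ ?_) ?_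
  · simpa using congrArg Prod.fst h0
  · simp [h1]
  · simpa using hx

theorem flat_family : Flat pot.family := by
  refine flat_structureMap_paramHom _ isCoveredInDegreeOne_totalMonoid fun e e' h => ?_
  have h1 : e • (1 : ℤ) = e' • (1 : ℤ) := congrArg Prod.snd h
  simpa using h1

theorem exists_isToroidalAt_family [Finite ι] (hP : (interior P.carrier).Nonempty) :
    ∃ U : pot.totalSpace.Opens, ∀ y, IsToroidalAt pot.family U y := by
  have : AddMonoid.FG pot.totalMonoid := (AddMonoid.fg_iff_addSubmonoid_fg _).2 fg_totalMonoid
  obtain ⟨u, hu⟩ := exists_forall_exists_nsmul_eq_add (S := pot.totalMonoid)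
  let κ : (Fin n → ℤ) × ℤ ≃+ (Fin (n + 1) → ℤ) :=
    AddEquiv.prodComm.trans (Fin.consLinearEquiv ℤ fun _ : Fin (n + 1) => ℤ).toAddEquiv
  exact ⟨_, fun y => isToroidalAt_structureMap_paramHom _ κ isCoveredInDegreeOne_totalMonoid
    fg_totalMonoid (exists_sub_eq hP) nsmul_mem_totalMonoid hu y⟩

theorem totalMonoid_le_productMonoid : pot.totalMonoid ≤ P.productMonoid := fun _ hx => hx.1

theorem verticalHom_one : P.verticalHom 1 =
    AddSubmonoid.inclusion pot.totalMonoid_le_productMonoid pot.vertical := rfl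

theorem exists_add_mem_totalMonoid [Finite ι] {x : ((Fin n → ℤ) × ℤ) × ℕ} (hx : x ∈ P.productMonoid) :
    ∃ e : ℕ, x + e • pot.vertical.1 ∈ pot.totalMonoid := by
  obtain ⟨j, hj⟩ := Γ.exists_mem_coneMonoid hx
  have h1 : forgetHeight (x + (pot.height j (x.1.1, x.2) - x.1.2).toNat • pot.vertical.1) =
      forgetHeight x := by
    have h2 : forgetHeight pot.vertical.1 = 0 := rfl
    rw [map_add, map_nsmul, h2, smul_zero, add_zero]
  -- adding multiples of the vertical vector raises the point above the graph
  refine ⟨(pot.height j (x.1.1, x.2) - x.1.2).toNat, mem_totalMonoid_of_mem (j := j) ?_ ?_⟩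
  · change forgetHeight _ ∈ _
    rw [h1]
    exact hj
  · refine (congrArg (pot.height j) h1).le.trans ?_
    change pot.height j (x.1.1, x.2) ≤
      x.1.2 + (pot.height j (x.1.1, x.2) - x.1.2).toNat • (1 : ℤ)
    rw [nsmul_eq_mul, mul_one]
    have := Int.self_le_toNat (pot.height j (x.1.1, x.2) - x.1.2)
    omega

/-- The restriction of the family to the punctured line as a projective spectrum. -/
theorem isPullback_family [Finite ι] :
    IsPullback (Proj.map (gradedInclusion pot.totalMonoid_le_productMonoid)
        (irrelevant_le_map_gradedInclusion pot.totalMonoid_le_productMonoid pot.degree_vertical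
          P.verticalHom pot.verticalHom_one fun _ hx => pot.exists_add_mem_totalMonoid hx))
      (structureMap P.productMonoid (laurentHom P.verticalHom P.degree_verticalHom))
      pot.family puncturedLineι :=
  isPullback_invert pot.totalMonoid_le_productMonoid isCoveredInDegreeOne_totalMonoid
    pot.degree_vertical P.verticalHom P.degree_verticalHom pot.verticalHom_one
    fun _ hx => pot.exists_add_mem_totalMonoid hx

/-- Outside the central fiber the family is the projection of a product. -/
theorem exists_punctured_iso [Finite ι] :
    ∃ e : pullback pot.family puncturedLineι ≅
        pullback P.toricStructure (puncturedLineι ≫ complexLineStructure),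
      e.hom ≫ pullback.snd P.toricStructure (puncturedLineι ≫ complexLineStructure) =
        pullback.snd pot.family puncturedLineι := by
  have h1 := pot.isPullback_family
  have h2 := P.isPullback_product
  rw [← puncturedLineι_comp_complexLineStructure] at h2
  refine ⟨h1.isoPullback.symm ≪≫ h2.isoPullback, ?_⟩
  rw [Iso.trans_hom, Iso.symm_hom, Category.assoc, h2.isoPullback_hom_snd, h1.isoPullback_inv_snd]

/-- The fibers outside the central fiber are isomorphic to the toric variety of `P`. -/
theorem isReduced_fiberOver_of_ne_zero [Finite ι] {a : ℂ} (ha : a ≠ 0) :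
    IsReduced (fiberOver pot.family a) := by
  -- the point `a` lies on the punctured line
  let q : LaurentPolynomial ℂ →+* ℂ :=
    IsLocalization.Away.lift (X : ℂ[X]) (g := Polynomial.evalRingHom a) (by simpa using ha)
  have hq : q.comp (algebraMap ℂ[X] (LaurentPolynomial ℂ)) = Polynomial.evalRingHom a :=
    IsLocalization.lift_comp _
  have h1 : Spec.map (CommRingCat.ofHom q) ≫ puncturedLineι = complexLinePoint a := by
    rw [puncturedLineι, complexLinePoint, ← Spec.map_comp, ← CommRingCat.ofHom_comp, hq]
  have h2 : complexLinePoint a ≫ complexLineStructure = 𝟙 _ := by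
    rw [complexLinePoint, complexLineStructure, ← Spec.map_comp, ← CommRingCat.ofHom_comp,
      ← Spec.map_id]
    congr 1
    ext c
    exact Polynomial.eval_C
  have h3 := (IsPullback.of_hasPullback (structureMap P.productMonoid
    (laurentHom P.verticalHom P.degree_verticalHom)) (Spec.map (CommRingCat.ofHom q)))
  have h4 := h3.paste_horiz pot.isPullback_family
  have h5 := h3.paste_horiz P.isPullback_product
  rw [h1] at h4
  rw [← puncturedLineι_comp_complexLineStructure, ← Category.assoc, h1, h2] at h5
  have h6 := h5.isIso_fst_of_isIso
  have h7 : IsIntegral P.toricVariety := P.isIntegral_toricVariety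
  have h8 := isReduced_of_isOpenImmersion (pullback.fst (structureMap P.productMonoid
    (laurentHom P.verticalHom P.degree_verticalHom)) (Spec.map (CommRingCat.ofHom q)) ≫
      P.productProj)
  have h9 : IsReduced (pullback pot.family (complexLinePoint a)) :=
    isReduced_of_isOpenImmersion h4.isoPullback.inv
  exact h9

end SimplicialPartition.Potential

end Family

/-! ### Closed subschemes -/

noncomputable section ClosedSubschemes

open AddMonoidAlgebra hiding coeff

/-- The components of a space which is the union of finitely many closed irreducible subsets that
are not contained in each other are these subsets. -/
theorem exists_equiv_irreducibleComponents {Z ι : Type*} [TopologicalSpace Z] [Finite ι] (C : ι → Set Z)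
    (hcl : ∀ j, IsClosed (C j)) (hirr : ∀ j, IsIrreducible (C j)) (hcov : ∀ z, ∃ j, z ∈ C j)
    (hsub : ∀ j k, C j ⊆ C k → j = k) :
    ∃ e : ι ≃ irreducibleComponents Z, ∀ j, (e j : Set Z) = C j := by
  have key : ∀ D : Set Z, IsIrreducible D → ∃ j, D ⊆ C j := by
    intro D hD
    obtain ⟨_, hz, h⟩ := isIrreducible_iff_sUnion_isClosed.1 hD (Set.finite_range C).toFinset
      (fun z hz => by
        obtain ⟨j, rfl⟩ := (Set.Finite.mem_toFinset _).1 hz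
        exact hcl j)
      fun z _ => by
        obtain ⟨j, hj⟩ := hcov z
        exact ⟨C j, (Set.Finite.mem_toFinset _).2 ⟨j, rfl⟩, hj⟩
    obtain ⟨j, rfl⟩ := (Set.Finite.mem_toFinset _).1 hz
    exact ⟨j, h⟩
  have hmem : ∀ j, C j ∈ irreducibleComponents Z := by
    refine fun j => ⟨hirr j, fun D hD hjD => ?_⟩
    obtain ⟨k, hk⟩ := key D hD
    obtain rfl := hsub j k (hjD.trans hk)
    exact hk
  refine ⟨Equiv.ofBijective (fun j => ⟨C j, hmem j⟩) ⟨fun j k h => ?_, fun D => ?_⟩, fun _ => rfl⟩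
  · exact hsub j k (congrArg Subtype.val h).le
  · obtain ⟨j, hj⟩ := key D.1 D.2.1
    exact ⟨j, Subtype.ext ((hj.antisymm (D.2.2 (hirr j) hj))).symm⟩

theorem ker_eq_vanishingIdeal {X Z : Scheme} (i : X ⟶ Z) [IsClosedImmersion i] [IsReduced X]
    (C : TopologicalSpace.Closeds Z) (hC : (C : Set Z) = Set.range i) :
    i.ker = Scheme.IdealSheafData.vanishingIdeal C := by
  have h1 : C = i.ker.support := by
    apply SetLike.coe_injective
    rw [Scheme.Hom.support_ker, hC, i.isClosedEmbedding.isClosed_range.closure_eq]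
  rw [h1, Scheme.IdealSheafData.vanishingIdeal_support]
  refine le_antisymm (Scheme.IdealSheafData.le_radical _) fun U => ?_
  rw [Scheme.IdealSheafData.radical_ideal, Scheme.Hom.ker_apply]
  rintro x ⟨k, hk⟩
  rw [RingHom.mem_ker, map_pow] at hk
  exact RingHom.mem_ker.2 (eq_zero_of_pow_eq_zero hk)

/-- A reduced closed subscheme whose underlying set is an irreducible component is the component
with its reduced structure. -/
theorem exists_iso_reducedComponent {X Z : Scheme} (i : X ⟶ Z) [IsClosedImmersion i] [IsReduced X]
    (C : irreducibleComponents Z) (hC : (C : Set Z) = Set.range i) :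
    ∃ f : X ≅ reducedComponent C, f.hom ≫ reducedComponentι C = i := by
  have h1 := ker_eq_vanishingIdeal i
    ⟨C.1, isClosed_of_mem_irreducibleComponents C.1 C.2⟩ hC
  have h2 : IsClosedImmersion (reducedComponentι C) := by
    exact inferInstanceAs (IsClosedImmersion (Scheme.IdealSheafData.subschemeι _))
  have h3 : (reducedComponentι C).ker = i.ker := by
    rw [h1]
    exact Scheme.IdealSheafData.ker_subschemeι _
  have h4 := IsClosedImmersion.isIso_lift _ _ h3
  exact ⟨asIso (IsClosedImmersion.lift _ _ h3.le), IsClosedImmersion.lift_fac _ _ _⟩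

/-- Dividing by the variable is the base change to the origin of the affine line. -/
theorem isPushout_quotient {R : Type} [CommRing R] (ψ : ℂ[X] →+* R) :
    IsPushout (CommRingCat.ofHom ψ) (CommRingCat.ofHom (Polynomial.evalRingHom (0 : ℂ)))
      (CommRingCat.ofHom (Ideal.Quotient.mk (Ideal.span {ψ X})))
      (CommRingCat.ofHom (((Ideal.Quotient.mk (Ideal.span {ψ X})).comp ψ).comp Polynomial.C)) := by
  have w : CommSq (CommRingCat.ofHom ψ) (CommRingCat.ofHom (Polynomial.evalRingHom (0 : ℂ)))
      (CommRingCat.ofHom (Ideal.Quotient.mk (Ideal.span {ψ X})))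
      (CommRingCat.ofHom (((Ideal.Quotient.mk (Ideal.span {ψ X})).comp ψ).comp Polynomial.C)) := by
    refine ⟨CommRingCat.hom_ext (Polynomial.ringHom_ext (fun c => ?_) ?_)⟩
    · change Ideal.Quotient.mk _ (ψ (C c)) = Ideal.Quotient.mk _ (ψ (C ((C c).eval 0)))
      rw [Polynomial.eval_C]
    · change Ideal.Quotient.mk _ (ψ X) = Ideal.Quotient.mk _ (ψ (C ((X : ℂ[X]).eval 0)))
      rw [Polynomial.eval_X, map_zero, map_zero, map_zero, Ideal.Quotient.eq_zero_iff_mem]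
      exact Ideal.mem_span_singleton_self _
  refine ⟨w, ⟨PushoutCocone.isColimitAux' _ fun s => ?_⟩⟩
  have hs : ∀ f, s.inl.hom (ψ f) = s.inr.hom (f.eval 0) := fun f =>
    RingHom.congr_fun (congrArg CommRingCat.Hom.hom s.condition) f
  have h0 : ∀ a ∈ Ideal.span {ψ X}, s.inl.hom a = 0 := by
    intro a ha
    obtain ⟨b, rfl⟩ := Ideal.mem_span_singleton'.1 ha
    rw [map_mul, hs, Polynomial.eval_X, map_zero, mul_zero]
  refine ⟨CommRingCat.ofHom (Ideal.Quotient.lift _ s.inl.hom h0), ?_, ?_, fun {m} h1 _ => ?_⟩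
  · exact CommRingCat.hom_ext (RingHom.ext fun a =>
      Ideal.Quotient.lift_mk (Ideal.span {ψ X}) s.inl.hom h0)
  · refine CommRingCat.hom_ext (RingHom.ext fun c => ?_)
    change Ideal.Quotient.lift _ s.inl.hom h0 (Ideal.Quotient.mk _ (ψ (C c))) = _
    rw [Ideal.Quotient.lift_mk, hs, Polynomial.eval_C]
  · refine CommRingCat.hom_ext (Ideal.Quotient.ringHom_ext (RingHom.ext fun a => ?_))
    change _ = Ideal.Quotient.lift _ s.inl.hom h0 (Ideal.Quotient.mk _ a)
    rw [Ideal.Quotient.lift_mk]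
    exact RingHom.congr_fun (congrArg CommRingCat.Hom.hom h1) a

variable {H : Type} [AddCommGroup H] {N : AddSubmonoid (H × ℕ)}

theorem exists_homogeneous_dehomogenize_eq {w : H} (hw : (w, 1) ∈ N)
    (a : AddMonoidAlgebra ℂ (chartMonoid N w)) :
    ∃ d, ∃ b ∈ monoidGrading N d, dehomogenize N w b = a := by
  obtain ⟨x, rfl⟩ := (awayToChart_bijective hw).2 a
  obtain ⟨k, b, hb, rfl⟩ := HomogeneousLocalization.Away.mk_surjective _ (degreeOneChar_mem hw) x
  exact ⟨_, b, hb, (awayToChart_mk hw k b hb).symm⟩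

/-- If a character of degree zero generates a radical ideal, then it does so in the charts. -/
theorem isRadical_span_toChart {t : N} (ht : t.1.2 = 0)
    (hrad : (Ideal.span {(single t 1 : AddMonoidAlgebra ℂ N)}).IsRadical) {w : H} (hw : (w, 1) ∈ N) :
    (Ideal.span {(single (toChart N w t) 1 : AddMonoidAlgebra ℂ (chartMonoid N w))}).IsRadical := by
  rintro a ⟨k, hk⟩
  obtain ⟨c, hc⟩ := Ideal.mem_span_singleton'.1 hk
  obtain ⟨d, b, hb, rfl⟩ := exists_homogeneous_dehomogenize_eq hw a
  obtain ⟨d', c, hc', rfl⟩ := exists_homogeneous_dehomogenize_eq hw c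
  let s := degreeOneChar hw
  have hs : ∀ e, s ^ e ∈ monoidGrading N e := fun e => by
    have := SetLike.pow_mem_graded e (degreeOneChar_mem hw)
    rwa [smul_eq_mul, mul_one] at this
  have ht' : (single t 1 : AddMonoidAlgebra ℂ N) ∈ monoidGrading N 0 :=
    ht ▸ single_mem_monoidGrading t 1
  -- multiplying with powers of the character of degree one makes the degrees equal
  have h1 : s ^ d' * b ^ k - s ^ (k • d) * (c * single t 1) = 0 := by
    refine eq_zero_of_dehomogenize_eq_zero (w := w) (d := k • d + d') (sub_mem ?_ ?_) ?_
    · rw [add_comm]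
      exact SetLike.mul_mem_graded (hs d') (SetLike.pow_mem_graded k hb)
    · have h2 := SetLike.mul_mem_graded (hs (k • d)) (SetLike.mul_mem_graded hc' ht')
      rwa [add_zero] at h2
    · rw [map_sub, map_mul, map_mul, map_mul, map_pow, map_pow, map_pow, dehomogenize_degreeOneChar,
        dehomogenize_single, hc, one_pow, one_pow, sub_self]
  have h2 : (s * b) ^ (k + d') ∈ Ideal.span {(single t 1 : AddMonoidAlgebra ℂ N)} := by
    rw [Ideal.mem_span_singleton']
    refine ⟨s ^ k * b ^ d' * (s ^ (k • d) * c), ?_⟩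
    calc s ^ k * b ^ d' * (s ^ (k • d) * c) * single t 1
        = s ^ k * b ^ d' * (s ^ (k • d) * (c * single t 1)) := by ring
      _ = s ^ k * b ^ d' * (s ^ d' * b ^ k) := by rw [sub_eq_zero.1 h1]
      _ = (s * b) ^ (k + d') := by ring
  obtain ⟨f, hf⟩ := Ideal.mem_span_singleton'.1 (hrad ⟨_, h2⟩)
  refine Ideal.mem_span_singleton'.2 ⟨dehomogenize N w f, ?_⟩
  rw [← dehomogenize_single, ← map_mul, hf, map_mul, dehomogenize_degreeOneChar, one_mul]

/-- The central fiber is reduced if the parameter generates a radical ideal. -/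
theorem isReduced_fiberOver_zero (hN : IsCoveredInDegreeOne N) {t : N} (ht : t.1.2 = 0)
    (hrad : (Ideal.span {(single t 1 : AddMonoidAlgebra ℂ N)}).IsRadical) :
    IsReduced (fiberOver (structureMap N (paramHom ht)) 0) := by
  suffices h : ∀ (w : H) (hw : (w, 1) ∈ N),
      IsReduced (pullback (chartι hw ≫ structureMap N (paramHom ht)) (complexLinePoint 0)) by
    let 𝒰 := Scheme.Pullback.openCoverOfLeft (chartCover hN).openCover (structureMap N (paramHom ht))
      (complexLinePoint 0)
    have : ∀ i, IsReduced (𝒰.X i) := fun i => h i.1 i.2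
    exact IsReduced.of_openCover _ 𝒰
  intro w hw
  rw [chartι_structureMap]
  have h1 := isPullback_SpecMap_of_isPushout _ _ _ _
    (isPushout_quotient (chartStructure (paramHom ht) w))
  have h2 : IsReduced (Spec (CommRingCat.of (AddMonoidAlgebra ℂ (chartMonoid N w) ⧸
      Ideal.span {chartStructure (paramHom ht) w X}))) := by
    have h3 : chartStructure (paramHom ht) w X = single (toChart N w t) 1 := by
      rw [chartStructure_paramHom]
      exact Polynomial.aeval_X _
    have h4 := isRadical_span_toChart ht hrad hw
    rw [← h3, Ideal.isRadical_iff_quotient_reduced] at h4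
    infer_instance
  have h5 : IsReduced (pullback (Spec.map (CommRingCat.ofHom (chartStructure (paramHom ht) w)))
      (Spec.map (CommRingCat.ofHom (Polynomial.evalRingHom (0 : ℂ))))) :=
    isReduced_of_isOpenImmersion h1.isoPullback.inv
  exact h5

/-- The points of the central fiber are the points at which the parameter vanishes. -/
theorem range_fst_complexLinePoint_zero (hN : IsCoveredInDegreeOne N) {t : N} (ht : t.1.2 = 0) :
    Set.range (pullback.fst (structureMap N (paramHom ht)) (complexLinePoint 0)) =
      {y | y ∉ Proj.basicOpen (monoidGrading N) (single t 1)} := by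
  have hpt : Set.range (complexLinePoint 0) =
      {z | z ∉ PrimeSpectrum.basicOpen (X : ℂ[X])} := by
    have h1 : Set.range (complexLinePoint 0) =
        PrimeSpectrum.zeroLocus (RingHom.ker (Polynomial.evalRingHom (0 : ℂ))) :=
      range_comap_of_surjective _ _ fun c => ⟨C c, Polynomial.eval_C⟩
    rw [h1]
    ext z
    rw [PrimeSpectrum.mem_zeroLocus, Set.mem_ofPred_eq, PrimeSpectrum.mem_basicOpen, not_not]
    constructor
    · intro h
      exact h (Polynomial.eval_X)
    · intro h f hf
      have h2 : X ∣ f := by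
        rw [Polynomial.X_dvd_iff, Polynomial.coeff_zero_eq_eval_zero]
        exact hf
      exact Ideal.mem_of_dvd _ h2 h
  rw [Scheme.Pullback.range_fst, hpt]
  ext y
  obtain ⟨w, hw, hy⟩ := hN.exists_mem_basicOpen y
  rw [← opensRange_chartι] at hy
  obtain ⟨z, rfl⟩ := hy
  have h1 : chartι hw z ∈ Proj.basicOpen (monoidGrading N) (single t 1) ↔
      z ∈ PrimeSpectrum.basicOpen (single (toChart N w t) (1 : ℂ)) := by
    rw [← chartι_preimage_basicOpen hw t]
    rfl
  have h2 : structureMap N (paramHom ht) (chartι hw z) ∈ PrimeSpectrum.basicOpen (X : ℂ[X]) ↔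
      z ∈ PrimeSpectrum.basicOpen (single (toChart N w t) (1 : ℂ)) := by
    have h3 : structureMap N (paramHom ht) (chartι hw z) =
        Spec.map (CommRingCat.ofHom (chartStructure (paramHom ht) w)) z := by
      rw [← chartι_structureMap (paramHom ht) hw]
      rfl
    have h4 : chartStructure (paramHom ht) w X = single (toChart N w t) 1 := by
      rw [chartStructure_paramHom]
      exact Polynomial.aeval_X _
    rw [h3, ← h4]
    rfl
  exact not_congr (h2.trans h1.symm)

end ClosedSubschemes

/-! ### The central fiber -/

noncomputable section CentralFiber

open AddMonoidAlgebra hiding coeff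

theorem single_add_one {S : Type*} [AddCommMonoid S] (x y : S) :
    (single (x + y) 1 : AddMonoidAlgebra ℂ S) = single x 1 * single y 1 := by
  rw [single_mul_single, one_mul]

section Face

variable {H H' : Type} [AddCommGroup H] [AddCommGroup H'] {N : AddSubmonoid (H × ℕ)}
  {N' : AddSubmonoid (H' × ℕ)} (s : N' →+ N) (hs : Function.Injective s)
  (hface : ∀ x y, x + y ∈ Set.range s → x ∈ Set.range s) (hdeg : ∀ y, (s y).1.2 = y.1.2)

/-- The closed subscheme of `Proj ℂ[N]` which belongs to a face of `N`. -/
def faceι : Proj (monoidGrading N') ⟶ Proj (monoidGrading N) :=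
  Proj.map (gradedFaceProj s hs hface hdeg) (irrelevant_le_map_gradedFaceProj s hs hface hdeg)

instance isClosedImmersion_faceι : IsClosedImmersion (faceι s hs hface hdeg) :=
  isClosedImmersion_projMap _ _ (faceProj_surjective s hs hface)

theorem faceι_preimage_basicOpen (a : AddMonoidAlgebra ℂ N) :
    faceι s hs hface hdeg ⁻¹ᵁ Proj.basicOpen (monoidGrading N) a =
      Proj.basicOpen (monoidGrading N') (faceProj s hs hface a) := rfl

/-- The subscheme which belongs to a face consists of the points at which all characters outside the
face vanish. -/
theorem mem_range_faceι [IsDomain (AddMonoidAlgebra ℂ N')] {w : H'} (hw : (w, 1) ∈ N')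
    (y : Proj (monoidGrading N)) : y ∈ Set.range (faceι s hs hface hdeg) ↔
      ∀ x ∉ Set.range s, y ∉ Proj.basicOpen (monoidGrading N) (single x 1) := by
  constructor
  · rintro ⟨z, rfl⟩ x hx h
    have h1 : z ∈ faceι s hs hface hdeg ⁻¹ᵁ Proj.basicOpen (monoidGrading N) (single x 1) := h
    rw [faceι_preimage_basicOpen, faceProj_single_of_notMem s hs hface hx] at h1
    exact h1 (zero_mem z.asHomogeneousIdeal)
  · intro h
    have hcl : IsClosed (Set.range (faceι s hs hface hdeg)) :=
      (faceι s hs hface hdeg).isClosedEmbedding.isClosed_range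
    let ξ : ProjectiveSpectrum (monoidGrading N) := faceι s hs hface hdeg (genericPt hw)
    have hle : ξ ≤ y := by
      intro a ha
      refine mem_of_forall_single_mem fun x hx => ?_
      have h1 : faceProj s hs hface a = 0 := by
        by_contra hne
        have h2 : (genericPt hw : Proj (monoidGrading N')) ∈
            faceι s hs hface hdeg ⁻¹ᵁ Proj.basicOpen (monoidGrading N) a := by
          rw [faceι_preimage_basicOpen]
          exact hne
        exact h2 ha
      exact not_not.1 (h x (notMem_range_of_faceProj_eq_zero s hs hface h1 hx))
    exact hcl.closure_subset_iff.2 (Set.singleton_subset_iff.2 ⟨genericPt hw, rfl⟩)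
      ((ProjectiveSpectrum.le_iff_mem_closure _ _ _).1 hle)

theorem faceι_genericPt_mem_basicOpen [IsDomain (AddMonoidAlgebra ℂ N')] {w : H'}
    (hw : (w, 1) ∈ N') (x : N') : (faceι s hs hface hdeg (genericPt hw) : Proj (monoidGrading N)) ∈
      Proj.basicOpen (monoidGrading N) (single (s x) 1) := by
  have h : (genericPt hw : Proj (monoidGrading N')) ∈
      faceι s hs hface hdeg ⁻¹ᵁ Proj.basicOpen (monoidGrading N) (single (s x) 1) := by
    rw [faceι_preimage_basicOpen, faceProj_single]
    exact fun h => one_ne_zero (single_eq_zero.1 h)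
  exact h

end Face

variable {n : ℕ} {P : LatticePolytope n} {ι : Type*} {Γ : SimplicialPartition P ι}

namespace SimplicialPartition.Potential

variable (pot : Γ.Potential)

/-- The parameter generates the intersection of the kernels of the projections to the faces. -/
theorem mem_span_vertical {a : AddMonoidAlgebra ℂ pot.totalMonoid}
    (ha : ∀ j, faceProj (pot.faceHom j) (pot.faceHom_injective j) (isFace_range_faceHom j) a = 0) :
    a ∈ Ideal.span {(single pot.vertical 1 : AddMonoidAlgebra ℂ pot.totalMonoid)} := by
  refine mem_of_forall_single_mem fun x hx => ?_
  obtain ⟨y, rfl⟩ := exists_eq_vertical_add fun j =>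
    notMem_range_of_faceProj_eq_zero _ _ _ (ha j) hx
  rw [single_add_one]
  exact Ideal.mul_mem_right _ _ (Ideal.mem_span_singleton_self _)

/-- The central fiber is reduced: the ideal of the parameter is an intersection of prime ideals. -/
theorem isRadical_span_vertical :
    (Ideal.span {(single pot.vertical 1 : AddMonoidAlgebra ℂ pot.totalMonoid)}).IsRadical := by
  rintro a ⟨k, hk⟩
  refine pot.mem_span_vertical fun j => ?_
  obtain ⟨b, hb⟩ := Ideal.mem_span_singleton'.1 hk
  have h1 := congrArg (faceProj (pot.faceHom j) (pot.faceHom_injective j)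
    (isFace_range_faceHom j)) hb
  rw [map_mul, faceProj_single_of_notMem _ _ _ (vertical_notMem_range j), mul_zero, map_pow] at h1
  exact eq_zero_of_pow_eq_zero h1.symm

theorem isReduced_fiberOver [Finite ι] (a : ℂ) : IsReduced (fiberOver pot.family a) := by
  rcases eq_or_ne a 0 with rfl | ha
  · exact isReduced_fiberOver_zero isCoveredInDegreeOne_totalMonoid _ pot.isRadical_span_vertical
  · exact pot.isReduced_fiberOver_of_ne_zero ha

/-- The toric variety of the `j`-th polytope as a closed subscheme of the total space. -/
def pieceι (j : ι) : (Γ.piece j).toricVariety ⟶ pot.totalSpace :=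
  faceι (pot.faceHom j) (pot.faceHom_injective j) (isFace_range_faceHom j) fun _ => rfl

instance (j : ι) : IsClosedImmersion (pot.pieceι j) :=
  isClosedImmersion_faceι (pot.faceHom j) (pot.faceHom_injective j) (isFace_range_faceHom j) _

theorem pieceι_family (j : ι) :
    pot.pieceι j ≫ pot.family = (Γ.piece j).toricStructure ≫ complexLinePoint 0 := by
  have h1 : (Γ.piece j).toricStructure ≫ complexLinePoint 0 =
      structureMap (Γ.piece j).coneMonoid
        ((algebraMap ℂ (monoidGrading (Γ.piece j).coneMonoid 0)).comp
          (Polynomial.evalRingHom (0 : ℂ))) := by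
    rw [structureMap, CommRingCat.ofHom_comp, Spec.map_comp]
    exact Category.assoc _ _ _
  rw [h1]
  refine projMap_structureMap _ fun f => ?_
  rw [coe_paramHom]
  have h2 : (faceProj (pot.faceHom j) (pot.faceHom_injective j) (isFace_range_faceHom j)).comp
      (Polynomial.aeval (R := ℂ) (single pot.vertical (1 : ℂ))).toRingHom =
      (algebraMap ℂ (AddMonoidAlgebra ℂ (Γ.piece j).coneMonoid)).comp
        (Polynomial.evalRingHom (0 : ℂ)) := by
    refine Polynomial.ringHom_ext (fun c => ?_) ?_
    · change faceProj (pot.faceHom j) (pot.faceHom_injective j) (isFace_range_faceHom j)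
        (Polynomial.aeval (R := ℂ) _ (C c)) = algebraMap _ _ ((C c).eval 0)
      rw [Polynomial.aeval_C, Polynomial.eval_C]
      change faceProj (pot.faceHom j) (pot.faceHom_injective j) (isFace_range_faceHom j)
        (single 0 c) = single 0 c
      rw [← map_zero (pot.faceHom j), faceProj_single]
    · change faceProj (pot.faceHom j) (pot.faceHom_injective j) (isFace_range_faceHom j)
        (Polynomial.aeval (R := ℂ) _ X) = algebraMap _ _ ((X : ℂ[X]).eval 0)
      rw [Polynomial.aeval_X, Polynomial.eval_X, map_zero,
        faceProj_single_of_notMem _ _ _ (vertical_notMem_range j)]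
  exact RingHom.congr_fun h2 f

/-- The toric variety of the `j`-th polytope as a closed subscheme of the central fiber. -/
def centralι (j : ι) : (Γ.piece j).toricVariety ⟶ fiberOver pot.family 0 :=
  pullback.lift (pot.pieceι j) (Γ.piece j).toricStructure (pot.pieceι_family j)

/-- The inclusion of the central fiber. -/
def fiberι : fiberOver pot.family 0 ⟶ pot.totalSpace :=
  pullback.fst pot.family (complexLinePoint 0)

theorem isClosedImmersion_complexLinePoint (a : ℂ) : IsClosedImmersion (complexLinePoint a) :=
  IsClosedImmersion.spec_of_surjective _ fun c => ⟨C c, Polynomial.eval_C⟩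

instance isClosedImmersion_fiberι : IsClosedImmersion pot.fiberι := by
  have := isClosedImmersion_complexLinePoint 0
  exact inferInstanceAs (IsClosedImmersion (pullback.fst pot.family (complexLinePoint 0)))

theorem centralι_fiberι (j : ι) : pot.centralι j ≫ pot.fiberι = pot.pieceι j :=
  pullback.lift_fst _ _ _

theorem centralι_fiberStructure (j : ι) :
    pot.centralι j ≫ fiberStructure pot.family 0 = (Γ.piece j).toricStructure :=
  pullback.lift_snd _ _ _

instance (j : ι) : IsClosedImmersion (pot.centralι j) := by
  have h1 : IsClosedImmersion (pot.centralι j ≫ pot.fiberι) := by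
    rw [centralι_fiberι]
    infer_instance
  exact IsClosedImmersion.of_comp_isClosedImmersion _ pot.fiberι

theorem mem_range_centralι_iff {j : ι} {z : fiberOver pot.family 0} :
    z ∈ Set.range (pot.centralι j) ↔ pot.fiberι z ∈ Set.range (pot.pieceι j) := by
  have hcomp : ∀ u, pot.fiberι (pot.centralι j u) = pot.pieceι j u := fun u => by
    rw [← centralι_fiberι]
    rfl
  constructor
  · rintro ⟨u, rfl⟩
    exact ⟨u, (hcomp u).symm⟩
  · rintro ⟨u, hu⟩
    exact ⟨u, pot.fiberι.isClosedEmbedding.injective ((hcomp u).trans hu)⟩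

theorem mem_range_pieceι {j : ι} {y : pot.totalSpace} :
    y ∈ Set.range (pot.pieceι j) ↔ ∀ x ∉ Set.range (pot.faceHom j),
      y ∉ Proj.basicOpen (monoidGrading pot.totalMonoid) (single x 1) := by
  obtain ⟨v, hv⟩ := (Γ.piece j).exists_mem_carrier
  exact mem_range_faceι _ _ _ _ ((Γ.piece j).mem_coneMonoid_one.2 hv) y

theorem notMem_basicOpen_vertical (z : fiberOver pot.family 0) : pot.fiberι z ∉
    Proj.basicOpen (monoidGrading pot.totalMonoid) (single pot.vertical 1) := by
  have h : pot.fiberι z ∈ Set.range pot.fiberι := ⟨z, rfl⟩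
  have h1 : Set.range pot.fiberι = _ :=
    range_fst_complexLinePoint_zero isCoveredInDegreeOne_totalMonoid pot.degree_vertical
  rw [h1] at h
  exact h

/-- The toric varieties of the polytopes cover the central fiber. -/
theorem exists_mem_range_centralι [Finite ι] (z : fiberOver pot.family 0) :
    ∃ j, z ∈ Set.range (pot.centralι j) := by
  classical
  cases nonempty_fintype ι
  by_contra hcon
  push Not at hcon
  simp only [mem_range_centralι_iff, mem_range_pieceι] at hcon
  push Not at hcon
  choose x hx hxz using hcon
  -- the product of characters outside the faces is divisible by the parameter
  have h1 : ∑ j, x j ∉ ⋃ j, Set.range (pot.faceHom j) := by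
    intro h
    obtain ⟨j, hj⟩ := Set.mem_iUnion.1 h
    rw [← Finset.add_sum_erase _ _ (Finset.mem_univ j)] at hj
    exact hx j (isFace_range_faceHom j _ _ hj)
  obtain ⟨y, hy⟩ := exists_eq_vertical_add (x := ∑ j, x j) fun j hj => h1 (Set.mem_iUnion.2 ⟨j, hj⟩)
  have h2 : ∀ S : Finset ι, pot.fiberι z ∈
      Proj.basicOpen (monoidGrading pot.totalMonoid) (single (∑ j ∈ S, x j) 1) := by
    intro S
    induction S using Finset.induction_on with
    | empty =>
      rw [Finset.sum_empty]
      change _ ∈ Proj.basicOpen (monoidGrading pot.totalMonoid) 1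
      rw [Proj.basicOpen_one]
      trivial
    | insert j S hj ih =>
      rw [Finset.sum_insert hj, single_add_one, Proj.basicOpen_mul]
      exact ⟨hxz j, ih⟩
  have h3 := h2 Finset.univ
  rw [hy, single_add_one, Proj.basicOpen_mul] at h3
  exact pot.notMem_basicOpen_vertical z h3.1

end SimplicialPartition.Potential

end CentralFiber

/-! ### The components of the central fiber -/

noncomputable section Components

open AddMonoidAlgebra hiding coeff

variable {n : ℕ} {P : LatticePolytope n} {ι : Type*} {Γ : SimplicialPartition P ι}

theorem LatticePolytope.IsSimplicial.interior_nonempty (hP : P.IsSimplicial) :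
    (interior P.carrier).Nonempty := by
  obtain ⟨x, hx⟩ := P.carrier_nonempty
  obtain ⟨m⟩ := hP.exists_localModel hx
  obtain ⟨y, -, hy, -⟩ := m.exists_mem_interior Filter.univ_mem
  exact ⟨y, hy⟩

theorem LatticePolytope.subset_of_lattice_points {Q R : LatticePolytope n}
    (h : ∀ v, latticeToReal v ∈ Q.carrier → latticeToReal v ∈ R.carrier) :
    Q.carrier ⊆ R.carrier := by
  obtain ⟨V, -, hV⟩ := Q.exists_points
  rw [hV]
  refine convexHull_min ?_ R.carrier_convex
  rintro _ ⟨v, hv, rfl⟩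
  exact h v (hV ▸ subset_convexHull ℝ _ ⟨v, hv, rfl⟩)

theorem SimplicialPartition.eq_of_piece_subset {j k : ι}
    (h : (Γ.piece j).carrier ⊆ (Γ.piece k).carrier) : j = k := by
  by_contra hjk
  obtain ⟨y, hy⟩ := (Γ.simplicial j).interior_nonempty
  exact Set.disjoint_left.1 (Γ.disjoint_interior j k hjk) hy (interior_mono h hy)

namespace SimplicialPartition.Potential

/-- The elements of degree one in the face of the `k`-th polytope come from lattice points of this
polytope. -/
theorem latticeToReal_mem_of_mem_range {pot : Γ.Potential} {k : ι} {x : pot.totalMonoid}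
    (hx : x ∈ Set.range (pot.faceHom k)) (hdeg : x.1.2 = 1) :
    latticeToReal x.1.1.1 ∈ (Γ.piece k).carrier := by
  obtain ⟨⟨⟨v, d⟩, hy⟩, rfl⟩ := hx
  change d = 1 at hdeg
  subst hdeg
  exact (Γ.piece k).mem_coneMonoid_one.1 hy

/-- Polytopes of the partition with a common point have a common lattice point: a vertex of the
first one on the face where the difference of the affine functions vanishes. -/
theorem exists_lattice_point (pot : Γ.Potential) {S : Set ι} (hS : S.Nonempty)
    (h : (⋂ k ∈ S, (Γ.piece k).carrier).Nonempty) :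
    ∃ v, ∀ j ∈ S, latticeToReal v ∈ (Γ.piece j).carrier := by
  obtain ⟨i, hi⟩ := hS
  obtain ⟨y, hy⟩ := h
  have hy' : ∀ k ∈ S, y ∈ (Γ.piece k).carrier := fun k hk => Set.mem_iInter₂.1 hy k hk
  obtain ⟨V, -, hV⟩ := (Γ.piece i).exists_points
  have hVi : ∀ v ∈ V, latticeToReal v ∈ (Γ.piece i).carrier := fun v hv =>
    hV ▸ subset_convexHull ℝ _ ⟨v, hv, rfl⟩
  obtain ⟨a, ha0, ha1, hay⟩ := ((Γ.piece i).exists_weights hV zero_le_one (y := y)).1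
    (by rw [one_smul]; exact hy' i hi)
  obtain ⟨v, hv, hva⟩ : ∃ v ∈ V, a v ≠ 0 :=
    Finset.exists_ne_zero_of_sum_ne_zero (by rw [ha1]; exact one_ne_zero)
  refine ⟨v, fun j hj => pot.mem_of_eq i j _ (hVi v hv) ?_⟩
  have hsum : ∀ k, ∑ v ∈ V, a v * affineValue (pot.form k) (latticeToReal v) =
      affineValue (pot.form k) y := by
    intro k
    simp only [affineValue, mul_add, Finset.sum_add_distrib, ← Finset.sum_mul, ha1, one_mul, ← hay,
      map_sum, map_smul, smul_eq_mul]
  have h1 : ∑ v ∈ V, a v * (affineValue (pot.form i) (latticeToReal v) -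
      affineValue (pot.form j) (latticeToReal v)) = 0 := by
    simp only [mul_sub, Finset.sum_sub_distrib, hsum]
    exact sub_eq_zero.2 (le_antisymm (pot.le j i y (hy' j hj)) (pot.le i j y (hy' i hi)))
  have h2 := (Finset.sum_eq_zero_iff_of_nonneg fun u hu =>
    mul_nonneg (ha0 u hu) (sub_nonneg.2 (pot.le i j _ (hVi u hu)))).1 h1 v hv
  exact (sub_eq_zero.1 ((mul_eq_zero.1 h2).resolve_left hva)).symm

variable (pot : Γ.Potential)

/-- The common face of the lower faces of the monoid of the total space which belong to the polytopes
in `S`. -/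
def sharedFace (S : Set ι) : AddSubmonoid (((Fin n → ℤ) × ℤ) × ℕ) where
  carrier := {x | x ∈ pot.totalMonoid ∧ ∀ j ∈ S, x.1.2 = pot.height j (x.1.1, x.2)}
  zero_mem' := ⟨zero_mem _, fun j _ => (map_zero (pot.height j)).symm⟩
  add_mem' := fun {x y} hx hy => ⟨add_mem hx.1 hy.1, fun j hj =>
    (congrArg₂ (· + ·) (hx.2 j hj) (hy.2 j hj)).trans
      (map_add (pot.height j) (x.1.1, x.2) (y.1.1, y.2)).symm⟩

theorem sharedFace_le (S : Set ι) : pot.sharedFace S ≤ pot.totalMonoid := fun _ hx => hx.1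

/-- The inclusion of the common face. -/
def sharedHom (S : Set ι) : pot.sharedFace S →+ pot.totalMonoid :=
  AddSubmonoid.inclusion (pot.sharedFace_le S)

theorem sharedHom_injective (S : Set ι) : Function.Injective (pot.sharedHom S) :=
  AddSubmonoid.inclusion_injective _

variable {pot}

theorem mem_range_sharedHom {S : Set ι} {x : pot.totalMonoid} :
    x ∈ Set.range (pot.sharedHom S) ↔ ∀ j ∈ S, x ∈ Set.range (pot.faceHom j) := by
  simp only [mem_range_faceHom]
  constructor
  · rintro ⟨y, rfl⟩
    exact y.2.2
  · exact fun h => ⟨⟨x.1, x.2, h⟩, rfl⟩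

theorem isFace_range_sharedHom (S : Set ι) (x y : pot.totalMonoid)
    (h : x + y ∈ Set.range (pot.sharedHom S)) : x ∈ Set.range (pot.sharedHom S) := by
  rw [mem_range_sharedHom] at h ⊢
  exact fun j hj => isFace_range_faceHom j x y (h j hj)

theorem mem_sharedFace {S : Set ι} {i : ι} (hi : i ∈ S) {v : Fin n → ℤ}
    (hv : ∀ j ∈ S, latticeToReal v ∈ (Γ.piece j).carrier) :
    ((v, pot.height i (v, 1)), 1) ∈ pot.sharedFace S := by
  have h : ∀ j ∈ S, (v, 1) ∈ (Γ.piece j).coneMonoid := fun j hj =>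
    (Γ.piece j).mem_coneMonoid_one.2 (hv j hj)
  exact ⟨mem_totalMonoid_of_mem (j := i) (h i hi) le_rfl, fun j hj =>
    le_antisymm (height_le i (h j hj)) (height_le j (h i hi))⟩

variable (pot)

/-- The generic point of the stratum of the common face of the polytopes in `S` lies on exactly those
toric subvarieties whose polytope contains this face. -/
theorem exists_point {S : Set ι} (hS : S.Nonempty) {v : Fin n → ℤ}
    (hv : ∀ j ∈ S, latticeToReal v ∈ (Γ.piece j).carrier) :
    ∃ z : fiberOver pot.family 0, (∀ j ∈ S, z ∈ Set.range (pot.centralι j)) ∧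
      ∀ k, z ∈ Set.range (pot.centralι k) → ∀ u, (∀ j ∈ S, latticeToReal u ∈ (Γ.piece j).carrier) →
        latticeToReal u ∈ (Γ.piece k).carrier := by
  obtain ⟨i, hi⟩ := hS
  let q := faceι (pot.sharedHom S) (pot.sharedHom_injective S) (isFace_range_sharedHom S)
    fun _ => rfl
  have hw := mem_sharedFace (pot := pot) hi hv
  let y : pot.totalSpace := q (genericPt hw)
  have hy : ∀ j ∈ S, y ∈ Set.range (pot.pieceι j) := by
    intro j hj
    refine pot.mem_range_pieceι.2 fun x hx => ?_
    exact (mem_range_faceι _ _ _ _ hw y).1 ⟨_, rfl⟩ x fun h => hx (mem_range_sharedHom.1 h j hj)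
  obtain ⟨u, hu⟩ := hy i hi
  have hz : pot.fiberι (pot.centralι i u) = y := by
    rw [← hu, ← centralι_fiberι]
    rfl
  refine ⟨pot.centralι i u, fun j hj => ?_, fun k hk u' hu' => ?_⟩
  · rw [mem_range_centralι_iff, hz]
    exact hy j hj
  · rw [mem_range_centralι_iff, hz, mem_range_pieceι] at hk
    have hx := mem_sharedFace (pot := pot) hi hu'
    by_contra hcon
    refine hk (pot.sharedHom S ⟨_, hx⟩) (fun h => hcon (latticeToReal_mem_of_mem_range h rfl)) ?_
    exact faceι_genericPt_mem_basicOpen _ _ _ _ hw ⟨_, hx⟩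

/-- At a common point of the central fiber some character of degree one does not vanish, and its
lattice point is common to the polytopes. -/
theorem exists_common_point {S : Set ι} {z : fiberOver pot.family 0}
    (hz : ∀ j ∈ S, z ∈ Set.range (pot.centralι j)) :
    (⋂ k ∈ S, (Γ.piece k).carrier).Nonempty := by
  obtain ⟨w, hw, h⟩ := isCoveredInDegreeOne_totalMonoid.exists_mem_basicOpen (pot.fiberι z)
  refine ⟨latticeToReal w.1, Set.mem_iInter₂.2 fun j hj => ?_⟩
  have h1 := pot.mem_range_centralι_iff.1 (hz j hj)
  rw [mem_range_pieceι] at h1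
  exact latticeToReal_mem_of_mem_range (not_not.1 fun hx => h1 ⟨_, hw⟩ hx h) rfl

/-- The components of the central fiber are the toric varieties of the polytopes. -/
theorem exists_equiv_components [Finite ι] :
    ∃ e : ι ≃ irreducibleComponents (fiberOver pot.family 0),
      ∀ j, (e j : Set (fiberOver pot.family 0)) = Set.range (pot.centralι j) := by
  refine exists_equiv_irreducibleComponents _
    (fun j => (pot.centralι j).isClosedEmbedding.isClosed_range) (fun j => ?_)
    pot.exists_mem_range_centralι fun j k h => ?_
  · have := (Γ.piece j).isIntegral_toricVariety
    rw [← Set.image_univ]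
    exact (irreducibleSpace_def _).1 inferInstance |>.image _
      (pot.centralι j).isClosedEmbedding.continuous.continuousOn
  · obtain ⟨v, hv⟩ := (Γ.piece j).exists_mem_carrier
    obtain ⟨z, hz1, hz2⟩ := pot.exists_point (Set.singleton_nonempty j) (v := v) (by simpa using hv)
    refine Γ.eq_of_piece_subset (LatticePolytope.subset_of_lattice_points fun u hu => ?_)
    exact hz2 k (h (hz1 j rfl)) u (by simpa using hu)

end SimplicialPartition.Potential

end Components

theorem mainTheorem6 {n : ℕ} (P : LatticePolytope n) (hP : P.IsSimplicial)
    {ι : Type*} [Finite ι] (Γ : SimplicialPartition P ι)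
    (hss : Γ.IsSemistable) (hms : Γ.IsMildlySingular)
    (htriple : Γ.TriplesMeetAtNonsingularVertex) :
    ∃ (Y : Scheme) (p : Y ⟶ complexLine),
      IsWeakSemistableDegeneration p P.toricStructure ∧
      ∃ e : ι ≃ irreducibleComponents (fiberOver p 0),
        (∀ S : Set ι, S ∈ Γ.dualComplex ↔ e '' S ∈ componentDualComplex (fiberOver p 0)) ∧
        ∀ j, ∃ f : (Γ.piece j).toricVariety ≅ reducedComponent (e j),
          f.hom ≫ reducedComponentι (e j) ≫ fiberStructure p 0 = (Γ.piece j).toricStructure := by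
  obtain ⟨pot⟩ := hss.exists_potential hP hms.1 htriple
  refine ⟨pot.totalSpace, pot.family, ⟨⟨pot.isIntegral_totalSpace, pot.isProper_family,
    pot.flat_family, pot.isReduced_fiberOver, pot.exists_isToroidalAt_family hP.interior_nonempty⟩,
    pot.exists_punctured_iso⟩, ?_⟩
  obtain ⟨e, he⟩ := pot.exists_equiv_components
  refine ⟨e, fun S => ?_, fun j => ?_⟩
  · have hinter : (⋂ C ∈ e '' S, (C : Set (fiberOver pot.family 0))) =
        ⋂ j ∈ S, Set.range (pot.centralι j) := by
      rw [Set.biInter_image]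
      simp only [he]
    rw [hss.mem_dualComplex_iff hP]
    constructor
    · rintro ⟨hS, h⟩
      obtain ⟨v, hv⟩ := pot.exists_lattice_point hS h
      obtain ⟨z, hz, -⟩ := pot.exists_point hS hv
      refine ⟨hS.image e, Set.toFinite _, z, ?_⟩
      rw [hinter]
      exact Set.mem_iInter₂.2 hz
    · rintro ⟨hS, -, z, hz⟩
      rw [hinter] at hz
      exact ⟨hS.of_image, pot.exists_common_point fun j hj => Set.mem_iInter₂.1 hz j hj⟩
  · have := (Γ.piece j).isIntegral_toricVariety
    obtain ⟨f, hf⟩ := exists_iso_reducedComponent (pot.centralι j) (e j) (he j)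
    refine ⟨f, ?_⟩
    rw [← Category.assoc, hf]
    exact pot.centralι_fiberStructure j
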